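/- \textbf{Theorem.} Let $X$ be a smooth connected separated scheme of finite type over $\mathbb C$, of dimension $n\ge 1$, and let $\mathfrak E=(E,\phi)$ be a Higgs bundle of rank $r$ on $X$: $E$ is a locally free sheaf of rank $r$ and $\phi\colon E\to E\otimes\Omega^1_X$ is $\mathcal O_X$-linear with $\phi\wedge\phi=0$. Let $\rho_1\colon \mathrm{Hgrass}_1(\mathfrak E)\to X$ be the Higgs Grassmannian of lines, that is, the closed subscheme of the bundle $\mathbb P(E)$ of lines in the fibers of $E$ that parametrizes the $\phi$-invariant lines. Over an open set with a frame $e_1,\dots,e_r$ of $E$ and a frame $\omega_1,\dots,\omega_n$ of $\Omega^1_X$, in which $\phi(e_j)=\sum_{k}\sum_i \phi^{(k)}_{ij}\,e_i\otimes\omega_k$, it is given in the homogeneous coordinates $z_1,\dots,z_r$ by the equations $\sum_{l} z_l\,(\phi^{(k)}_{jl}z_i-\phi^{(k)}_{il}z_j)=0$ for all $k$ and all $i<j$. Let $U\subset X$ be an open set over which $E$ and $\Omega^1_X$ have frames as above, and suppose that $\phi^{(1)}$ is block diagonal with upper triangular Jordan blocks $\phi^{(1)}_1,\dots,\phi^{(1)}_s$,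 where $\phi^{(1)}_v$ has size $i_v\ge 1$ and eigenvalue $\lambda_v\in\mathcal O_X(U)$, $\sum_v i_v=r$, and $\lambda_v-\lambda_w$ vanishes nowhere on $U$ for $v\ne w$. For $v=1,\dots,s$, let $E_v\subset E|_U$ be the generalized eigensheaf of $\phi^{(1)}$ for the eigenvalue $\lambda_v$. For an $m\times m$ matrix $M$ over $\mathcal O_X(U)$ let $V_M\subset\mathbb P^{m-1}_U$ be the closed subscheme defined by the forms $\sum_k z_k(M_{jk}z_i-M_{ik}z_j)$, $1\le i<j\le m$. Then: (1) $E_v$ is free of rank $i_v$, with frame the part of $(e_j)$ belonging to the $v$-th block, and it is $\phi$-invariant; thus $(E_v,\phi_v)$ with $\phi_v=\phi|_{E_v}$ is a Higgs bundle on $U$. (2) The inclusions $E_v\subset E|_U$ induce morphisms $\mathrm{Hgrass}_1(E_v,\phi_v)\to\mathrm{Hgrass}_1(\mathfrak E)$, which identify $\rho_1^{-1}(U)$, as a scheme over $U$, with the disjoint union $\coprod_{v=1}^s\mathrm{Hgrass}_1(E_v,\phi_v)$. (3) For every $v$, the homogeneous coordinates of the frame of $E_v$ in (1) give an isomorphism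 $\mathrm{Hgrass}_1(E_v,\phi_v)\cong V_{\phi^{(1)}_v}$ of schemes over $U$. (4) For every point $y\in U$, the fiber $\rho_1^{-1}(y)$ is a zero-dimensional scheme, finite of degree $r$ over the residue field $\kappa(y)$. Under the identification in (2) it is the disjoint union of the fibers over $y$ of the schemes $\mathrm{Hgrass}_1(E_v,\phi_v)$, $v=1,\dots,s$. The $v$-th of these is a finite $\kappa(y)$-scheme of length $i_v$ that has a single point and is curvilinear (its Zariski cotangent space has dimension at most $1$). -/

import Mathlib

namespace HiggsGrass

open CategoryTheory Limits AlgebraicGeometry TensorProduct DirectSum Module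

noncomputable section

section

section Grading

variable {A S : Type} [CommRing A] [CommRing S] [Algebra A S]

/-- The grading induced on a quotient `S ⧸ I` of a graded algebra. -/
def quotGrading (𝒮 : ℕ → Submodule A S) (I : Ideal S) (n : ℕ) : Submodule A (S ⧸ I) :=
  (𝒮 n).map (Ideal.Quotient.mkₐ A I).toLinearMap

/-- The degree-wise projection to the quotient. -/
def quotGradingProj (𝒮 : ℕ → Submodule A S) (I : Ideal S) (n : ℕ) :
    𝒮 n →ₗ[A] quotGrading 𝒮 I n :=
  (Ideal.Quotient.mkₐ A I).toLinearMap.restrict fun x hx => ⟨x, hx, rfl⟩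

instance quotGrading_gradedMonoid (𝒮 : ℕ → Submodule A S) [SetLike.GradedMonoid 𝒮] (I : Ideal S) :
    SetLike.GradedMonoid (quotGrading 𝒮 I) where
  one_mem := ⟨1, SetLike.GradedOne.one_mem, map_one (Ideal.Quotient.mk I)⟩
  mul_mem := by
    rintro i j _ _ ⟨x, hx, rfl⟩ ⟨y, hy, rfl⟩
    exact ⟨x * y, SetLike.GradedMul.mul_mem hx hy, map_mul (Ideal.Quotient.mkₐ A I) x y⟩

/-- The quotient of a graded algebra by a homogeneous ideal is graded. -/
@[reducible]
def quotGradedAlgebra (𝒮 : ℕ → Submodule A S) [GradedAlgebra 𝒮] (I : Ideal S)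
    (hI : I.IsHomogeneous 𝒮) : GradedAlgebra (quotGrading 𝒮 I) := by
  classical
  let F : (⨁ n, 𝒮 n) →ₗ[A] ⨁ n, quotGrading 𝒮 I n :=
    DirectSum.lmap (quotGradingProj 𝒮 I)
  let G : S →ₗ[A] ⨁ n, quotGrading 𝒮 I n := F ∘ₗ (DirectSum.decomposeLinearEquiv 𝒮).toLinearMap
  have hG : ∀ s ∈ I, G s = 0 := by
    intro s hs
    refine DirectSum.ext_component A fun n => ?_
    apply Subtype.ext
    exact Ideal.Quotient.eq_zero_iff_mem.mpr (hI n hs)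
  have hGof : ∀ n (x : S) (hx : x ∈ 𝒮 n), G x = DirectSum.lof A ℕ (fun n => quotGrading 𝒮 I n) n ⟨Ideal.Quotient.mk I x, x, hx, rfl⟩ := by
    intro n x hx
    lift x to 𝒮 n using hx
    simp only [G, F, LinearMap.comp_apply, LinearEquiv.coe_coe, DirectSum.decomposeLinearEquiv_apply, DirectSum.decompose_coe]
    erw [DirectSum.lmap_lof]
    rfl
  let H : (S ⧸ I) →+ ⨁ n, quotGrading 𝒮 I n :=
    QuotientAddGroup.lift (Submodule.toAddSubgroup I) G.toAddMonoidHom fun s hs => hG s hs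
  have hH : ∀ s, H (Ideal.Quotient.mk I s) = G s := fun s => rfl
  refine { toDecomposition := ⟨H, ?_, ?_⟩ }
  · intro x
    obtain ⟨s, rfl⟩ := Ideal.Quotient.mk_surjective x
    rw [hH]
    induction s using DirectSum.Decomposition.inductionOn 𝒮 with
    | zero => simp
    | homogeneous x =>
      rw [hGof _ x.1 x.2, DirectSum.lof_eq_of, DirectSum.coeAddMonoidHom_of]
    | add a b ha hb => rw [map_add, map_add, map_add, ha, hb]
  · intro x
    induction x using DirectSum.induction_on with
    | zero => simp
    | of n x =>
      obtain ⟨_, x, hx, rfl⟩ := x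
      rw [DirectSum.coeAddMonoidHom_of]
      exact hGof n x hx
    | add a b ha hb => rw [map_add, map_add, ha, hb]

end Grading

section Sym

variable (A D : Type) [CommRing A] [AddCommGroup D] [Module A D]

/-- The grading of the symmetric algebra. -/
abbrev symGrading : ℕ → Submodule A (SymmetricAlgebra A D) :=
  fun n => LinearMap.range (SymmetricAlgebra.ι A D) ^ n

variable {A D} in
theorem ι_mem_symGrading (x : D) : SymmetricAlgebra.ι A D x ∈ symGrading A D 1 := by
  rw [symGrading, pow_one]; exact ⟨x, rfl⟩

/-- The inclusion of the generators into the direct sum of the graded pieces. -/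
def symGradingι : D →ₗ[A] ⨁ n, symGrading A D n :=
  DirectSum.lof A ℕ (fun n => symGrading A D n) 1 ∘ₗ
    (SymmetricAlgebra.ι A D).codRestrict _ ι_mem_symGrading

theorem symGradingι_apply (x : D) : symGradingι A D x =
    DirectSum.of (fun n => symGrading A D n) 1 ⟨SymmetricAlgebra.ι A D x, ι_mem_symGrading x⟩ :=
  rfl

instance symGradedAlgebra : GradedAlgebra (symGrading A D) := by
  refine GradedAlgebra.ofAlgHom _ (SymmetricAlgebra.lift (symGradingι A D)) ?_ ?_
  · apply SymmetricAlgebra.algHom_ext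
    ext m
    change (DirectSum.coeAlgHom (symGrading A D)) (SymmetricAlgebra.lift (symGradingι A D)
      (SymmetricAlgebra.ι A D m)) = SymmetricAlgebra.ι A D m
    rw [SymmetricAlgebra.lift_ι_apply, symGradingι_apply, DirectSum.coeAlgHom_of]
  · rintro n ⟨x, hx⟩
    dsimp only [Subtype.coe_mk, DirectSum.lof_eq_of]
    induction hx using Submodule.pow_induction_on_left' with
    | algebraMap r =>
      rw [AlgHom.commutes, DirectSum.algebraMap_apply]; rfl
    | add x y i hx hy ihx ihy =>
      rw [map_add, ihx, ihy, ← map_add]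
      rfl
    | mem_mul m hm i x hx ih =>
      obtain ⟨m, rfl⟩ := hm
      rw [map_mul, ih, SymmetricAlgebra.lift_ι_apply, symGradingι_apply, DirectSum.of_mul_of]
      exact DirectSum.of_eq_of_gradedMonoid_eq (Sigma.subtype_ext (add_comm _ _) rfl)

end Sym

end

section

section Away

/-- A ring homomorphism that exhibits its target as the localization away from `f`. -/
structure IsAwayHom {S T : Type} [CommRing S] [CommRing T] (f : S) (h : S →+* T) : Prop where
  unit : IsUnit (h f)
  surj : ∀ t, ∃ (n : ℕ) (s : S), t * h f ^ n = h s
  ker : ∀ s, h s = 0 → ∃ n : ℕ, f ^ n * s = 0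

variable {S T : Type} [CommRing S] [CommRing T]

theorem IsAwayHom.of_isLocalization (f : S) [Algebra S T] [IsLocalization.Away f T] :
    IsAwayHom f (algebraMap S T) where
  unit := IsLocalization.Away.algebraMap_isUnit f
  surj t := by
    obtain ⟨n, a, h⟩ := IsLocalization.Away.surj f t
    exact ⟨n, a, by simpa using h⟩
  ker s hs := by
    obtain ⟨⟨_, n, rfl⟩, h⟩ := (IsLocalization.map_eq_zero_iff (.powers f) T s).mp hs
    exact ⟨n, h⟩

theorem IsAwayHom.isLocalization {f : S} {h : S →+* T} (H : IsAwayHom f h) :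
    letI := h.toAlgebra; IsLocalization.Away f T := by
  let := h.toAlgebra
  constructor
  constructor
  · rintro ⟨_, n, rfl⟩
    exact (map_pow h f n) ▸ H.unit.pow n
  · intro t
    obtain ⟨n, s, hs⟩ := H.surj t
    exact ⟨⟨s, ⟨_, n, rfl⟩⟩, (congrArg (t * ·) (map_pow h f n)).trans hs⟩
  · intro a b hab
    obtain ⟨n, hn⟩ := H.ker (a - b) (by
      rw [map_sub]; exact sub_eq_zero.mpr hab)
    exact ⟨⟨_, n, rfl⟩, by linear_combination hn⟩

/-- Localization commutes with quotients. -/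
theorem IsAwayHom.quotient {f : S} {h : S →+* T} (H : IsAwayHom f h) (I : Ideal S) (J : Ideal T)
    (hIJ : J = I.map h) :
    IsAwayHom (Ideal.Quotient.mk I f)
      (Ideal.quotientMap J h (by rw [hIJ]; exact Ideal.le_comap_map)) where
  unit := by
    rw [Ideal.quotientMap_mk]
    exact H.unit.map _
  surj t := by
    obtain ⟨t, rfl⟩ := Ideal.Quotient.mk_surjective t
    obtain ⟨n, s, hs⟩ := H.surj t
    refine ⟨n, Ideal.Quotient.mk I s, ?_⟩
    rw [Ideal.quotientMap_mk, Ideal.quotientMap_mk, ← hs, map_mul, map_pow]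
  ker s hs := by
    obtain ⟨s, rfl⟩ := Ideal.Quotient.mk_surjective s
    rw [Ideal.quotientMap_mk, Ideal.Quotient.eq_zero_iff_mem, hIJ] at hs
    let := h.toAlgebra
    have := H.isLocalization
    obtain ⟨⟨⟨i, hi⟩, ⟨_, n, rfl⟩⟩, h1⟩ :=
      (IsLocalization.mem_map_algebraMap_iff (.powers f) T).mp hs
    obtain ⟨m, hm⟩ := H.ker (s * f ^ n - i) (by
      rw [map_sub]; exact sub_eq_zero.mpr (by simpa [RingHom.algebraMap_toAlgebra] using h1))
    refine ⟨m + n, ?_⟩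
    rw [← map_pow, ← map_mul, Ideal.Quotient.eq_zero_iff_mem]
    have : f ^ (m + n) * s = f ^ m * i := by
      rw [pow_add]; linear_combination hm
    rw [this]
    exact I.mul_mem_left _ hi

end Away

section ProjAway

variable {A B σ τ : Type} [CommRing A] [SetLike σ A] [AddSubgroupClass σ A]
  [CommRing B] [SetLike τ B] [AddSubgroupClass τ B] {𝒜 : ℕ → σ} {ℬ : ℕ → τ}
  [GradedRing 𝒜] [GradedRing ℬ] {h : 𝒜 →+*ᵍ ℬ} {f : A}

theorem IsAwayHom.surj_homogeneous (hf : f ∈ 𝒜 0) (H : IsAwayHom f h.toRingHom) {i : ℕ} {t : B}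
    (ht : t ∈ ℬ i) : ∃ (n : ℕ) (s : A), s ∈ 𝒜 i ∧ t * h f ^ n = h s := by
  obtain ⟨n, s, hs⟩ := H.surj t
  refine ⟨n, DirectSum.decompose 𝒜 s i, SetLike.coe_mem _, ?_⟩
  have h1 : t * h f ^ n ∈ ℬ i := by
    have := SetLike.mul_mem_graded ht (SetLike.pow_mem_graded n (h.map_mem hf))
    simpa using this
  rw [GradedRingHom.map_directSumDecompose, ← DirectSum.decompose_of_mem_same ℬ h1]
  congr 3

theorem IsAwayHom.irrelevant_le (hf : f ∈ 𝒜 0) (H : IsAwayHom f h.toRingHom) :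
    HomogeneousIdeal.irrelevant ℬ ≤ (HomogeneousIdeal.irrelevant 𝒜).map h := by
  rw [HomogeneousIdeal.irrelevant_le]
  intro i hi t ht
  obtain ⟨n, s, hs, h1⟩ := H.surj_homogeneous hf ht
  have h2 : h s ∈ ((HomogeneousIdeal.irrelevant 𝒜).map h).toIdeal := by
    refine Ideal.mem_map_of_mem _ ?_
    exact HomogeneousIdeal.mem_irrelevant_of_mem 𝒜 hi hs
  rw [← h1] at h2
  exact (Ideal.mul_unit_mem_iff_mem _ (H.unit.pow n)).mp h2

theorem IsAwayHom.awayMap (hf : f ∈ 𝒜 0) (H : IsAwayHom f h.toRingHom) {i : ℕ} {s : A}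
    (hs : s ∈ 𝒜 i) :
    IsAwayHom (HomogeneousLocalization.fromZeroRingHom 𝒜 (.powers s) ⟨f, hf⟩)
      (HomogeneousLocalization.Away.map h s) := by
  have h0 : HomogeneousLocalization.Away.map h s
      (HomogeneousLocalization.fromZeroRingHom 𝒜 (.powers s) ⟨f, hf⟩) =
      HomogeneousLocalization.fromZeroRingHom ℬ (.powers (h s)) ⟨h f, h.map_mem hf⟩ := by
    apply HomogeneousLocalization.val_injective
    change Localization.mk (h f) ⟨h 1, _⟩ = Localization.mk (h f) 1
    congr 1
    exact Subtype.ext (map_one h)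
  refine ⟨?_, ?_, ?_⟩
  · rw [h0]
    refine IsUnit.map _ ?_
    obtain ⟨u, hu⟩ := H.unit.exists_right_inv
    change h f * u = 1 at hu
    refine isUnit_iff_exists_inv.mpr ⟨DirectSum.decompose ℬ u 0, ?_⟩
    apply Subtype.ext
    have := DirectSum.coe_decompose_mul_of_left_mem_of_le ℬ (b := u) (n := 0) (h.map_mem hf) le_rfl
    change h f * _ = 1
    refine this.symm.trans ?_
    change ((DirectSum.decompose ℬ (h f * u)) 0 : B) = 1
    rw [hu]
    exact DirectSum.decompose_of_mem_same ℬ SetLike.GradedOne.one_mem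
  · intro t
    obtain ⟨n, t, ht, rfl⟩ := HomogeneousLocalization.Away.mk_surjective ℬ (h.map_mem hs) t
    obtain ⟨m, x, hx, h1⟩ := H.surj_homogeneous hf ht
    refine ⟨m, HomogeneousLocalization.Away.mk 𝒜 hs n x hx, ?_⟩
    rw [h0, HomogeneousLocalization.Away.map_mk]
    apply HomogeneousLocalization.val_injective
    rw [HomogeneousLocalization.val_mul, HomogeneousLocalization.val_pow]
    have h2 : ∀ q : Submonoid.powers (h s), Localization.mk t q * Localization.mk (h f) 1 ^ m =
        Localization.mk (h x) q := fun q => by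
      rw [Localization.mk_pow, Localization.mk_mul, h1, one_pow, mul_one]
    exact h2 ⟨h s ^ n, n, rfl⟩
  · intro x hx
    obtain ⟨n, x, hx', rfl⟩ := HomogeneousLocalization.Away.mk_surjective 𝒜 hs x
    rw [HomogeneousLocalization.Away.map_mk] at hx
    have h1 := congrArg HomogeneousLocalization.val hx
    rw [HomogeneousLocalization.val_zero, HomogeneousLocalization.Away.val_mk,
      Localization.mk_eq_mk', IsLocalization.mk'_eq_zero_iff] at h1
    obtain ⟨⟨_, k, rfl⟩, h2⟩ := h1
    obtain ⟨m, hm⟩ := H.ker (s ^ k * x) (by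
      change h (s ^ k * x) = 0
      rw [map_mul, map_pow]; exact h2)
    refine ⟨m, ?_⟩
    apply HomogeneousLocalization.val_injective
    rw [HomogeneousLocalization.val_mul, HomogeneousLocalization.val_pow]
    change Localization.mk f 1 ^ m * Localization.mk x _ = _
    rw [HomogeneousLocalization.val_zero, Localization.mk_pow, Localization.mk_mul,
      Localization.mk_eq_mk', IsLocalization.mk'_eq_zero_iff]
    exact ⟨⟨_, k, rfl⟩, by change s ^ k * (f ^ m * x) = 0; linear_combination hm⟩

open Proj in
theorem IsAwayHom.specMap {S T : Type} [CommRing S] [CommRing T] {f : S} {h : S →+* T}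
    (H : IsAwayHom f h) : IsOpenImmersion (Spec.map (CommRingCat.ofHom h)) ∧
      Set.range (Spec.map (CommRingCat.ofHom h)) = (PrimeSpectrum.basicOpen f : Set (PrimeSpectrum S)) := by
  let := h.toAlgebra
  have := H.isLocalization
  exact ⟨IsOpenImmersion.of_isLocalization f, PrimeSpectrum.localization_away_comap_range T f⟩

theorem isPullback_awayι {i : ℕ} (hi : 0 < i) {s : A} (hs : s ∈ 𝒜 i)
    (hirr : HomogeneousIdeal.irrelevant ℬ ≤ (HomogeneousIdeal.irrelevant 𝒜).map h) :
    IsPullback (Proj.awayι ℬ (h s) (h.map_mem hs) hi)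
      (Spec.map (CommRingCat.ofHom (HomogeneousLocalization.Away.map h s)))
      (Proj.map h hirr) (Proj.awayι 𝒜 s hs hi) := by
  refine (IsOpenImmersion.isPullback _ _ _ _ ?_ ?_).flip
  · exact (Proj.awayι_comp_map h hirr hi s hs)
  · rw [Proj.opensRange_awayι, Proj.opensRange_awayι]
    rfl

variable (𝒜) in
theorem exists_awayι (x : Proj 𝒜) : ∃ (i : ℕ) (hi : 0 < i) (s : A) (hs : s ∈ 𝒜 i)
    (y : Spec (.of (HomogeneousLocalization.Away 𝒜 s))), Proj.awayι 𝒜 s hs hi y = x :=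
  let s := (Proj.affineOpenCover 𝒜).idx x
  ⟨s.1, s.1.2, s.2.1, s.2.2, (Proj.affineOpenCover 𝒜).covers x⟩

theorem IsAwayHom.projMap_isOpenImmersion (hf : f ∈ 𝒜 0) (H : IsAwayHom f h.toRingHom)
    (hirr : HomogeneousIdeal.irrelevant ℬ ≤ (HomogeneousIdeal.irrelevant 𝒜).map h) :
    IsOpenImmersion (Proj.map h hirr) := by
  refine IsZariskiLocalAtTarget.of_forall_exists_morphismRestrict (P := @IsOpenImmersion) fun x => ?_
  obtain ⟨i, hi, s, hs, y, rfl⟩ := exists_awayι 𝒜 x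
  refine ⟨(Proj.awayι 𝒜 s hs hi).opensRange, ⟨y, rfl⟩, ?_⟩
  refine ((MorphismProperty.arrow_mk_iso_iff @IsOpenImmersion
    (morphismRestrictOpensRange _ _))).mpr ?_
  have h1 := isPullback_awayι hi hs hirr
  have := (H.awayMap hf hs).specMap.1
  rw [← h1.isoPullback_hom_snd] at this
  exact (MorphismProperty.cancel_left_of_respectsIso @IsOpenImmersion _ _).mp this

theorem IsAwayHom.range_projMap (hf : f ∈ 𝒜 0) (H : IsAwayHom f h.toRingHom)
    (hirr : HomogeneousIdeal.irrelevant ℬ ≤ (HomogeneousIdeal.irrelevant 𝒜).map h) (x : Proj 𝒜) :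
    x ∈ Set.range (Proj.map h hirr) ↔
      Proj.toSpecZero 𝒜 x ∈ (PrimeSpectrum.basicOpen (⟨f, hf⟩ : 𝒜 0) : Set (PrimeSpectrum (𝒜 0))) := by
  obtain ⟨i, hi, s, hs, y, rfl⟩ := exists_awayι 𝒜 x
  have h4 := (H.awayMap hf hs).specMap.2
  rw [← Scheme.Hom.comp_apply, Proj.awayι_toSpecZero]
  change _ ↔ y ∈ (PrimeSpectrum.basicOpen (HomogeneousLocalization.fromZeroRingHom 𝒜 (.powers s)
    ⟨f, hf⟩) : Set (PrimeSpectrum _))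
  rw [← h4]
  constructor
  · rintro ⟨z, hz⟩
    obtain ⟨w, -, hw⟩ := Scheme.exists_preimage_of_isPullback
      (isPullback_awayι hi hs hirr) z y hz
    exact ⟨w, hw⟩
  · rintro ⟨w, hw⟩
    refine ⟨Proj.awayι ℬ (h s) (h.map_mem hs) hi w, ?_⟩
    rw [← hw, ← Scheme.Hom.comp_apply, ← Scheme.Hom.comp_apply, Proj.awayι_comp_map]

end ProjAway

end

section

section HiggsAlgebra

variable {A : Type} {M N : Type} [CommRing A] [AddCommGroup M] [Module A M]
  [AddCommGroup N] [Module A N]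

/-- The endomorphism `(id ⊗ ξ) ∘ φ` of `M` obtained by contracting `φ : M → M ⊗ N` with `ξ`. -/
def contract (φ : M →ₗ[A] M ⊗[A] N) (ξ : Dual A N) : M →ₗ[A] M :=
  (TensorProduct.rid A M).toLinearMap ∘ₗ LinearMap.lTensor M ξ ∘ₗ φ

/-- The quadratic equation on lines in `M` given by `α, β ∈ M^∨` and `ξ ∈ N^∨`; all of these vanish
on a line `L` exactly when `L` is invariant under `φ`. -/
def higgsRel (φ : M →ₗ[A] M ⊗[A] N) (p : Dual A M × Dual A M × Dual A N) :
    SymmetricAlgebra A (Dual A M) :=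
  SymmetricAlgebra.ι A _ p.1 * SymmetricAlgebra.ι A _ (p.2.1 ∘ₗ contract φ p.2.2) -
    SymmetricAlgebra.ι A _ p.2.1 * SymmetricAlgebra.ι A _ (p.1 ∘ₗ contract φ p.2.2)

/-- The ideal of the invariant lines in the coordinate ring `Sym M^∨` of the space of lines. -/
def higgsIdeal (φ : M →ₗ[A] M ⊗[A] N) : Ideal (SymmetricAlgebra A (Dual A M)) :=
  Ideal.span (Set.range (higgsRel φ))

theorem higgsIdeal_homogeneous (φ : M →ₗ[A] M ⊗[A] N) :
    (higgsIdeal φ).IsHomogeneous (symGrading A (Dual A M)) := by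
  refine Ideal.homogeneous_span _ _ ?_
  rintro _ ⟨p, rfl⟩
  refine ⟨1 + 1, ?_⟩
  exact sub_mem (SetLike.mul_mem_graded (ι_mem_symGrading _) (ι_mem_symGrading _))
    (SetLike.mul_mem_graded (ι_mem_symGrading _) (ι_mem_symGrading _))

/-- The homogeneous coordinate ring of the space of `φ`-invariant lines in `M`. -/
abbrev CoordRing (φ : M →ₗ[A] M ⊗[A] N) : Type :=
  SymmetricAlgebra A (Dual A M) ⧸ higgsIdeal φ

/-- The grading of the homogeneous coordinate ring. -/
abbrev coordGrading (φ : M →ₗ[A] M ⊗[A] N) : ℕ → Submodule A (CoordRing φ) :=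
  quotGrading (symGrading A (Dual A M)) (higgsIdeal φ)

instance coordGradedAlgebra (φ : M →ₗ[A] M ⊗[A] N) : GradedAlgebra (coordGrading φ) :=
  quotGradedAlgebra _ _ (higgsIdeal_homogeneous φ)

/-- A linear form on `M` as a linear coordinate. -/
def coord (φ : M →ₗ[A] M ⊗[A] N) (α : Dual A M) : CoordRing φ :=
  Ideal.Quotient.mk (higgsIdeal φ) (SymmetricAlgebra.ι A _ α)

end HiggsAlgebra

section ProjOver

variable {A S : Type} [CommRing A] [CommRing S] [Algebra A S] (𝒮 : ℕ → Submodule A S)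
  [GradedAlgebra 𝒮]

/-- The ring homomorphism from the base ring to the part of degree zero. -/
def toDegreeZero : A →+* 𝒮 0 where
  toFun a := ⟨algebraMap A S a, SetLike.algebraMap_mem_graded 𝒮 a⟩
  map_one' := Subtype.ext (map_one _)
  map_mul' a b := Subtype.ext (map_mul _ a b)
  map_zero' := Subtype.ext (map_zero _)
  map_add' a b := Subtype.ext (map_add _ a b)

/-- The structure morphism `Proj 𝒮 ⟶ Spec A` for a graded `A`-algebra. -/
def projToSpec : Proj 𝒮 ⟶ Spec (.of A) :=
  Proj.toSpecZero 𝒮 ≫ Spec.map (CommRingCat.ofHom (toDegreeZero 𝒮))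

end ProjOver

section Restriction

variable {A B : Type} [CommRing A] [CommRing B] {σ : A →+* B}

/-- The ring homomorphism of symmetric algebras induced by a semilinear map. -/
def symMap {D E : Type} [AddCommGroup D] [Module A D] [AddCommGroup E] [Module B E]
    (δ : D →ₛₗ[σ] E) : SymmetricAlgebra A D →+* SymmetricAlgebra B E :=
  let := ((algebraMap B (SymmetricAlgebra B E)).comp σ).toAlgebra
  (SymmetricAlgebra.lift (R := A) (A := SymmetricAlgebra B E)
    { toFun := fun x => SymmetricAlgebra.ι B E (δ x)
      map_add' := fun x y => by rw [map_add, map_add]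
      map_smul' := fun a x => by
        rw [map_smulₛₗ, map_smul, Algebra.smul_def, Algebra.smul_def]; rfl }).toRingHom

section
variable {D E : Type} [AddCommGroup D] [Module A D] [AddCommGroup E] [Module B E]
    (δ : D →ₛₗ[σ] E)

theorem symMap_ι (x : D) : symMap δ (SymmetricAlgebra.ι A D x) = SymmetricAlgebra.ι B E (δ x) := by
  let := ((algebraMap B (SymmetricAlgebra B E)).comp σ).toAlgebra
  exact SymmetricAlgebra.lift_ι_apply _ _

theorem symMap_algebraMap (a : A) :
    symMap δ (algebraMap A _ a) = algebraMap B (SymmetricAlgebra B E) (σ a) := by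
  let := ((algebraMap B (SymmetricAlgebra B E)).comp σ).toAlgebra
  exact AlgHom.commutes _ _

theorem symMap_mem {n : ℕ} {x : SymmetricAlgebra A D} (hx : x ∈ symGrading A D n) :
    symMap δ x ∈ symGrading B E n := by
  induction hx using Submodule.pow_induction_on_left' with
  | algebraMap r => 
    rw [symMap_algebraMap]
    exact SetLike.algebraMap_mem_graded (symGrading B E) _
  | add x y i hx hy ihx ihy => rw [map_add]; exact add_mem ihx ihy
  | mem_mul m hm i x hx ih =>
    obtain ⟨m, rfl⟩ := hm
    rw [map_mul, symMap_ι, Nat.succ_eq_add_one, add_comm]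
    exact SetLike.mul_mem_graded (ι_mem_symGrading _) ih

theorem symHom_ext {T : Type} [CommRing T] {g h : SymmetricAlgebra A D →+* T}
    (h1 : ∀ a, g (algebraMap A _ a) = h (algebraMap A _ a))
    (h2 : ∀ x, g (SymmetricAlgebra.ι A D x) = h (SymmetricAlgebra.ι A D x)) : g = h := by
  refine RingHom.ext fun x => ?_
  induction x using SymmetricAlgebra.induction with
  | algebraMap r => exact h1 r
  | ι x => exact h2 x
  | mul a b ha hb => rw [map_mul, map_mul, ha, hb]
  | add a b ha hb => rw [map_add, map_add, ha, hb]

theorem isAwayHom_symMap {f : A} (hσ : IsAwayHom f σ) {κ : Type} (b : Basis κ A D)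
    (c : Basis κ B E) (hbc : ∀ i, δ (b i) = c i) :
    IsAwayHom (algebraMap A (SymmetricAlgebra A D) f) (symMap δ) := by
  let := σ.toAlgebra
  have := hσ.isLocalization
  have h1 : IsAwayHom (MvPolynomial.C f) (MvPolynomial.map (σ := κ) σ) := by
    let : Algebra (MvPolynomial κ A) (MvPolynomial κ B) := MvPolynomial.algebraMvPolynomial
    have h3 : IsLocalization.Away (MvPolynomial.C (σ := κ) f) (MvPolynomial κ B) := by
      have := MvPolynomial.isLocalization (σ := κ) (Submonoid.powers f) B
      rwa [Submonoid.map_powers] at this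
    exact IsAwayHom.of_isLocalization (T := MvPolynomial κ B) (MvPolynomial.C (σ := κ) f)
  let p := SymmetricAlgebra.equivMvPolynomial b
  let q := SymmetricAlgebra.equivMvPolynomial c
  have h2 : (q : SymmetricAlgebra B E →+* MvPolynomial κ B).comp (symMap δ) =
      (MvPolynomial.map σ).comp (p : SymmetricAlgebra A D →+* MvPolynomial κ A) := by
    have h3 : (q : SymmetricAlgebra B E →+* MvPolynomial κ B).comp ((symMap δ).comp
        (p.symm : MvPolynomial κ A →+* SymmetricAlgebra A D)) = MvPolynomial.map σ := by
      refine MvPolynomial.ringHom_ext (fun a => ?_) (fun i => ?_)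
      · simp only [RingHom.comp_apply, RingHom.coe_coe, ← MvPolynomial.algebraMap_eq,
          AlgEquiv.commutes, symMap_algebraMap]
        simp [MvPolynomial.algebraMap_eq]
      · simp [p, q, SymmetricAlgebra.equivMvPolynomial_symm_X, symMap_ι, hbc]
    rw [← h3]
    refine RingHom.ext fun x => ?_
    simp
  have h2' : ∀ x, q (symMap δ x) = MvPolynomial.map σ (p x) := fun x => congr($h2 x)
  have hpf : p (algebraMap A _ f) = MvPolynomial.C f := p.commutes f
  have hqf : q (symMap δ (algebraMap A _ f)) = MvPolynomial.map σ (MvPolynomial.C f) := by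
    rw [h2', hpf]
  refine ⟨?_, fun t => ?_, fun s hs => ?_⟩
  · refine (MulEquiv.isUnit_map q).mp ?_
    rw [hqf]
    exact h1.unit
  · obtain ⟨n, s, h⟩ := h1.surj (q t)
    refine ⟨n, p.symm s, q.injective ?_⟩
    rw [map_mul, map_pow, hqf, h, h2', AlgEquiv.apply_symm_apply]
  · obtain ⟨n, h⟩ := h1.ker (p s) (by rw [← h2', hs, map_zero])
    refine ⟨n, p.injective ?_⟩
    rw [map_mul, map_pow, hpf, h, map_zero]

end

section

variable {M M' : Type} [AddCommGroup M] [Module A M] [AddCommGroup M'] [Module B M']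

/-- Every linear form on `M` extends uniquely along `ρ : M → M'`, and up to powers of `f` all linear
forms on `M'` arise in this way. -/
structure DualPair (f : A) (ρ : M →ₛₗ[σ] M') : Prop where
  ext : ∀ ℓ : Dual A M, ∃! ℓ' : Dual B M', ∀ m, ℓ' (ρ m) = σ (ℓ m)
  surj : ∀ ℓ' : Dual B M', ∃ (n : ℕ) (ℓ : Dual A M), ∀ m, σ f ^ n * ℓ' (ρ m) = σ (ℓ m)

variable {f : A} {ρ : M →ₛₗ[σ] M'}

/-- The extension of linear forms from `M` to `M'`. -/
def DualPair.map (h : DualPair f ρ) : Dual A M →ₛₗ[σ] Dual B M' where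
  toFun ℓ := (h.ext ℓ).choose
  map_add' ℓ₁ ℓ₂ := by
    refine ((h.ext (ℓ₁ + ℓ₂)).choose_spec.2 _ fun m => ?_).symm
    rw [LinearMap.add_apply, (h.ext ℓ₁).choose_spec.1, (h.ext ℓ₂).choose_spec.1,
      LinearMap.add_apply, map_add]
  map_smul' a ℓ := by
    refine ((h.ext (a • ℓ)).choose_spec.2 _ fun m => ?_).symm
    rw [LinearMap.smul_apply, (h.ext ℓ).choose_spec.1, LinearMap.smul_apply, smul_eq_mul,
      smul_eq_mul, map_mul]

theorem DualPair.map_apply (h : DualPair f ρ) (ℓ : Dual A M) (m : M) :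
    h.map ℓ (ρ m) = σ (ℓ m) :=
  (h.ext ℓ).choose_spec.1 m

theorem DualPair.eq_map (h : DualPair f ρ) {ℓ : Dual A M} {ℓ' : Dual B M'}
    (H : ∀ m, ℓ' (ρ m) = σ (ℓ m)) : ℓ' = h.map ℓ :=
  (h.ext ℓ).choose_spec.2 _ H

theorem DualPair.exists_smul (h : DualPair f ρ) (ℓ' : Dual B M') :
    ∃ (n : ℕ) (ℓ : Dual A M), σ f ^ n • ℓ' = h.map ℓ := by
  obtain ⟨n, ℓ, H⟩ := h.surj ℓ'
  exact ⟨n, ℓ, h.eq_map fun m => by rw [LinearMap.smul_apply, smul_eq_mul, H]⟩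

theorem semilinear_eq_of_basis {κ : Type} (b : Basis κ A M) (ℓ : Dual A M) (ℓ' : Dual B M') (a : B)
    (h : ∀ i, a * ℓ' (ρ (b i)) = σ (ℓ (b i))) (m : M) : a * ℓ' (ρ m) = σ (ℓ m) := by
  have hm : m ∈ Submodule.span A (Set.range b) := by rw [b.span_eq]; trivial
  induction hm using Submodule.span_induction with
  | mem x hx => obtain ⟨i, rfl⟩ := hx; exact h i
  | zero => simp
  | add x y _ _ hx hy => simp only [map_add, mul_add, hx, hy]
  | smul r x _ hx =>
    rw [map_smulₛₗ, map_smul, map_smul, smul_eq_mul, smul_eq_mul, map_mul, ← hx]; ring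

theorem dualPair_of_basis (hσ : IsAwayHom f σ) {κ : Type} [Finite κ] (b : Basis κ A M)
    (c : Basis κ B M') (hbc : ∀ i, ρ (b i) = c i) : DualPair f ρ where
  ext ℓ := by
    refine ⟨c.constr B fun i => σ (ℓ (b i)), fun m => ?_, fun ℓ' h => ?_⟩
    · have h1 := semilinear_eq_of_basis (ρ := ρ) b ℓ (c.constr B fun i => σ (ℓ (b i))) 1
        (fun i => by rw [hbc, Basis.constr_basis, one_mul]) m
      rwa [one_mul] at h1
    · refine c.ext fun i => ?_
      rw [← hbc, h, hbc, Basis.constr_basis]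
  surj ℓ' := by
    have := Fintype.ofFinite κ
    choose n s hs using fun i => hσ.surj (ℓ' (c i))
    refine ⟨∑ i, n i, b.constr A fun i => f ^ (∑ i, n i - n i) * s i, fun m => ?_⟩
    refine semilinear_eq_of_basis b _ _ _ (fun i => ?_) m
    have h1 : n i ≤ ∑ i, n i := Finset.single_le_sum (fun _ _ => Nat.zero_le _) (Finset.mem_univ i)
    rw [hbc, Basis.constr_basis, map_mul, map_pow, ← hs]
    conv_lhs => rw [← Nat.sub_add_cancel h1, pow_add]
    ring

variable {N N' : Type} [AddCommGroup N] [Module A N] [AddCommGroup N'] [Module B N']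
  {ν : N →ₛₗ[σ] N'} {φ : M →ₗ[A] M ⊗[A] N} {φ' : M' →ₗ[B] M' ⊗[B] N'}

theorem contract_map (hφ : ∀ m, φ' (ρ m) = TensorProduct.map ρ ν (φ m))
    {ξ : Dual A N} {ξ' : Dual B N'} (hξ : ∀ n, ξ' (ν n) = σ (ξ n)) (m : M) :
    contract φ' ξ' (ρ m) = ρ (contract φ ξ m) := by
  simp only [contract, LinearMap.comp_apply, hφ]
  induction φ m using TensorProduct.induction_on with
  | zero => simp
  | tmul x y => simp [hξ]
  | add x y hx hy => simp only [map_add] at *; rw [hx, hy]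

theorem higgsRel_map (hρ : DualPair f ρ) (hν : DualPair f ν)
    (hφ : ∀ m, φ' (ρ m) = TensorProduct.map ρ ν (φ m)) (p : Dual A M × Dual A M × Dual A N) :
    symMap hρ.map (higgsRel φ p) = higgsRel φ' (hρ.map p.1, hρ.map p.2.1, hν.map p.2.2) := by
  have h : ∀ (α : Dual A M) (ξ : Dual A N), hρ.map (α ∘ₗ contract φ ξ) =
      hρ.map α ∘ₗ contract φ' (hν.map ξ) := fun α ξ => (hρ.eq_map fun m => by
    rw [LinearMap.comp_apply, contract_map hφ (hν.map_apply ξ), hρ.map_apply,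
      LinearMap.comp_apply]).symm
  simp only [higgsRel, map_sub, map_mul, symMap_ι, h]

theorem higgsIdeal_map (hσ : IsAwayHom f σ) (hρ : DualPair f ρ) (hν : DualPair f ν)
    (hφ : ∀ m, φ' (ρ m) = TensorProduct.map ρ ν (φ m)) :
    higgsIdeal φ' = (higgsIdeal φ).map (symMap hρ.map) := by
  apply le_antisymm
  · refine Ideal.span_le.mpr ?_
    rintro _ ⟨⟨α', β', ξ'⟩, rfl⟩
    obtain ⟨a, α, hα⟩ := hρ.exists_smul α'
    obtain ⟨b, β, hβ⟩ := hρ.exists_smul β'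
    obtain ⟨c, ξ, hξ⟩ := hν.exists_smul ξ'
    have h1 : symMap hρ.map (higgsRel φ (α, β, ξ)) =
        higgsRel φ' (α', β', ξ') * (algebraMap B _ (σ f)) ^ (a + b + c) := by
      have h3 : ∀ γ : Dual B M', γ ∘ₗ contract φ' (σ f ^ c • ξ') =
          σ f ^ c • (γ ∘ₗ contract φ' ξ') := fun γ => by
        simp only [contract, LinearMap.lTensor_smul, LinearMap.smul_comp, LinearMap.comp_smul]
      rw [higgsRel_map hρ hν hφ]
      simp only [higgsRel, ← hα, ← hβ, ← hξ, h3, LinearMap.smul_comp, map_smul]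
      simp only [Algebra.smul_def, map_pow]
      ring
    have h2 : symMap hρ.map (higgsRel φ (α, β, ξ)) ∈ (higgsIdeal φ).map (symMap hρ.map) :=
      Ideal.mem_map_of_mem _ (Ideal.subset_span ⟨_, rfl⟩)
    rw [h1] at h2
    exact (Ideal.mul_unit_mem_iff_mem _ ((hσ.unit.map (algebraMap B _)).pow _)).mp h2
  · rw [higgsIdeal, Ideal.map_span, Ideal.span_le]
    rintro _ ⟨_, ⟨p, rfl⟩, rfl⟩
    rw [higgsRel_map hρ hν hφ]
    exact Ideal.subset_span ⟨_, rfl⟩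

/-- The homomorphism of homogeneous coordinate rings induced by restriction. -/
def coordMap (hρ : DualPair f ρ) (hν : DualPair f ν)
    (hφ : ∀ m, φ' (ρ m) = TensorProduct.map ρ ν (φ m)) : coordGrading φ →+*ᵍ coordGrading φ' where
  toRingHom := Ideal.quotientMap (higgsIdeal φ') (symMap hρ.map) (by
    refine Ideal.span_le.mpr ?_
    rintro _ ⟨p, rfl⟩
    change symMap hρ.map (higgsRel φ p) ∈ higgsIdeal φ'
    rw [higgsRel_map hρ hν hφ]
    exact Ideal.subset_span ⟨_, rfl⟩)
  map_mem := by
    rintro i _ ⟨x, hx, rfl⟩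
    exact ⟨symMap hρ.map x, symMap_mem _ hx, rfl⟩

theorem coordMap_coord (hρ : DualPair f ρ) (hν : DualPair f ν)
    (hφ : ∀ m, φ' (ρ m) = TensorProduct.map ρ ν (φ m)) (α : Dual A M) :
    coordMap hρ hν hφ (coord φ α) = coord φ' (hρ.map α) :=
  congrArg (Ideal.Quotient.mk (higgsIdeal φ')) (symMap_ι _ _)

theorem coordMap_algebraMap (hρ : DualPair f ρ) (hν : DualPair f ν)
    (hφ : ∀ m, φ' (ρ m) = TensorProduct.map ρ ν (φ m)) (a : A) :
    coordMap hρ hν hφ (algebraMap A _ a) = algebraMap B _ (σ a) :=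
  congrArg (Ideal.Quotient.mk (higgsIdeal φ')) (symMap_algebraMap _ _)

theorem coordHom_ext {T : Type} [CommRing T] {g h : CoordRing φ →+* T}
    (h1 : ∀ a, g (algebraMap A _ a) = h (algebraMap A _ a))
    (h2 : ∀ x, g (coord φ x) = h (coord φ x)) : g = h :=
  Ideal.Quotient.ringHom_ext (symHom_ext h1 h2)

theorem isAwayHom_coordMap (hσ : IsAwayHom f σ) {κ : Type} [Finite κ] (b : Basis κ A M)
    (c : Basis κ B M') (hbc : ∀ i, ρ (b i) = c i) (hρ : DualPair f ρ) (hν : DualPair f ν)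
    (hφ : ∀ m, φ' (ρ m) = TensorProduct.map ρ ν (φ m)) :
    IsAwayHom (algebraMap A (CoordRing φ) f) (coordMap hρ hν hφ).toRingHom := by
  classical
  refine (isAwayHom_symMap hρ.map hσ b.dualBasis c.dualBasis fun i => ?_).quotient _ _
    (higgsIdeal_map hσ hρ hν hφ)
  refine c.ext fun j => ?_
  rw [← hbc, hρ.map_apply, hbc]
  rw [Basis.dualBasis_apply_self, Basis.dualBasis_apply_self, apply_ite σ, map_one, map_zero]

end

end Restriction

end

section

section

variable {A B S T : Type} [CommRing A] [CommRing B] [CommRing S] [CommRing T] [Algebra A S]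
  [Algebra B T] {𝒮 : ℕ → Submodule A S} {𝒯 : ℕ → Submodule B T} [GradedAlgebra 𝒮]
  [GradedAlgebra 𝒯] {f : A} {σ : A →+* B} {h : 𝒮 →+*ᵍ 𝒯}

theorem projMap_projToSpec (hirr : HomogeneousIdeal.irrelevant 𝒯 ≤ (HomogeneousIdeal.irrelevant 𝒮).map h)
    (hσ : ∀ a, h (algebraMap A S a) = algebraMap B T (σ a)) :
    Proj.map h hirr ≫ projToSpec 𝒮 = projToSpec 𝒯 ≫ Spec.map (CommRingCat.ofHom σ) := by
  refine (Proj.mapAffineOpenCover h hirr).openCover.hom_ext _ _ fun s => ?_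
  have hi : 0 < s.1.1 := s.1.2
  have hs : s.2.1 ∈ 𝒮 s.1.1 := s.2.2
  change Proj.awayι 𝒯 (h s.2.1) (h.map_mem hs) hi ≫ _ ≫ _ =
    Proj.awayι 𝒯 (h s.2.1) (h.map_mem hs) hi ≫ _
  simp only [projToSpec, Category.assoc]
  rw [Proj.awayι_comp_map_assoc h hirr hi s.2.1 hs, Proj.awayι_toSpecZero_assoc, Proj.awayι_toSpecZero_assoc,
    ← Spec.map_comp, ← Spec.map_comp, ← Spec.map_comp, ← Spec.map_comp]
  congr 1
  refine CommRingCat.hom_ext (RingHom.ext fun a => ?_)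
  apply HomogeneousLocalization.val_injective
  change Localization.mk (h (algebraMap A S a)) ⟨h 1, _⟩ = Localization.mk (algebraMap B T (σ a)) 1
  rw [hσ]
  congr 1
  exact Subtype.ext (map_one h)

theorem isPullback_projMap (hf : IsAwayHom f σ) (H : IsAwayHom (algebraMap A S f) h.toRingHom)
    (hirr : HomogeneousIdeal.irrelevant 𝒯 ≤ (HomogeneousIdeal.irrelevant 𝒮).map h)
    (hσ : ∀ a, h (algebraMap A S a) = algebraMap B T (σ a)) :
    IsPullback (projToSpec 𝒯) (Proj.map h hirr) (Spec.map (CommRingCat.ofHom σ)) (projToSpec 𝒮) := by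
  have h0 := SetLike.algebraMap_mem_graded 𝒮 f
  have := H.projMap_isOpenImmersion h0 hirr
  have := hf.specMap.1
  refine IsOpenImmersion.isPullback _ _ _ _ (projMap_projToSpec hirr hσ) ?_
  ext x
  refine Iff.trans ?_ (H.range_projMap h0 hirr x).symm
  change projToSpec 𝒮 x ∈ Set.range (Spec.map (CommRingCat.ofHom σ)) ↔ _
  rw [hf.specMap.2]
  rfl

end

section Kaehler

variable {k A B : Type} [CommRing k] [CommRing A] [CommRing B] [Algebra k A] [Algebra k B]

/-- The map on Kähler differentials induced by an algebra homomorphism. -/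
def kaehlerMap (σ : A →ₐ[k] B) : Ω[A⁄k] →ₛₗ[σ.toRingHom] Ω[B⁄k] :=
  let := σ.toRingHom.toAlgebra
  have : IsScalarTower k A B := .of_algebraMap_eq' σ.comp_algebraMap.symm
  { toFun := KaehlerDifferential.map k k A B
    map_add' := map_add _
    map_smul' := fun a x => by
      rw [map_smul, ← algebraMap_smul B]; rfl }

theorem kaehlerMap_D (σ : A →ₐ[k] B) (a : A) :
    kaehlerMap σ (KaehlerDifferential.D k A a) = KaehlerDifferential.D k B (σ a) := by
  let := σ.toRingHom.toAlgebra
  have : IsScalarTower k A B := .of_algebraMap_eq' σ.comp_algebraMap.symm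
  exact KaehlerDifferential.map_D k k A B a

theorem kaehlerMap_eq (σ : A →ₐ[k] B) (g : Ω[A⁄k] →ₛₗ[σ.toRingHom] Ω[B⁄k])
    (h : ∀ a, g (KaehlerDifferential.D k A a) = KaehlerDifferential.D k B (σ a)) (x : Ω[A⁄k]) :
    kaehlerMap σ x = g x := by
  have hx : x ∈ Submodule.span A (Set.range (KaehlerDifferential.D k A)) := by
    rw [KaehlerDifferential.span_range_derivation]; trivial
  induction hx using Submodule.span_induction with
  | mem x hx => obtain ⟨i, rfl⟩ := hx; rw [kaehlerMap_D, h]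
  | zero => exact (map_zero (kaehlerMap σ)).trans (map_zero g).symm
  | add x y _ _ hx hy => rw [map_add, map_add, hx, hy]
  | smul r x _ hx => rw [map_smulₛₗ, map_smulₛₗ, hx]

theorem dualPair_kaehlerMap [Algebra.FinitePresentation k A] (σ : A →ₐ[k] B) (f : A)
    (hσ : IsAwayHom f σ.toRingHom) : DualPair f (kaehlerMap σ) := by
  let := σ.toRingHom.toAlgebra
  have : IsScalarTower k A B := .of_algebraMap_eq' σ.comp_algebraMap.symm
  have := hσ.isLocalization
  let p := Submonoid.powers f
  let l := KaehlerDifferential.map k k A B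
  have : IsLocalizedModule p l := KaehlerDifferential.isLocalizedModule_map k A B p
  have hl : ∀ x, kaehlerMap σ x = l x := fun x => rfl
  let g := Algebra.linearMap A B
  have : IsLocalizedModule p g := inferInstance
  refine ⟨fun ℓ => ?_, fun ℓ' => ?_⟩
  · refine ⟨(IsLocalizedModule.map p l g ℓ).extendScalarsOfIsLocalization p B, fun m => ?_,
      fun ℓ' h => ?_⟩
    · exact IsLocalizedModule.map_apply p l g ℓ m
    · have : ℓ'.restrictScalars A = IsLocalizedModule.map p l g ℓ :=
        IsLocalizedModule.ext p l (IsLocalizedModule.map_units g) (LinearMap.ext fun m => 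
          (h m).trans (IsLocalizedModule.map_apply p l g ℓ m).symm)
      exact LinearMap.ext fun x => LinearMap.congr_fun this x
  · obtain ⟨ℓ, ⟨_, n, rfl⟩, h⟩ := Module.FinitePresentation.exists_lift_of_isLocalizedModule p g
      (ℓ'.restrictScalars A ∘ₗ l)
    refine ⟨n, ℓ, fun m => ?_⟩
    have := LinearMap.congr_fun h m
    refine Eq.trans ?_ this.symm
    change _ = f ^ n • ℓ' (l m)
    rw [Algebra.smul_def, map_pow]
    rfl

end Kaehler

end

section

section Sections

variable (X : Scheme.{0}) [X.Over (Spec (.of ℂ))]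

/-- The structure map from the complex numbers to the regular functions on `W`. -/
def complexToSections (W : X.Opens) : CommRingCat.of ℂ ⟶ Γ(X, W) :=
  (Scheme.ΓSpecIso (.of ℂ)).inv ≫ (X ↘ Spec (.of ℂ)).appLE ⊤ W
    (show W ≤ (X ↘ Spec (.of ℂ)) ⁻¹ᵁ ⊤ from le_top)

instance sectionsAlgebra (W : X.Opens) : Algebra ℂ Γ(X, W) :=
  (complexToSections X W).hom.toAlgebra

variable {X}

/-- Restriction of regular functions as a homomorphism of `ℂ`-algebras. -/
def resAlg {V W : X.Opens} (h : V ≤ W) : Γ(X, W) →ₐ[ℂ] Γ(X, V) where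
  toRingHom := (X.presheaf.map (homOfLE h).op).hom
  commutes' c := by
    change (complexToSections X W ≫ X.presheaf.map (homOfLE h).op).hom c =
      (complexToSections X V).hom c
    rw [complexToSections, Category.assoc, Scheme.Hom.appLE_map]
    rfl

/-- Restriction of sections of a sheaf of modules as a semilinear map. -/
def resMod (E : X.Modules) {V W : X.Opens} (h : V ≤ W) :
    Γ(E, W) →ₛₗ[(resAlg h).toRingHom] Γ(E, V) where
  toFun := (E.presheaf.map (homOfLE h).op).hom
  map_add' := map_add _
  map_smul' a m := E.map_smul (homOfLE h) a m

theorem resMod_refl (E : X.Modules) (W : X.Opens) (m : Γ(E, W)) : resMod E le_rfl m = m := by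
  change (E.presheaf.map (𝟙 _)).hom m = m
  rw [E.presheaf.map_id]; rfl

theorem resMod_trans (E : X.Modules) {U V W : X.Opens} (h : V ≤ W) (h' : U ≤ V) (m : Γ(E, W)) :
    resMod E h' (resMod E h m) = resMod E (h'.trans h) m := by
  change (E.presheaf.map _ ≫ E.presheaf.map _).hom m = (E.presheaf.map _).hom m
  rw [← E.presheaf.map_comp]; rfl

theorem resAlg_refl (W : X.Opens) (m : Γ(X, W)) : resAlg (X := X) le_rfl m = m := by
  change (X.presheaf.map (𝟙 _)).hom m = m
  rw [X.presheaf.map_id]; rfl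

theorem resAlg_trans {U V W : X.Opens} (h : V ≤ W) (h' : U ≤ V) (m : Γ(X, W)) :
    resAlg h' (resAlg h m) = resAlg (h'.trans h) m := by
  change (X.presheaf.map _ ≫ X.presheaf.map _).hom m = (X.presheaf.map _).hom m
  rw [← X.presheaf.map_comp]; rfl

/-- A frame of the sheaf of modules `E` over `U`: sections over `U` whose restrictions
form a basis of the sections over every smaller open set. -/
structure Frame (E : X.Modules) (U : X.Opens) (κ : Type) where
  sec : κ → Γ(E, U)
  linearIndependent : ∀ {V : X.Opens} (h : V ≤ U),
    LinearIndependent (X.presheaf.obj (.op V)) fun i => resMod E h (sec i)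
  span : ∀ {V : X.Opens} (h : V ≤ U),
    ⊤ ≤ Submodule.span (X.presheaf.obj (.op V)) (Set.range fun i => resMod E h (sec i))

/-- The basis of the sections over a smaller open set given by a frame. -/
def Frame.basis {E : X.Modules} {U : X.Opens} {κ : Type} (e : Frame E U κ) {V : X.Opens}
    (h : V ≤ U) : Basis κ (X.presheaf.obj (.op V)) Γ(E, V) :=
  Basis.mk (e.linearIndependent h) (e.span h)

theorem Frame.basis_apply {E : X.Modules} {U : X.Opens} {κ : Type} (e : Frame E U κ) {V : X.Opens}
    (h : V ≤ U) (i : κ) : e.basis h i = resMod E h (e.sec i) :=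
  Basis.mk_apply _ _ i

theorem Frame.res_basis {E : X.Modules} {U : X.Opens} {κ : Type} (e : Frame E U κ) {V W : X.Opens}
    (h : V ≤ U) (h' : W ≤ V) (i : κ) : resMod E h' (e.basis h i) = e.basis (h'.trans h) i := by
  rw [e.basis_apply, e.basis_apply, resMod_trans]

/-- The restriction of a frame. -/
def Frame.restrict {E : X.Modules} {U : X.Opens} {κ : Type} (e : Frame E U κ) {V : X.Opens}
    (h : V ≤ U) : Frame E V κ where
  sec i := resMod E h (e.sec i)
  linearIndependent h' := by
    simp only [resMod_trans]
    exact e.linearIndependent (h'.trans h)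
  span h' := by
    simp only [resMod_trans]
    exact e.span (h'.trans h)

theorem isAwayHom_resAlg {V W : X.Opens} (hW : IsAffineOpen W) (h : V ≤ W) (f : Γ(X, W))
    (hf : X.basicOpen f = V) : IsAwayHom f (resAlg h).toRingHom := by
  subst hf
  let := (resAlg h).toRingHom.toAlgebra
  have : IsLocalization.Away f Γ(X, X.basicOpen f) :=
    hW.isLocalization_of_eq_basicOpen f (homOfLE h) rfl
  exact IsAwayHom.of_isLocalization (T := Γ(X, X.basicOpen f)) f

theorem finitePresentation_sections [LocallyOfFinitePresentation (X ↘ Spec (.of ℂ))]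
    {W : X.Opens} (hW : IsAffineOpen W) : Algebra.FinitePresentation ℂ Γ(X, W) := by
  have h1 := (X ↘ Spec (.of ℂ)).finitePresentation_appLE (isAffineOpen_top _) hW
    (show W ≤ (X ↘ Spec (.of ℂ)) ⁻¹ᵁ ⊤ from le_top)
  have h2 : (complexToSections X W).hom.FinitePresentation :=
    h1.comp (RingHom.FinitePresentation.of_bijective
      ((Scheme.ΓSpecIso (.of ℂ)).symm.commRingCatIsoToRingEquiv.bijective))
  exact h2

end Sections

/-- The wedge product `N ⊗ N → Λ N`. -/
def wedge (A N : Type) [CommRing A] [AddCommGroup N] [Module A N] :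
    N ⊗[A] N →ₗ[A] ExteriorAlgebra A N :=
  LinearMap.mul' A _ ∘ₗ TensorProduct.map (ExteriorAlgebra.ι A) (ExteriorAlgebra.ι A)

/-- The composition of `φ ⊗ id : M ⊗ N → M ⊗ N ⊗ N` with `φ`, followed by the wedge product. -/
def wedgeSquare {A M N : Type} [CommRing A] [AddCommGroup M] [Module A M] [AddCommGroup N]
    [Module A N] (φ : M →ₗ[A] M ⊗[A] N) : M →ₗ[A] M ⊗[A] ExteriorAlgebra A N :=
  LinearMap.lTensor M (wedge A N) ∘ₗ (TensorProduct.assoc A M N N).toLinearMap ∘ₗ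
    LinearMap.rTensor N φ ∘ₗ φ

/-- A Higgs bundle of rank `r` on `X`: a locally free sheaf `E` of rank `r` together with a
morphism `φ : E → E ⊗ Ω¹` such that `φ ∧ φ = 0`. The morphism is given by its values on the affine
open sets `W`, over which the sections of `E ⊗ Ω¹` are `E(W) ⊗ Ω¹(W)`. -/
structure HiggsBundle (X : Scheme.{0}) [X.Over (Spec (.of ℂ))] (r : ℕ) where
  E : X.Modules
  locallyFree : ∀ x : X, ∃ U : X.Opens, x ∈ U ∧ Nonempty (Frame E U (Fin r))
  φ : ∀ {W : X.Opens}, IsAffineOpen W →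
    (Γ(E, W) →ₗ[Γ(X, W)] Γ(E, W) ⊗[Γ(X, W)] Ω[Γ(X, W)⁄ℂ])
  φ_res : ∀ {V W : X.Opens} (hV : IsAffineOpen V) (hW : IsAffineOpen W) (h : V ≤ W) (m : Γ(E, W)),
    φ hV (resMod E h m) = TensorProduct.map (resMod E h) (kaehlerMap (resAlg h)) (φ hW m)
  integrable : ∀ {W : X.Opens} (hW : IsAffineOpen W), wedgeSquare (φ hW) = 0

end

section

section

variable {A B C σ τ ψ : Type} [CommRing A] [SetLike σ A] [AddSubgroupClass σ A]
  [CommRing B] [SetLike τ B] [AddSubgroupClass τ B]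
  [CommRing C] [SetLike ψ C] [AddSubgroupClass ψ C]
  {𝒜 : ℕ → σ} {ℬ : ℕ → τ} {𝒞 : ℕ → ψ} [GradedRing 𝒜] [GradedRing ℬ] [GradedRing 𝒞]

theorem projMap_eq_id {g : 𝒜 →+*ᵍ 𝒜} (hg : g = .id _)
    (h : HomogeneousIdeal.irrelevant 𝒜 ≤ (HomogeneousIdeal.irrelevant 𝒜).map g) :
    Proj.map g h = 𝟙 _ := by
  subst hg
  exact Proj.map_id

theorem projMap_eq_comp {f : 𝒜 →+*ᵍ ℬ} {g : ℬ →+*ᵍ 𝒞} {k : 𝒜 →+*ᵍ 𝒞} (hk : k = g.comp f)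
    (h : HomogeneousIdeal.irrelevant ℬ ≤ (HomogeneousIdeal.irrelevant 𝒜).map f)
    (h' : HomogeneousIdeal.irrelevant 𝒞 ≤ (HomogeneousIdeal.irrelevant ℬ).map g)
    (h'' : HomogeneousIdeal.irrelevant 𝒞 ≤ (HomogeneousIdeal.irrelevant 𝒜).map k) :
    Proj.map k h'' = Proj.map g h' ≫ Proj.map f h := by
  subst hk
  exact Proj.map_comp _ _ _ _

end

variable {X : Scheme.{0}} [X.Over (Spec (.of ℂ))] {r : ℕ}

/-- The affine open sets over which the bundle has a frame. -/
def TrivAffine (𝔈 : HiggsBundle X r) : Type :=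
  { W : X.Opens // IsAffineOpen W ∧ Nonempty (Frame 𝔈.E W (Fin r)) }

namespace TrivAffine

variable {𝔈 : HiggsBundle X r}

theorem affine (W : TrivAffine 𝔈) : IsAffineOpen W.1 := W.2.1

/-- The principal open subset of a trivializing affine open set. -/
def basicOpen (W : TrivAffine 𝔈) (f : Γ(X, W.1)) : TrivAffine 𝔈 :=
  ⟨X.basicOpen f, W.affine.basicOpen f, W.2.2.map fun e => e.restrict (X.basicOpen_le f)⟩

/-- The order by inclusion as a principal open subset. -/
instance : Preorder (TrivAffine 𝔈) where
  le V W := ∃ f : Γ(X, W.1), X.basicOpen f = V.1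
  le_refl W := ⟨1, Scheme.basicOpen_of_isUnit _ isUnit_one⟩
  le_trans := by
    rintro ⟨U, hU⟩ ⟨V, hV⟩ ⟨W, hW⟩ ⟨f, rfl⟩ ⟨g, rfl⟩
    exact hW.1.basicOpen_basicOpen_is_basicOpen g f

theorem basicOpen_le (W : TrivAffine 𝔈) (f : Γ(X, W.1)) : W.basicOpen f ≤ W := ⟨f, rfl⟩

theorem opens_le {V W : TrivAffine 𝔈} (h : V ≤ W) : V.1 ≤ W.1 := by
  obtain ⟨f, hf⟩ := h
  exact hf ▸ X.basicOpen_le f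

theorem exists_mem (𝔈 : HiggsBundle X r) (x : X) : ∃ W : TrivAffine 𝔈, x ∈ W.1 := by
  obtain ⟨U, hx, ⟨e⟩⟩ := 𝔈.locallyFree x
  obtain ⟨_, ⟨W, hW, rfl⟩, hxW, hWU⟩ := X.isBasis_affineOpens.exists_subset_of_mem_open hx U.2
  exact ⟨⟨W, hW, ⟨e.restrict hWU⟩⟩, hxW⟩

/-- The open cover by the trivializing affine open sets. -/
@[simps]
abbrev cover (𝔈 : HiggsBundle X r) : X.OpenCover where
  I₀ := TrivAffine 𝔈
  X U := U.1
  f U := U.1.ι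
  mem₀ := by
    rw [Scheme.presieve₀_mem_precoverage_iff]
    refine ⟨fun x => ?_, inferInstance⟩
    obtain ⟨W, hW⟩ := exists_mem 𝔈 x
    exact ⟨W, ⟨x, hW⟩, rfl⟩

instance : Category (cover 𝔈).I₀ := inferInstanceAs (Category (TrivAffine 𝔈))

instance : Quiver.IsThin (cover 𝔈).I₀ := inferInstanceAs (Quiver.IsThin (TrivAffine 𝔈))

instance : Small.{0} (cover 𝔈).I₀ := inferInstanceAs (Small.{0} (TrivAffine 𝔈))

instance : (cover 𝔈).LocallyDirected where
  trans {U V} f := X.homOfLE (opens_le (leOfHom (X := TrivAffine 𝔈) f))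
  directed {U V} x := by
    let a := (pullback.fst _ _ ≫ U.1.ι) x
    have haU : a ∈ U.1 := (pullback.fst U.1.ι V.1.ι x).2
    have haV : a ∈ V.1 := by unfold a; rw [pullback.condition]; exact (pullback.snd U.1.ι V.1.ι x).2
    obtain ⟨f, g, e, hxf⟩ := exists_basicOpen_le_affine_inter U.affine V.affine _ ⟨haU, haV⟩
    refine ⟨U.basicOpen f, homOfLE (U.basicOpen_le f), homOfLE (⟨g, e.symm⟩ : U.basicOpen f ≤ V),
      ⟨a, hxf⟩, ?_⟩
    apply (pullback.fst _ _ ≫ U.1.ι).isOpenEmbedding.injective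
    dsimp
    change (pullback.lift _ _ _ ≫ pullback.fst _ _ ≫ U.1.ι) _ = _
    simp only [pullback.lift_fst_assoc, Scheme.homOfLE_ι, Scheme.Opens.ι_apply]
    rfl

end TrivAffine

variable (𝔈 : HiggsBundle X r)

/-- The scheme of `φ`-invariant lines in the fibers of the bundle over a trivializing affine open
set `W`. -/
def chart (W : TrivAffine 𝔈) : Scheme.{0} := Proj (coordGrading (𝔈.φ W.affine))

/-- The structure morphism of a chart. -/
def chartToBase (W : TrivAffine 𝔈) : chart 𝔈 W ⟶ W.1.toScheme :=
  projToSpec (coordGrading (𝔈.φ W.affine)) ≫ W.affine.isoSpec.inv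

section Transition

variable {𝔈} {V W : TrivAffine 𝔈} (h : V ≤ W)

theorem dualPair_resMod {f : Γ(X, W.1)} (hf : X.basicOpen f = V.1) :
    DualPair f (resMod 𝔈.E (TrivAffine.opens_le h)) := by
  obtain ⟨e⟩ := W.2.2
  exact dualPair_of_basis (isAwayHom_resAlg W.affine _ f hf) (e.basis le_rfl)
    (e.basis (TrivAffine.opens_le h)) fun i => e.res_basis _ _ i

variable [Smooth (X ↘ Spec (.of ℂ))]

theorem dualPair_res_kaehler {f : Γ(X, W.1)} (hf : X.basicOpen f = V.1) :
    DualPair f (kaehlerMap (resAlg (TrivAffine.opens_le h))) := by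
  have := finitePresentation_sections W.affine
  exact dualPair_kaehlerMap _ f (isAwayHom_resAlg W.affine _ f hf)

/-- The restriction homomorphism of homogeneous coordinate rings. -/
def coordRes : coordGrading (𝔈.φ W.affine) →+*ᵍ coordGrading (𝔈.φ V.affine) :=
  coordMap (dualPair_resMod h h.choose_spec) (dualPair_res_kaehler h h.choose_spec)
    (𝔈.φ_res V.affine W.affine (TrivAffine.opens_le h))

theorem coordRes_algebraMap (a : Γ(X, W.1)) :
    coordRes h (algebraMap _ _ a) = algebraMap _ _ (resAlg (TrivAffine.opens_le h) a) :=
  coordMap_algebraMap _ _ _ a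

theorem coordRes_coord (α : Dual Γ(X, W.1) Γ(𝔈.E, W.1)) (β : Dual Γ(X, V.1) Γ(𝔈.E, V.1))
    (hαβ : ∀ m, β (resMod 𝔈.E (TrivAffine.opens_le h) m) = resAlg (TrivAffine.opens_le h) (α m)) :
    coordRes h (coord _ α) = coord _ β := by
  rw [coordRes, coordMap_coord, ← DualPair.eq_map _ hαβ]

theorem isAwayHom_coordRes :
    IsAwayHom (algebraMap _ (CoordRing (𝔈.φ W.affine)) h.choose) (coordRes h).toRingHom := by
  obtain ⟨e⟩ := W.2.2
  exact isAwayHom_coordMap (isAwayHom_resAlg W.affine _ _ h.choose_spec) (e.basis le_rfl)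
    (e.basis (TrivAffine.opens_le h)) (fun i => e.res_basis _ _ i) _ _ _

theorem coordRes_irrelevant :
    HomogeneousIdeal.irrelevant (coordGrading (𝔈.φ V.affine)) ≤
      (HomogeneousIdeal.irrelevant (coordGrading (𝔈.φ W.affine))).map (coordRes h) :=
  (isAwayHom_coordRes h).irrelevant_le (SetLike.algebraMap_mem_graded _ _)

theorem coordRes_ext {U : TrivAffine 𝔈}
    {g g' : coordGrading (𝔈.φ W.affine) →+*ᵍ coordGrading (𝔈.φ U.affine)}
    (h1 : ∀ a, g (algebraMap (X.presheaf.obj (.op W.1)) _ a) =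
      g' (algebraMap (X.presheaf.obj (.op W.1)) _ a))
    (h2 : ∀ α, g (coord _ α) = g' (coord _ α)) : g = g' := by
  have h3 : g.toRingHom = g'.toRingHom := coordHom_ext h1 h2
  exact GradedRingHom.ext fun x => congr($h3 x)

theorem coordRes_refl (h : W ≤ W) : coordRes h = .id _ := by
  refine coordRes_ext (fun a => ?_) (fun α => ?_)
  · rw [coordRes_algebraMap, resAlg_refl]; rfl
  · exact coordRes_coord _ α α fun m => by rw [resMod_refl, resAlg_refl]

theorem coordRes_trans {U : TrivAffine 𝔈} (h' : U ≤ V) :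
    (coordRes h').comp (coordRes h) = coordRes (h'.trans h) := by
  refine coordRes_ext (fun a => ?_) (fun α => ?_)
  · rw [GradedRingHom.comp_apply, coordRes_algebraMap, coordRes_algebraMap, coordRes_algebraMap,
      resAlg_trans]
  · have d := dualPair_resMod h h.choose_spec
    have d' := dualPair_resMod h' h'.choose_spec
    have h1 : coordRes h (coord _ α) = coord _ (d.map α) := coordRes_coord h α _ (d.map_apply α)
    have h2 : coordRes h' (coord _ (d.map α)) = coord _ (d'.map (d.map α)) :=
      coordRes_coord h' _ _ (d'.map_apply (d.map α))
    refine ((congrArg (coordRes h') h1).trans h2).trans ?_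
    refine (coordRes_coord (h'.trans h) α _ fun m => ?_).symm
    rw [← resMod_trans 𝔈.E (TrivAffine.opens_le h) (TrivAffine.opens_le h')]
    refine (d'.map_apply _ _).trans ?_
    refine (congrArg _ (d.map_apply _ _)).trans ?_
    exact resAlg_trans _ _ _

/-- The transition morphism between two charts. -/
def chartMap : chart 𝔈 V ⟶ chart 𝔈 W := Proj.map (coordRes h) (coordRes_irrelevant h)

theorem isPullback_chartMap :
    IsPullback (chartToBase 𝔈 V) (chartMap h) (X.homOfLE (TrivAffine.opens_le h))
      (chartToBase 𝔈 W) := by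
  have h1 := isPullback_projMap (isAwayHom_resAlg W.affine _ _ h.choose_spec)
    (isAwayHom_coordRes h) (coordRes_irrelevant h) (coordRes_algebraMap h)
  refine h1.of_iso (Iso.refl _) V.affine.isoSpec.symm (Iso.refl _) W.affine.isoSpec.symm ?_ ?_ ?_ ?_
  · exact (Category.id_comp _).symm
  · exact (Category.comp_id _).trans (Category.id_comp _).symm
  · refine (Iso.comp_inv_eq W.affine.isoSpec).mpr ?_
    refine Eq.trans ?_ (Category.assoc _ _ _).symm
    refine (Iso.eq_inv_comp V.affine.isoSpec).mpr ?_
    exact Scheme.Opens.toSpecΓ_SpecMap_presheaf_map _ _ _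
  · exact (Category.id_comp _).symm

theorem chartMap_refl (h : W ≤ W) : chartMap h = 𝟙 _ := projMap_eq_id (coordRes_refl h) _

theorem chartMap_trans {U : TrivAffine 𝔈} (h' : U ≤ V) :
    chartMap (h'.trans h) = chartMap h' ≫ chartMap h :=
  projMap_eq_comp (coordRes_trans h h').symm _ _ _

end Transition

variable [Smooth (X ↘ Spec (.of ℂ))]

/-- The charts with their transition morphisms. -/
def chartFunctor : (TrivAffine.cover 𝔈).I₀ ⥤ Scheme.{0} where
  obj W := chart 𝔈 W
  map {V W} h := chartMap (leOfHom (X := TrivAffine 𝔈) h)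
  map_id _ := chartMap_refl _
  map_comp _ _ := chartMap_trans _ _

/-- The gluing data of the charts over the base. -/
def gluingData : (TrivAffine.cover 𝔈).RelativeGluingData where
  functor := chartFunctor 𝔈
  natTrans :=
    { app := fun W => chartToBase 𝔈 W
      naturality := fun _ _ h => ((isPullback_chartMap (leOfHom (X := TrivAffine 𝔈) h)).w).symm }
  equifibered := fun _ _ h => (isPullback_chartMap (leOfHom (X := TrivAffine 𝔈) h)).flip

/-- The Higgs Grassmannian of lines: the scheme over `X` that parametrizes the `φ`-invariant lines
in the fibers of the Higgs bundle, as a closed subscheme of the projective bundle of lines. -/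
def Hgrass : Scheme.{0} := (gluingData 𝔈).glued

/-- The projection of the Higgs Grassmannian to the base. -/
def Hgrass.proj : Hgrass 𝔈 ⟶ X := (gluingData 𝔈).toBase

/-- The open immersion of a chart. -/
def Hgrass.ι (W : TrivAffine 𝔈) : chart 𝔈 W ⟶ Hgrass 𝔈 :=
  (gluingData 𝔈).cover.f W

end

section

theorem Hgrass.isPullback_ι {X : Scheme.{0}} [X.Over (Spec (.of ℂ))] {r : ℕ}
    (𝔈 : HiggsBundle X r) [Smooth (X ↘ Spec (.of ℂ))] (W : TrivAffine 𝔈) :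
    IsPullback (chartToBase 𝔈 W) (Hgrass.ι 𝔈 W) W.1.ι (Hgrass.proj 𝔈) :=
  (gluingData 𝔈).isPullback_natTrans_ι_toBase W

section Quadrics

variable {R : Type} [CommRing R] {d : ℕ}

attribute [local instance] MvPolynomial.gradedAlgebra

/-- The quadratic form `∑ k, z_k (M_jk z_i - M_ik z_j)`. -/
def matrixRel (M : Matrix (Fin d) (Fin d) R) (i j : Fin d) : MvPolynomial (Fin d) R :=
  ∑ k, MvPolynomial.X k *
    (MvPolynomial.C (M j k) * MvPolynomial.X i - MvPolynomial.C (M i k) * MvPolynomial.X j)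

/-- The ideal generated by the forms `∑ k, z_k (M_jk z_i - M_ik z_j)` with `i < j`. -/
def matrixIdeal (M : Matrix (Fin d) (Fin d) R) : Ideal (MvPolynomial (Fin d) R) :=
  Ideal.span { p | ∃ i j, i < j ∧ p = matrixRel M i j }

theorem matrixIdeal_homogeneous (M : Matrix (Fin d) (Fin d) R) :
    (matrixIdeal M).IsHomogeneous (MvPolynomial.homogeneousSubmodule (Fin d) R) := by
  refine Ideal.homogeneous_span _ _ ?_
  rintro _ ⟨i, j, -, rfl⟩
  refine ⟨1 + 1, (MvPolynomial.mem_homogeneousSubmodule _ _).mpr ?_⟩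
  refine MvPolynomial.IsHomogeneous.sum _ _ _ fun k _ => (MvPolynomial.isHomogeneous_X R k).mul ?_
  exact ((MvPolynomial.isHomogeneous_X R i).C_mul _).sub ((MvPolynomial.isHomogeneous_X R j).C_mul _)

/-- The homogeneous coordinate ring `R[z_1, …, z_d] / I_M`. -/
abbrev MatrixRing (M : Matrix (Fin d) (Fin d) R) : Type :=
  MvPolynomial (Fin d) R ⧸ matrixIdeal M

/-- The grading of `R[z_1, …, z_d] / I_M`. -/
abbrev matrixGrading (M : Matrix (Fin d) (Fin d) R) : ℕ → Submodule R (MatrixRing M) :=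
  quotGrading (MvPolynomial.homogeneousSubmodule (Fin d) R) (matrixIdeal M)

instance matrixGradedAlgebra (M : Matrix (Fin d) (Fin d) R) : GradedAlgebra (matrixGrading M) :=
  quotGradedAlgebra _ _ (matrixIdeal_homogeneous M)

/-- The class of the variable `z_a`. -/
def matrixVar (M : Matrix (Fin d) (Fin d) R) (a : Fin d) : MatrixRing M :=
  Ideal.Quotient.mk (matrixIdeal M) (MvPolynomial.X a)

/-- The upper triangular Jordan block of size `d`. -/
def jordanBlock (c : R) (d : ℕ) : Matrix (Fin d) (Fin d) R := fun a b =>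
  if a = b then c else if a.val + 1 = b.val then 1 else 0

end Quadrics

/-- For a matrix `M` of regular functions on `U`, the closed subscheme `V_M` of the projective
space over `U` defined by the ideal `I_M`. -/
def VM {X : Scheme.{0}} (U : X.Opens) {d : ℕ} (M : Matrix (Fin d) (Fin d) Γ(X, U)) : Scheme.{0} :=
  pullback U.toSpecΓ (projToSpec (matrixGrading M))

/-- The projection of `V_M` to `U`. -/
def VM.proj {X : Scheme.{0}} (U : X.Opens) {d : ℕ} (M : Matrix (Fin d) (Fin d) Γ(X, U)) :
    VM U M ⟶ U.toScheme := pullback.fst _ _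

/-- The canonical morphism from `V_M` to `Proj R[z_1, …, z_d] / I_M`, where `R` is the ring of
regular functions on `U`. -/
def VM.toProj {X : Scheme.{0}} (U : X.Opens) {d : ℕ} (M : Matrix (Fin d) (Fin d) Γ(X, U)) :
    VM U M ⟶ Proj (matrixGrading M) := pullback.snd _ _

section Finite

/-- The scheme `Z` is finite of degree `ℓ` over the spectrum of the field `K`; that is, it is a
zero-dimensional scheme of degree (or length) `ℓ`. -/
structure IsFiniteOfDegree {Z : Scheme.{0}} {K : CommRingCat.{0}} (z : Z ⟶ Spec K) (ℓ : ℕ) :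
    Prop where
  finite : IsFinite z
  degree : @Module.finrank K (Z.presheaf.obj (.op ⊤)) _ _
    ((Scheme.ΓSpecIso K).inv ≫ z.appTop).hom.toAlgebra.toModule = ℓ

/-- All Zariski cotangent spaces have dimension at most one. -/
def IsCurvilinear (Z : Scheme.{0}) : Prop :=
  ∀ z : Z, Module.rank (IsLocalRing.ResidueField (Z.presheaf.stalk z))
    (IsLocalRing.CotangentSpace (Z.presheaf.stalk z)) ≤ 1

end Finite

section Restriction

variable {X : Scheme.{0}} [X.Over (Spec (.of ℂ))]

instance smooth_opens [Smooth (X ↘ Spec (.of ℂ))] (U : X.Opens) :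
    Smooth (U.toScheme ↘ Spec (.of ℂ)) :=
  inferInstanceAs (Smooth (U.ι ≫ X ↘ Spec (.of ℂ)))

variable {U : X.Opens}

theorem le_preimage_of_image_eq {W' : U.toScheme.Opens} {W : X.Opens} (h : U.ι ''ᵁ W' = W) :
    W' ≤ U.ι ⁻¹ᵁ W := by
  subst h
  exact fun x hx => ⟨x, hx, rfl⟩

/-- The identification of the regular functions on an open subset `W` of `U`, considered as
an open subscheme, with those on `W` as an open subset of `X`. -/
def openAlg (W : U.toScheme.Opens) : Γ(U, W) →ₐ[ℂ] Γ(X, U.ι ''ᵁ W) where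
  toRingHom := (U.ι.appIso W).inv.hom
  commutes' c := by
    have h : complexToSections U.toScheme W ≫ (U.ι.appIso W).inv =
        complexToSections X (U.ι ''ᵁ W) := by
      rw [Iso.comp_inv_eq, Scheme.Hom.appIso_hom', complexToSections, complexToSections,
        Category.assoc]
      congr 1
      exact (Scheme.Hom.appLE_comp_appLE _ _ _ _ _ _ _).symm
    exact congr($h c)

/-- The map on sections of a morphism to a restriction. -/
def inclSec {F : U.toScheme.Modules} {E : X.Modules} (i : F ⟶ E.restrict U.ι)
    (W : U.toScheme.Opens) : Γ(F, W) →ₛₗ[(openAlg W).toRingHom] Γ(E, U.ι ''ᵁ W) where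
  toFun m := (E.restrictAppIso U.ι W).hom.hom ((i.app W).hom m)
  map_add' x y := by rw [map_add, map_add]
  map_smul' a x := by
    refine (congrArg (E.restrictAppIso U.ι W).hom.hom (i.app_smul a x)).trans ?_
    exact congr($(Scheme.Modules.smul_restrictAppIso_hom U.ι E W a) ((i.app W).hom x))

/-- A morphism of Higgs bundles from a Higgs bundle on the open subscheme `U` to the restriction
of a Higgs bundle on `X`. -/
structure HiggsHom {d r : ℕ} (𝔉 : HiggsBundle U.toScheme d) (𝔈 : HiggsBundle X r) where
  hom : 𝔉.E ⟶ 𝔈.E.restrict U.ι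
  comm : ∀ {W : U.toScheme.Opens} (hW : IsAffineOpen W) (m : Γ(𝔉.E, W)),
    𝔈.φ (hW.image_of_isOpenImmersion U.ι) (inclSec hom W m) =
      TensorProduct.map (inclSec hom W) (kaehlerMap (openAlg W)) (𝔉.φ hW m)

/-- A frame of the sheaf of differentials over `U`. -/
structure CotangentFrame (U : X.Opens) (n : ℕ) where
  form : ∀ {W : X.Opens}, IsAffineOpen W → W ≤ U → Fin n → Ω[Γ(X, W)⁄ℂ]
  res : ∀ {V W : X.Opens} (hV : IsAffineOpen V) (hW : IsAffineOpen W) (hWU : W ≤ U) (h : V ≤ W)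
    (k : Fin n), kaehlerMap (resAlg h) (form hW hWU k) = form hV (h.trans hWU) k
  linearIndependent : ∀ {W : X.Opens} (hW : IsAffineOpen W) (hWU : W ≤ U),
    LinearIndependent (X.presheaf.obj (.op W)) (form hW hWU)
  span : ∀ {W : X.Opens} (hW : IsAffineOpen W) (hWU : W ≤ U),
    ⊤ ≤ Submodule.span (X.presheaf.obj (.op W)) (Set.range (form hW hWU))

/-- The matrices `Φ k` of regular functions on `U` represent the Higgs field in the given frames of
the bundle and of the cotangent sheaf: `φ (e_j) = ∑ k, ∑ i, (Φ k)_ij e_i ⊗ ω_k`. -/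
def Represents {r n : ℕ} {𝔈 : HiggsBundle X r} {κ : Type} [Fintype κ] (e : Frame 𝔈.E U κ)
    (ω : CotangentFrame U n) (Φ : Fin n → Matrix κ κ Γ(X, U)) : Prop :=
  ∀ {W : X.Opens} (hW : IsAffineOpen W) (hWU : W ≤ U) (j : κ),
    𝔈.φ hW (e.basis hWU j) =
      ∑ k, ∑ i, (resAlg hWU (Φ k i j) • e.basis hWU i) ⊗ₜ[X.presheaf.obj (.op W)] ω.form hW hWU k

/-- The endomorphism of the sections over a smaller open set given by a matrix in a frame. -/
def frameEnd {E : X.Modules} {κ : Type} [Fintype κ] [DecidableEq κ] (e : Frame E U κ)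
    (A : Matrix κ κ Γ(X, U)) {W : X.Opens} (h : W ≤ U) :
    End (X.presheaf.obj (.op W)) Γ(E, W) :=
  Matrix.toLin (e.basis h) (e.basis h) (A.map (resAlg h))

/-- The morphism `i` identifies its source with the generalized eigensheaf with eigenvalue `c` of
the endomorphism given by the matrix `A` in the frame `e`. -/
def IsEigenSubbundle {d r : ℕ} {𝔉 : HiggsBundle U.toScheme d} {𝔈 : HiggsBundle X r}
    (i : HiggsHom 𝔉 𝔈) {κ : Type} [Fintype κ] [DecidableEq κ] (e : Frame 𝔈.E U κ)
    (A : Matrix κ κ Γ(X, U)) (c : Γ(X, U)) : Prop :=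
  ∀ W : U.toScheme.Opens, Function.Injective (inclSec i.hom W) ∧
    Set.range (inclSec i.hom W) = (End.maxGenEigenspace (frameEnd e A (U.ι_image_le W))
      (resAlg (U.ι_image_le W) c) : Set Γ(𝔈.E, U.ι ''ᵁ W))

variable [Smooth (X ↘ Spec (.of ℂ))]

/-- The morphism `f` sends an invariant line to its image under `i`: on homogeneous coordinates it
is given by restricting linear forms along `i`. -/
def IsInducedBy {d r : ℕ} {𝔉 : HiggsBundle U.toScheme d} {𝔈 : HiggsBundle X r}
    (f : Hgrass 𝔉 ⟶ Hgrass 𝔈) (i : HiggsHom 𝔉 𝔈) : Prop :=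
  ∀ (W' : TrivAffine 𝔉) (W : TrivAffine 𝔈) (hW : U.ι ''ᵁ W'.1 = W.1),
    ∃ (h : coordGrading (𝔈.φ W.affine) →+*ᵍ coordGrading (𝔉.φ W'.affine))
      (hirr : HomogeneousIdeal.irrelevant (coordGrading (𝔉.φ W'.affine)) ≤
        (HomogeneousIdeal.irrelevant (coordGrading (𝔈.φ W.affine))).map h),
      (∀ a : Γ(X, W.1), h (algebraMap Γ(X, W.1) _ a) = algebraMap Γ(U, W'.1) _
        ((U.ι.appLE W.1 W'.1 (le_preimage_of_image_eq hW)).hom a)) ∧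
      (∀ (α : Dual Γ(X, W.1) Γ(𝔈.E, W.1)) (β : Dual Γ(U, W'.1) Γ(𝔉.E, W'.1)),
        (∀ (m : Γ(𝔉.E, W'.1)) (m' : Γ(𝔈.E, W.1)), inclSec i.hom W'.1 m = resMod 𝔈.E hW.le m' →
          openAlg W'.1 (β m) = resAlg hW.le (α m')) →
        h (coord _ α) = coord _ β) ∧
      Hgrass.ι 𝔉 W' ≫ f = Proj.map h hirr ≫ Hgrass.ι 𝔈 W

/-- The morphism `f` to `V_M` is the one given by the homogeneous coordinates with respect to
the frame `e`. -/
def IsCoordinates {d : ℕ} {𝔉 : HiggsBundle U.toScheme d} {M : Matrix (Fin d) (Fin d) Γ(X, U)}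
    (f : Hgrass 𝔉 ⟶ VM U M) (e : Frame 𝔉.E ⊤ (Fin d)) : Prop :=
  f ≫ VM.proj U M = Hgrass.proj 𝔉 ∧
  ∀ W : TrivAffine 𝔉,
    ∃ (h : matrixGrading M →+*ᵍ coordGrading (𝔉.φ W.affine))
      (hirr : HomogeneousIdeal.irrelevant (coordGrading (𝔉.φ W.affine)) ≤
        (HomogeneousIdeal.irrelevant (matrixGrading M)).map h),
      (∀ a : Γ(X, U), h (algebraMap Γ(X, U) _ a) = algebraMap Γ(U, W.1) _
        ((U.ι.appLE U W.1 fun x _ => x.2).hom a)) ∧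
      (∀ a, h (matrixVar M a) = coord _ ((e.basis (le_top (a := W.1))).coord a)) ∧
      Hgrass.ι 𝔉 W ≫ f ≫ VM.toProj U M = Proj.map h hirr

end Restriction

end

end

end HiggsGrass

/-!
Integrability of the Higgs field says that its matrices `Φ k` in the given frames commute
(`Represents.commute`). One of them is a Jordan matrix with blocks of different eigenvalues, whose
differences are units. A matrix that commutes with it is block diagonal
(`apply_eq_zero_of_commute_jordan`), and its diagonal blocks are upper triangular Toeplitz matrices
(`exists_toeplitz_of_commute_jordan`), that is, polynomials in the nilpotent Jordan block. Hence the
part of the frame that belongs to one block spans an invariant subbundle, which is the generalized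
eigensheaf (`maxGenEigenspace_jordanEnd`), and the lines in it that are invariant under one `Φ k`
with a Jordan block are invariant under all of them.

The geometry is contained in the homogeneous coordinate rings over the affine open subsets `W` of
`U`. Write `A` for the ring of functions on `W` and `z 0, …, z (d - 1)` for the coordinates in one
block. The eigenvalue cancels from the equation of the invariant lines, which becomes
`z i * z (j + 1) = z (i + 1) * z j`, with `z d = 0`. Consequently `z 0` vanishes only where all `z i`
do, and on the locus where it does not vanish the ratio `t = z 1 / z 0` satisfies
`z i / z 0 = t ^ i` and `t ^ d = 0`. Conversely `∑ i, t ^ i e_i` spans an invariant line over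
`A[t] / (t ^ d)`, because a Toeplitz matrix acts on it as a polynomial in `t` (`exists_coordEval`). So
this locus is the spectrum of `A[t] / (t ^ d)`. The structure `JordanChart` isolates what the
argument uses of the graded ring; it is satisfied by the coordinate ring of the Higgs bundle, by
that of each block, and by that of `V_M` for a Jordan block `M`.

* For one block the locus is the whole of `Proj` (`JordanChart.isIso_specι`). As the formation of
  `A[t] / (t ^ d)` commutes with base change, the homogeneous coordinates identify the Higgs
  Grassmannian of a block with `V_M` (`JordanChart.isPullback_projMap`, `IsJordan.isoVM`).
* For blocks with eigenvalues `λ ≠ μ`, the equations of the invariant lines say that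
  `(λ - μ) z i * w j` is a combination of `z (i + 1) * w j` and `z i * w (j + 1)`. As `λ - μ` is a
  unit, `z i * w j = 0` (`IsJordan.coord_mul_coord_eq_zero`). So the loci that belong to the blocks
  are disjoint, and they cover the Higgs Grassmannian over `U` (`IsJordan.isPullback_sigmaDesc`).
* The fiber of a block over a point with residue field `κ` is the spectrum of `κ[t] / (t ^ d)`
  (`IsJordan.exists_fiber_iso`). This ring has dimension `d` and a single prime ideal, which is
  generated by `t`; this gives the degree, the single point and the bound on the cotangent space.
-/

namespace HiggsGrass

open CategoryTheory Limits AlgebraicGeometry TensorProduct DirectSum Module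

noncomputable section

/-! ### Truncated polynomial rings -/

section Trunc

/-- The truncated polynomial ring `A[t] / (t ^ d)`. -/
abbrev Trunc (A : Type) [CommRing A] (d : ℕ) : Type :=
  AdjoinRoot (Polynomial.X ^ d : Polynomial A)

variable {A B : Type} [CommRing A] [CommRing B] {d : ℕ}

/-- The class of `t` in `A[t] / (t ^ d)`. -/
abbrev Trunc.t (A : Type) [CommRing A] (d : ℕ) : Trunc A d :=
  AdjoinRoot.root (Polynomial.X ^ d : Polynomial A)

theorem Trunc.t_pow_eq_zero {i : ℕ} (h : d ≤ i) : Trunc.t A d ^ i = 0 := by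
  refine pow_eq_zero_of_le h ?_
  have := AdjoinRoot.mk_self (f := (Polynomial.X ^ d : Polynomial A))
  rwa [map_pow, AdjoinRoot.mk_X] at this

/-- The change of coefficients `A[t] / (t ^ d) → B[t] / (t ^ d)`. -/
def Trunc.map (σ : A →+* B) (d : ℕ) : Trunc A d →+* Trunc B d :=
  AdjoinRoot.map σ _ _ (by simp)

theorem Trunc.map_t (σ : A →+* B) : Trunc.map σ d (Trunc.t A d) = Trunc.t B d :=
  AdjoinRoot.map_root _ _ _ _

theorem Trunc.map_algebraMap (σ : A →+* B) (a : A) :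
    Trunc.map σ d (algebraMap A _ a) = algebraMap B _ (σ a) :=
  AdjoinRoot.map_of _ _ _ _ _

theorem Trunc.ringHom_ext {T : Type} [CommRing T] {g h : Trunc A d →+* T}
    (h1 : ∀ a, g (algebraMap A _ a) = h (algebraMap A _ a)) (h2 : g (.t A d) = h (.t A d)) :
    g = h :=
  AdjoinRoot.ringHom_ext (RingHom.ext h1) h2

/-- The formation of `A[t] / (t ^ d)` commutes with base change. -/
theorem Trunc.isPullback_spec (σ : A →+* B) (d : ℕ) :
    IsPullback (Spec.map (CommRingCat.ofHom (algebraMap B (Trunc B d))))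
      (Spec.map (CommRingCat.ofHom (Trunc.map σ d))) (Spec.map (CommRingCat.ofHom σ))
      (Spec.map (CommRingCat.ofHom (algebraMap A (Trunc A d)))) := by
  have h : IsPushout (CommRingCat.ofHom σ) (CommRingCat.ofHom (algebraMap A (Trunc A d)))
      (CommRingCat.ofHom (algebraMap B (Trunc B d))) (CommRingCat.ofHom (Trunc.map σ d)) := by
    have hs (s : PushoutCocone (CommRingCat.ofHom σ)
        (CommRingCat.ofHom (algebraMap A (Trunc A d)))) :
        (Polynomial.X ^ d : Polynomial B).eval₂ s.inl.hom (s.inr.hom (Trunc.t A d)) = 0 := by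
      rw [Polynomial.eval₂_X_pow, ← map_pow, t_pow_eq_zero le_rfl, map_zero]
    let L (s : PushoutCocone (CommRingCat.ofHom σ)
        (CommRingCat.ofHom (algebraMap A (Trunc A d)))) : Trunc B d →+* s.pt :=
      AdjoinRoot.lift s.inl.hom (s.inr.hom (Trunc.t A d)) (hs s)
    refine ⟨⟨CommRingCat.hom_ext (RingHom.ext fun a => (Trunc.map_algebraMap σ a).symm)⟩,
      ⟨PushoutCocone.IsColimit.mk _
        (fun s => CommRingCat.ofHom (L s))
        (fun s => ?_) (fun s => ?_) (fun s m h1 h2 => ?_)⟩⟩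
    · exact CommRingCat.hom_ext (AdjoinRoot.lift_comp_of (hs s))
    · refine CommRingCat.hom_ext (Trunc.ringHom_ext (fun a => ?_) ?_)
      · refine (congrArg _ (Trunc.map_algebraMap σ a)).trans ?_
        refine (AdjoinRoot.lift_of (hs s)).trans ?_
        exact congr($(s.condition) a)
      · refine (congrArg _ (Trunc.map_t σ)).trans ?_
        exact AdjoinRoot.lift_root (hs s)
    · refine CommRingCat.hom_ext (Trunc.ringHom_ext (fun a => ?_) ?_)
      · exact congr($h1 a).trans (AdjoinRoot.lift_of (hs s)).symm
      · refine Eq.trans ?_ (AdjoinRoot.lift_root (hs s)).symm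
        rw [← h2, ← Trunc.map_t σ]
        rfl
  exact (isPullback_SpecMap_of_isPushout _ _ _ _ h)

end Trunc

/-! ### Graded rings with a chart of Jordan type -/

section JordanChart

variable {A S : Type} [CommRing A] [CommRing S] [Algebra A S]

/-- The graded `A`-algebra `S` is generated in degree one by elements `z i` with the relations
`z i * z (j + 1) = z (i + 1) * z j` satisfied by `z i = t ^ i`, and by a set `Y` of elements
annihilated by `z 0`; moreover `z i ↦ t ^ i` does define a homomorphism to `A[t] / (t ^ d)`. The
indices of the `z i` run over all natural numbers, with `z i = 0` for `d ≤ i`. -/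
structure JordanChart (𝒮 : ℕ → Submodule A S) (d : ℕ) (z : ℕ → S) (Y : Set S) : Prop where
  mem : ∀ i, z i ∈ 𝒮 1
  eq_zero : ∀ i, d ≤ i → z i = 0
  rel : ∀ i j, z i * z (j + 1) = z (i + 1) * z j
  le_span_pow : ∀ n, 𝒮 n ≤ Submodule.span A (Set.range z ∪ Y) ^ n
  mul_eq_zero : ∀ y ∈ Y, z 0 * y = 0
  exists_eval : ∃ p : S →ₐ[A] Trunc A d, ∀ i, p (z i) = Trunc.t A d ^ i

namespace JordanChart

variable {𝒮 : ℕ → Submodule A S} [GradedAlgebra 𝒮] {d : ℕ} {z : ℕ → S} {Y : Set S}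

section Ratio

variable (H : JordanChart 𝒮 d z Y)

/-- The coordinate `z 1 / z 0` on the open set where `z 0` does not vanish. -/
def ratio : HomogeneousLocalization.Away 𝒮 (z 0) :=
  .mk 𝒮 (H.mem 0) 1 (z 1) (by simpa using H.mem 1)

/-- `(z 1 / z 0) ^ i = z i / z 0`: the relations express all coordinates by the first ratio. -/
theorem ratio_val_pow (i : ℕ) : H.ratio.val ^ i * algebraMap S _ (z 0) = algebraMap S _ (z i) := by
  have h1 : H.ratio.val * algebraMap S _ (z 0) = algebraMap S _ (z 1) := by
    rw [ratio, HomogeneousLocalization.Away.val_mk, Localization.mk_eq_mk']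
    simpa only [pow_one] using IsLocalization.mk'_spec (Localization.Away (z 0)) (z 1)
      (⟨z 0 ^ 1, ⟨1, rfl⟩⟩ : Submonoid.powers (z 0))
  induction i with
  | zero => rw [pow_zero, one_mul]
  | succ i ih =>
    refine (IsLocalization.Away.algebraMap_isUnit (z 0)).mul_left_injective ?_
    change _ * _ * _ = _ * _
    rw [← map_mul, mul_comm (z (i + 1)), H.rel 0 i, map_mul, ← h1, ← ih]
    ring

theorem ratio_pow_eq_zero : H.ratio ^ d = 0 := by
  apply HomogeneousLocalization.val_injective
  rw [HomogeneousLocalization.val_pow, HomogeneousLocalization.val_zero]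
  refine ((IsLocalization.Away.algebraMap_isUnit (z 0)).mul_left_eq_zero).mp ?_
  rw [H.ratio_val_pow, H.eq_zero d le_rfl, map_zero]

/-- The homomorphism from `A[t] / (t ^ d)` to the coordinate ring of the open set where `z 0` does
not vanish; it sends `t` to `z 1 / z 0`. -/
def toAway : Trunc A d →+* HomogeneousLocalization.Away 𝒮 (z 0) :=
  AdjoinRoot.lift ((HomogeneousLocalization.fromZeroRingHom 𝒮 _).comp (toDegreeZero 𝒮)) H.ratio
    (by rw [Polynomial.eval₂_X_pow, H.ratio_pow_eq_zero])

theorem toAway_t : H.toAway (Trunc.t A d) = H.ratio := AdjoinRoot.lift_root _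

theorem toAway_algebraMap (a : A) : H.toAway (algebraMap A _ a) =
    HomogeneousLocalization.fromZeroRingHom 𝒮 _ (toDegreeZero 𝒮 a) := AdjoinRoot.lift_of _

theorem toAway_algebraMap_val (a : A) : (H.toAway (algebraMap A _ a)).val =
    algebraMap S _ (algebraMap A S a) := by
  rw [H.toAway_algebraMap]; rfl

/-- The evaluation `z i ↦ t ^ i` sends `z 0` to `1`, hence extends to the localization, where it is
a left inverse of `toAway`. -/
theorem toAway_injective : Function.Injective H.toAway := by
  obtain ⟨p, hp⟩ := H.exists_eval
  have h0 : p (z 0) = 1 := by rw [hp, pow_zero]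
  let q : Localization.Away (z 0) →+* Trunc A d :=
    IsLocalization.Away.lift (z 0) (g := p.toRingHom) (h0 ▸ isUnit_one)
  have hq : ∀ x, q (algebraMap S _ x) = p x := fun x => IsLocalization.Away.lift_eq _ _ _
  let g := (q.comp (algebraMap (HomogeneousLocalization.Away 𝒮 (z 0)) _)).comp H.toAway
  have hg : g = RingHom.id _ := by
    refine Trunc.ringHom_ext (fun a => ?_) ?_
    · change q (H.toAway _).val = _
      rw [H.toAway_algebraMap_val, hq, AlgHom.commutes]; rfl
    · change q (H.toAway _).val = _
      have h1 := congrArg q (H.ratio_val_pow 1)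
      rw [map_mul, hq, hq, h0, mul_one, pow_one, hp, pow_one] at h1
      rw [H.toAway_t, h1]; rfl
  exact Function.LeftInverse.injective (g := q.comp (algebraMap _ _)) fun x => congr($hg x)

/-- Every element of degree `n` becomes a polynomial in `z 1 / z 0` after division by `z 0 ^ n`; the
elements of `Y` become zero. -/
theorem exists_toAway {n : ℕ} {x : S} (hx : x ∈ Submodule.span A (Set.range z ∪ Y) ^ n) :
    ∃ q, (H.toAway q).val * algebraMap S _ (z 0) ^ n = algebraMap S _ x := by
  induction hx using Submodule.pow_induction_on_left' with
  | algebraMap r =>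
    exact ⟨algebraMap A _ r, by rw [H.toAway_algebraMap_val, pow_zero, mul_one]⟩
  | add x y i hx hy ihx ihy =>
    obtain ⟨p, hp⟩ := ihx
    obtain ⟨q, hq⟩ := ihy
    exact ⟨p + q, by rw [map_add, HomogeneousLocalization.val_add, map_add, ← hp, ← hq, add_mul]⟩
  | mem_mul m hm i x hx ih =>
    obtain ⟨q, hq⟩ := ih
    obtain ⟨p, hp⟩ : ∃ p, (H.toAway p).val * algebraMap S _ (z 0) = algebraMap S _ m := by
      induction hm using Submodule.span_induction with
      | mem y hy =>
        obtain ⟨i, rfl⟩ | hy := hy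
        · refine ⟨Trunc.t A d ^ i, ?_⟩
          rw [map_pow, H.toAway_t, HomogeneousLocalization.val_pow, H.ratio_val_pow]
        · refine ⟨0, ?_⟩
          rw [map_zero, HomogeneousLocalization.val_zero, zero_mul]
          refine (((IsLocalization.Away.algebraMap_isUnit (z 0)).mul_right_eq_zero).mp ?_).symm
          rw [← map_mul, H.mul_eq_zero y hy, map_zero]
      | zero =>
        exact ⟨0, by rw [map_zero, HomogeneousLocalization.val_zero, zero_mul, map_zero]⟩
      | add x y _ _ ihx ihy =>
        obtain ⟨p, hp⟩ := ihx
        obtain ⟨q, hq⟩ := ihy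
        exact ⟨p + q, by
          rw [map_add, HomogeneousLocalization.val_add, map_add, ← hp, ← hq, add_mul]⟩
      | smul a x _ ih =>
        obtain ⟨p, hp⟩ := ih
        refine ⟨algebraMap A _ a * p, ?_⟩
        rw [map_mul, HomogeneousLocalization.val_mul, H.toAway_algebraMap_val, Algebra.smul_def,
          map_mul, mul_assoc, hp]
    refine ⟨p * q, ?_⟩
    rw [map_mul, HomogeneousLocalization.val_mul, map_mul, ← hp, ← hq, pow_succ]
    ring

theorem toAway_bijective : Function.Bijective H.toAway := by
  refine ⟨H.toAway_injective, fun x => ?_⟩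
  obtain ⟨n, x, hx, rfl⟩ := HomogeneousLocalization.Away.mk_surjective 𝒮 (H.mem 0) x
  rw [smul_eq_mul, mul_one] at hx
  obtain ⟨q, hq⟩ := H.exists_toAway (H.le_span_pow n hx)
  refine ⟨q, HomogeneousLocalization.val_injective _ ?_⟩
  rw [HomogeneousLocalization.Away.val_mk, Localization.mk_eq_mk', IsLocalization.eq_mk'_iff_mul_eq,
    ← hq, map_pow]

instance isIso_spec_toAway : IsIso (Spec.map (CommRingCat.ofHom H.toAway)) := by
  have : IsIso (CommRingCat.ofHom H.toAway) :=
    (ConcreteCategory.isIso_iff_bijective _).mpr H.toAway_bijective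
  infer_instance

/-- The open immersion of the locus where `z 0` does not vanish. -/
def specι : Spec (.of (Trunc A d)) ⟶ Proj 𝒮 :=
  inv (Spec.map (CommRingCat.ofHom H.toAway)) ≫ Proj.awayι 𝒮 (z 0) (H.mem 0) one_pos

theorem spec_toAway_specι : Spec.map (CommRingCat.ofHom H.toAway) ≫ H.specι =
    Proj.awayι 𝒮 (z 0) (H.mem 0) one_pos :=
  IsIso.hom_inv_id_assoc _ _

instance : IsOpenImmersion H.specι := by unfold specι; infer_instance

theorem opensRange_specι : H.specι.opensRange = Proj.basicOpen 𝒮 (z 0) :=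
  (Scheme.Hom.opensRange_comp_of_isIso _ _).trans (Proj.opensRange_awayι ..)

theorem specι_projToSpec :
    H.specι ≫ projToSpec 𝒮 = Spec.map (CommRingCat.ofHom (algebraMap A (Trunc A d))) := by
  rw [← cancel_epi (Spec.map (CommRingCat.ofHom H.toAway)), reassoc_of% H.spec_toAway_specι,
    projToSpec, Proj.awayι_toSpecZero_assoc, ← Spec.map_comp, ← Spec.map_comp]
  congr 1
  exact CommRingCat.hom_ext (RingHom.ext fun a => (H.toAway_algebraMap a).symm)

end Ratio

/-- A point at which `z 0` vanishes is a zero of all `z i`, since `z (i + 1) ^ 2 = z (i + 2) * z i`.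
-/
theorem mem_of_zero_mem (H : JordanChart 𝒮 d z Y) (x : Proj 𝒮)
    (h : z 0 ∈ x.asHomogeneousIdeal) (i : ℕ) : z i ∈ x.asHomogeneousIdeal := by
  induction i with
  | zero => exact h
  | succ i ih =>
    refine (x.isPrime.mem_or_mem (?_ : z (i + 1) * z (i + 1) ∈ _)).elim id id
    rw [H.rel (i + 1) i]
    exact Ideal.mul_mem_left _ _ ih

/-- An ideal that contains the generators in degree one contains everything of positive degree. -/
theorem le_of_subset {n : ℕ} (hn : 0 < n) {s : Set S} {I : Ideal S} (hs : s ⊆ I) {x : S}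
    (hx : x ∈ Submodule.span A s ^ n) : x ∈ I := by
  obtain ⟨n, rfl⟩ := Nat.exists_eq_add_one_of_ne_zero hn.ne'
  rw [pow_succ] at hx
  have h1 : Submodule.span A s ≤ I.restrictScalars A := Submodule.span_le.mpr hs
  exact (Submodule.mul_le.mpr fun a _ b hb => I.mul_mem_left a (h1 hb) :
    Submodule.span A s ^ n * Submodule.span A s ≤ I.restrictScalars A) hx

theorem irrelevant_le (H : JordanChart 𝒮 d z Y) {I : HomogeneousIdeal 𝒮}
    (hI : ∀ i, z i ∈ I) (hY : ∀ y ∈ Y, y ∈ I) : HomogeneousIdeal.irrelevant 𝒮 ≤ I := by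
  rw [HomogeneousIdeal.irrelevant_le]
  intro n hn x hx
  refine le_of_subset hn ?_ (H.le_span_pow n hx)
  rintro _ (⟨i, rfl⟩ | hy)
  · exact hI i
  · exact hY _ hy

/-- Without the elements of `Y`, the single chart where `z 0` does not vanish is all of `Proj 𝒮`. -/
theorem basicOpen_eq_top (H : JordanChart 𝒮 d z ∅) : Proj.basicOpen 𝒮 (z 0) = ⊤ := by
  refine top_le_iff.mp fun x _ h => x.not_irrelevant_le ?_
  exact H.irrelevant_le (H.mem_of_zero_mem x h) fun y hy => hy.elim

theorem isIso_specι (H : JordanChart 𝒮 d z ∅) : IsIso H.specι := by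
  refine isIso_of_isOpenImmersion_of_opensRange_eq_top _ ?_
  rw [H.opensRange_specι, H.basicOpen_eq_top]

section Map

variable {B T : Type} [CommRing B] [CommRing T] [Algebra B T] {𝒯 : ℕ → Submodule B T}
  [GradedAlgebra 𝒯] {z' : ℕ → T} {Y' : Set T} {σ : A →+* B} {h : 𝒮 →+*ᵍ 𝒯}

/-- A homomorphism that hits the generators `z' i` in degree one induces a morphism on all of `Proj
𝒯`. -/
theorem irrelevant_le_map (H : JordanChart 𝒮 d z Y) (H' : JordanChart 𝒯 d z' ∅)
    (hz : ∀ i, h (z i) = z' i) :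
    HomogeneousIdeal.irrelevant 𝒯 ≤ (HomogeneousIdeal.irrelevant 𝒮).map h := by
  refine H'.irrelevant_le (fun i => ?_) fun y hy => hy.elim
  rw [← hz]
  exact Ideal.mem_map_of_mem _ (HomogeneousIdeal.mem_irrelevant_of_mem 𝒮 one_pos (H.mem i))

/-- On the charts, a homomorphism compatible with the coordinates is the change of coefficients
`A[t] / (t ^ d) → B[t] / (t ^ d)`. -/
theorem specι_projMap (H : JordanChart 𝒮 d z Y) (H' : JordanChart 𝒯 d z' Y')
    (hσ : ∀ a, h (algebraMap A S a) = algebraMap B T (σ a)) (hz : ∀ i, h (z i) = z' i)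
    (hirr : HomogeneousIdeal.irrelevant 𝒯 ≤ (HomogeneousIdeal.irrelevant 𝒮).map h) :
    H'.specι ≫ Proj.map h hirr = Spec.map (CommRingCat.ofHom (Trunc.map σ d)) ≫ H.specι := by
  obtain rfl : (fun i => h (z i)) = z' := funext hz
  have h1 : (HomogeneousLocalization.Away.map h (z 0)).comp H.toAway =
      H'.toAway.comp (Trunc.map σ d) := by
    refine Trunc.ringHom_ext (fun a => ?_) ?_
    · apply HomogeneousLocalization.val_injective
      simp only [RingHom.comp_apply]
      rw [Trunc.map_algebraMap, H'.toAway_algebraMap_val, H.toAway_algebraMap, ← hσ]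
      change Localization.mk (h (algebraMap A S a)) ⟨h 1, _⟩ =
        Localization.mk (h (algebraMap A S a)) 1
      congr 1
      exact Subtype.ext (map_one h)
    · simp only [RingHom.comp_apply]
      rw [Trunc.map_t, H.toAway_t, H'.toAway_t, ratio, ratio,
        HomogeneousLocalization.Away.map_mk]
  rw [← cancel_epi (Spec.map (CommRingCat.ofHom H'.toAway)), reassoc_of% H'.spec_toAway_specι,
    Proj.awayι_comp_map h hirr one_pos (z 0) (H.mem 0), ← H.spec_toAway_specι,
    ← Spec.map_comp_assoc, ← Spec.map_comp_assoc]
  congr 2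
  exact CommRingCat.hom_ext h1

/-- The formation of `Proj` commutes with base change, since both sides are spectra of truncated
polynomial rings. -/
theorem isPullback_projMap (H : JordanChart 𝒮 d z ∅) (H' : JordanChart 𝒯 d z' ∅)
    (hσ : ∀ a, h (algebraMap A S a) = algebraMap B T (σ a)) (hz : ∀ i, h (z i) = z' i)
    (hirr : HomogeneousIdeal.irrelevant 𝒯 ≤ (HomogeneousIdeal.irrelevant 𝒮).map h) :
    IsPullback (projToSpec 𝒯) (Proj.map h hirr) (Spec.map (CommRingCat.ofHom σ))
      (projToSpec 𝒮) := by
  have := H.isIso_specι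
  have := H'.isIso_specι
  refine (Trunc.isPullback_spec σ d).of_iso (asIso H'.specι) (Iso.refl _) (asIso H.specι)
    (Iso.refl _) ?_ ?_ ?_ ?_
  · exact (Category.comp_id _).trans H'.specι_projToSpec.symm
  · exact (H.specι_projMap H' hσ hz hirr).symm
  · exact (Category.comp_id _).trans (Category.id_comp _).symm
  · exact (Category.comp_id _).trans H.specι_projToSpec.symm

/-- If only the elements of `Y` are lost, the induced morphism identifies `Proj 𝒯` with the open
locus of `Proj 𝒮` where `z 0` does not vanish. -/
theorem isOpenImmersion_projMap (H : JordanChart 𝒮 d z Y) (H' : JordanChart 𝒯 d z' ∅)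
    (hb : Function.Bijective σ) (hσ : ∀ a, h (algebraMap A S a) = algebraMap B T (σ a))
    (hz : ∀ i, h (z i) = z' i)
    (hirr : HomogeneousIdeal.irrelevant 𝒯 ≤ (HomogeneousIdeal.irrelevant 𝒮).map h) :
    IsOpenImmersion (Proj.map h hirr) ∧
      Set.range (Proj.map h hirr) = (Proj.basicOpen 𝒮 (z 0) : Set (Proj 𝒮)) := by
  have := H'.isIso_specι
  have : IsIso (CommRingCat.ofHom σ) := (ConcreteCategory.isIso_iff_bijective _).mpr hb
  have : IsIso (Spec.map (CommRingCat.ofHom (Trunc.map σ d))) :=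
    (Trunc.isPullback_spec σ d).isIso_snd_of_isIso
  have h1 : Proj.map h hirr =
      (inv H'.specι ≫ Spec.map (CommRingCat.ofHom (Trunc.map σ d))) ≫ H.specι := by
    rw [Category.assoc, ← H.specι_projMap H' hσ hz hirr, IsIso.inv_hom_id_assoc]
  have h2 : IsOpenImmersion (Proj.map h hirr) := by rw [h1]; infer_instance
  refine ⟨h2, ?_⟩
  rw [← H.opensRange_specι, h1]
  exact congrArg SetLike.coe (Scheme.Hom.opensRange_comp_of_isIso
    (inv H'.specι ≫ Spec.map (CommRingCat.ofHom (Trunc.map σ d))) H.specι)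

end Map

end JordanChart

end JordanChart

/-! ### Matrices commuting with a Jordan matrix -/

section Jordan

variable {R : Type} [CommRing R]

/-- A Jordan block acts on a sequence of vectors, continued by zero, as `c` plus the shift. -/
theorem jordanBlock_row_sum {V : Type} [AddCommGroup V] [Module R V] (c : R) {d : ℕ}
    (x : ℕ → V) (hx : ∀ i, d ≤ i → x i = 0) (a : Fin d) :
    ∑ k : Fin d, jordanBlock c d a k • x k = c • x a + x (a + 1) := by
  have h1 : ∀ k : Fin d, jordanBlock c d a k • x k =
      (if a = k then c • x k else 0) + if a.val + 1 = k then x k else 0 := by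
    intro k
    rw [jordanBlock]
    split_ifs with h h' h'
    · subst h; omega
    · rw [add_zero]
    · rw [one_smul, zero_add]
    · rw [zero_smul, zero_add]
  rw [Finset.sum_congr rfl fun k _ => h1 k, Finset.sum_add_distrib, Finset.sum_ite_eq,
    if_pos (Finset.mem_univ _)]
  congr 1
  rw [Fin.sum_univ_eq_sum_range (fun k => if a.val + 1 = k then x k else 0) d, Finset.sum_ite_eq]
  split_ifs with h
  · rfl
  · exact (hx _ (by simpa using h)).symm

theorem jordanBlock_col_sum (c : R) {d : ℕ} (x : Fin d → R) (b : Fin d) :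
    ∑ k : Fin d, x k * jordanBlock c d k b =
      x b * c + if h : 0 < b.val then x ⟨b - 1, by omega⟩ else 0 := by
  have h1 : ∀ k : Fin d, x k * jordanBlock c d k b =
      (if k = b then x k * c else 0) + if k.val + 1 = b then x k else 0 := by
    intro k
    rw [jordanBlock]
    split_ifs with h h' h'
    · subst h; omega
    · rw [add_zero]
    · rw [mul_one, zero_add]
    · rw [mul_zero, zero_add]
  rw [Finset.sum_congr rfl fun k _ => h1 k, Finset.sum_add_distrib, Finset.sum_ite_eq',
    if_pos (Finset.mem_univ _)]
  congr 1
  split_ifs with h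
  · rw [Finset.sum_eq_single (⟨b - 1, by omega⟩ : Fin d)]
    · exact if_pos (by simp; omega)
    · intro k _ hk
      exact if_neg fun h' => hk (Fin.ext (by simp; omega))
    · exact fun h => (h (Finset.mem_univ _)).elim
  · exact Finset.sum_eq_zero fun k _ => if_neg (by omega)

variable {s : ℕ} {d : Fin s → ℕ} {c : Fin s → R}

/-- The entries of a matrix in one block, extended by zero beyond the last row. -/
def blockEntry (M : Matrix (Σ v : Fin s, Fin (d v)) (Σ v : Fin s, Fin (d v)) R) (v w : Fin s)
    (a : ℕ) (b : Fin (d w)) : R :=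
  if h : a < d v then M ⟨v, a, h⟩ ⟨w, b⟩ else 0

theorem blockEntry_of_le (M : Matrix (Σ v : Fin s, Fin (d v)) (Σ v : Fin s, Fin (d v)) R)
    {v w : Fin s} {a : ℕ} (h : d v ≤ a) (b : Fin (d w)) : blockEntry M v w a b = 0 :=
  dif_neg h.not_gt

theorem blockEntry_fin (M : Matrix (Σ v : Fin s, Fin (d v)) (Σ v : Fin s, Fin (d v)) R)
    {v w : Fin s} (a : Fin (d v)) (b : Fin (d w)) : blockEntry M v w a b = M ⟨v, a⟩ ⟨w, b⟩ :=
  dif_pos a.2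

variable {M : Matrix (Σ v : Fin s, Fin (d v)) (Σ v : Fin s, Fin (d v)) R}

/-- The equation of commutation with a Jordan matrix, entry by entry. -/
theorem blockEntry_succ
    (hM : M * Matrix.blockDiagonal' (fun v => jordanBlock (c v) (d v)) =
      Matrix.blockDiagonal' (fun v => jordanBlock (c v) (d v)) * M)
    (v w : Fin s) (a : Fin (d v)) (b : Fin (d w)) :
    (c w - c v) * blockEntry M v w a b + (if h : 0 < b.val then
      blockEntry M v w a ⟨b - 1, by omega⟩ else 0) = blockEntry M v w (a + 1) b := by
  have h1 := congrFun (congrFun hM ⟨v, a⟩) ⟨w, b⟩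
  rw [Matrix.mul_apply, Matrix.mul_apply, Fintype.sum_sigma, Fintype.sum_sigma,
    Fintype.sum_eq_single w, Fintype.sum_eq_single v] at h1
  · simp only [Matrix.blockDiagonal'_apply_eq] at h1
    rw [jordanBlock_col_sum] at h1
    have h2 := jordanBlock_row_sum (c v) (fun k => blockEntry M v w k b)
      (fun i hi => blockEntry_of_le M hi b) a
    simp only [blockEntry_fin, smul_eq_mul] at h2
    rw [h2] at h1
    simp only [blockEntry_fin]
    linear_combination h1
  · intro w' hw
    exact Finset.sum_eq_zero fun k _ => by
      rw [Matrix.blockDiagonal'_apply_ne _ _ _ hw.symm, zero_mul]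
  · intro w' hw
    exact Finset.sum_eq_zero fun k _ => by
      rw [Matrix.blockDiagonal'_apply_ne _ _ _ hw, mul_zero]

/-- The off-diagonal blocks solve a Sylvester equation whose only solution is zero. -/
theorem apply_eq_zero_of_commute_jordan
    (hM : M * Matrix.blockDiagonal' (fun v => jordanBlock (c v) (d v)) =
      Matrix.blockDiagonal' (fun v => jordanBlock (c v) (d v)) * M)
    (hc : ∀ v w, v ≠ w → IsUnit (c v - c w))
    {v w : Fin s} (hvw : v ≠ w) (a : Fin (d v)) (b : Fin (d w)) : M ⟨v, a⟩ ⟨w, b⟩ = 0 := by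
  -- Double induction, from the last row upwards and from the first column to the right: by
  -- `blockEntry_succ` an entry times `c w - c v` is a combination of the entries below and to the
  -- left of it.
  have h1 : ∀ (n m a : ℕ) (b : Fin (d w)), d v ≤ a + n → b.val = m →
      blockEntry M v w a b = 0 := by
    intro n
    induction n with
    | zero => exact fun _ a b h _ => blockEntry_of_le M h b
    | succ n ihn =>
      intro m
      induction m with
      | zero =>
        intro a b h hb
        by_cases ha : d v ≤ a
        · exact blockEntry_of_le M ha b
        have h2 := blockEntry_succ hM v w ⟨a, not_le.mp ha⟩ b
        rw [dif_neg (by omega), add_zero, ihn 0 (a + 1) b (by omega) hb] at h2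
        exact ((hc w v hvw.symm).mul_right_eq_zero).mp h2
      | succ m ihm =>
        intro a b h hb
        by_cases ha : d v ≤ a
        · exact blockEntry_of_le M ha b
        have h2 := blockEntry_succ hM v w ⟨a, not_le.mp ha⟩ b
        rw [dif_pos (by omega), ihn (m + 1) (a + 1) b (by omega) hb,
          ihm a ⟨b - 1, by omega⟩ h (by simp; omega), add_zero] at h2
        exact ((hc w v hvw.symm).mul_right_eq_zero).mp h2
  rw [← blockEntry_fin M]
  exact h1 (d v) b a b (by omega) rfl

/-- The diagonal blocks are upper triangular Toeplitz matrices. -/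
theorem exists_toeplitz_of_commute_jordan
    (hM : M * Matrix.blockDiagonal' (fun v => jordanBlock (c v) (d v)) =
      Matrix.blockDiagonal' (fun v => jordanBlock (c v) (d v)) * M)
    (v : Fin s) : ∃ τ : ℕ → R, ∀ a b : Fin (d v),
    M ⟨v, a⟩ ⟨v, b⟩ = if a ≤ b then τ (b - a) else 0 := by
  refine ⟨fun m => if h : m < d v then blockEntry M v v 0 ⟨m, h⟩ else 0, ?_⟩
  have h0 : ∀ (a : Fin (d v)) (b : Fin (d v)), (if h : 0 < b.val then
      blockEntry M v v a ⟨b - 1, by omega⟩ else 0) = blockEntry M v v (a + 1) b := by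
    intro a b
    rw [← blockEntry_succ hM v v a b, sub_self, zero_mul, zero_add]
  have h1 : ∀ (a : ℕ) (b : Fin (d v)), a < d v → blockEntry M v v a b =
      if h : a ≤ b then blockEntry M v v 0 ⟨b - a, by omega⟩ else 0 := by
    intro a
    induction a with
    | zero => exact fun b _ => rfl
    | succ a ih =>
      intro b ha
      rw [← h0 ⟨a, by omega⟩ b]
      by_cases hb : 0 < b.val
      · rw [dif_pos hb, ih _ (by omega)]
        by_cases hab : a + 1 ≤ b
        · rw [dif_pos hab, dif_pos (by simp; omega)]
          congr 2
          simp; omega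
        · rw [dif_neg hab, dif_neg (by simp; omega)]
      · rw [dif_neg hb, dif_neg (by omega)]
  intro a b
  rw [← blockEntry_fin M, h1 a b a.2]
  by_cases h : a ≤ b
  · rw [if_pos h, dif_pos (Fin.le_def.mp h)]
    beta_reduce
    rw [dif_pos (by omega)]
  · rw [if_neg h, dif_neg (fun h' => h (Fin.le_def.mpr h'))]

end Jordan

/-! ### The coordinate rings -/

section CoordChart

variable {A : Type} [CommRing A] {d : ℕ}

theorem submodule_pow_mono {S : Type} [CommRing S] [Algebra A S] {P Q : Submodule A S}
    (h : P ≤ Q) (n : ℕ) : P ^ n ≤ Q ^ n := by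
  induction n with
  | zero => rw [pow_zero, pow_zero]
  | succ n ih => rw [pow_succ, pow_succ]; exact mul_le_mul' ih h

/-- An upper triangular Toeplitz matrix acts on `(1, t, t ^ 2, …)` as multiplication by a polynomial
in `t`. -/
theorem Trunc.toeplitz_sum (τ : ℕ → A) (a : ℕ) :
    ∑ b : Fin d, (if a ≤ b.val then τ (b - a) else 0) • Trunc.t A d ^ b.val =
      (∑ m ∈ Finset.range d, τ m • Trunc.t A d ^ m) * Trunc.t A d ^ a := by
  rw [Fin.sum_univ_eq_sum_range (fun b => (if a ≤ b then τ (b - a) else 0) • Trunc.t A d ^ b) d,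
    Finset.sum_mul]
  simp only [smul_mul_assoc, ← pow_add]
  by_cases h : d ≤ a
  · rw [Finset.sum_eq_zero, Finset.sum_eq_zero]
    · exact fun m _ => by rw [Trunc.t_pow_eq_zero (by omega), smul_zero]
    · intro m hm
      rw [Finset.mem_range] at hm
      rw [if_neg (by omega), zero_smul]
  · obtain ⟨e, rfl⟩ := Nat.exists_eq_add_of_le (not_le.mp h).le
    rw [Finset.sum_range_add, Finset.sum_eq_zero, zero_add, add_comm a e, Finset.sum_range_add]
    · refine (Finset.sum_congr rfl fun m _ => ?_).trans (left_eq_add.mpr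
        (Finset.sum_eq_zero fun m _ => ?_))
      · rw [if_pos (by omega), Nat.add_sub_cancel_left, add_comm a m]
      · rw [Trunc.t_pow_eq_zero (by omega), smul_zero]
    · intro m hm
      rw [Finset.mem_range] at hm
      rw [if_neg (by omega), zero_smul]

variable {M N : Type} [AddCommGroup M] [Module A M] [AddCommGroup N] [Module A N]
  {φ : M →ₗ[A] M ⊗[A] N}

theorem coord_mem (α : Dual A M) : coord φ α ∈ coordGrading φ 1 :=
  ⟨_, ι_mem_symGrading α, rfl⟩

variable (φ) in
/-- The linear coordinates as a linear map. -/
def coordₗ : Dual A M →ₗ[A] CoordRing φ :=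
  (Ideal.Quotient.mkₐ A (higgsIdeal φ)).toLinearMap ∘ₗ SymmetricAlgebra.ι A _

theorem coordₗ_apply (α : Dual A M) : coordₗ φ α = coord φ α := rfl

/-- The equations of the invariant lines. -/
theorem coord_mul_coord (α β : Dual A M) (ξ : Dual A N) :
    coord φ α * coord φ (β ∘ₗ contract φ ξ) = coord φ β * coord φ (α ∘ₗ contract φ ξ) := by
  have : Ideal.Quotient.mk (higgsIdeal φ) (higgsRel φ (α, β, ξ)) = 0 :=
    Ideal.Quotient.eq_zero_iff_mem.mpr (Ideal.subset_span ⟨_, rfl⟩)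
  rw [higgsRel, map_sub, map_mul, map_mul] at this
  exact sub_eq_zero.mp this

theorem coordGrading_le {κ : Type} [Finite κ] (b : Basis κ A M) (n : ℕ) :
    coordGrading φ n ≤ Submodule.span A (Set.range fun i => coord φ (b.coord i)) ^ n := by
  classical
  rw [coordGrading, quotGrading, symGrading, Submodule.map_pow]
  refine submodule_pow_mono ?_ n
  rintro _ ⟨_, ⟨α, rfl⟩, rfl⟩
  change coordₗ φ α ∈ _
  have h1 : α ∈ Submodule.span A (Set.range b.coord) := by
    rw [← Basis.coe_dualBasis, b.dualBasis.span_eq]; trivial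
  have h2 := Submodule.mem_map_of_mem (f := coordₗ φ) h1
  rw [Submodule.map_span, ← Set.range_comp] at h2
  exact h2

/-- A linear form evaluated on the vectors `x a` as a polynomial in `t`. -/
def truncEval (x : Fin d → M) : Dual A M →ₗ[A] Trunc A d where
  toFun α := ∑ a, α (x a) • Trunc.t A d ^ a.val
  map_add' α β := by simp only [LinearMap.add_apply, add_smul, Finset.sum_add_distrib]
  map_smul' r α := by
    simp only [LinearMap.smul_apply, smul_assoc, Finset.smul_sum, RingHom.id_apply]

/-- The vector `∑ a, t ^ a • x a` is an eigenvector of an endomorphism that acts on the `x a` by a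
Toeplitz matrix. -/
theorem truncEval_comp {x : Fin d → M} {T : M →ₗ[A] M} {τ : ℕ → A}
    (hT : ∀ b, T (x b) = ∑ a, (if a ≤ b then τ (b - a) else 0) • x a) (α : Dual A M) :
    truncEval x (α ∘ₗ T) = (∑ m ∈ Finset.range d, τ m • Trunc.t A d ^ m) * truncEval x α := by
  change ∑ b, α (T (x b)) • _ = _ * ∑ a, α (x a) • _
  simp only [hT, map_sum, map_smul, Finset.sum_smul, Finset.mul_sum]
  rw [Finset.sum_comm]
  refine Finset.sum_congr rfl fun a _ => ?_
  rw [mul_smul_comm, ← Trunc.toeplitz_sum, Finset.smul_sum]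
  refine Finset.sum_congr rfl fun b _ => ?_
  rw [smul_eq_mul, mul_comm, mul_smul]
  rfl

/-- If `φ` acts on the vectors `x a` by upper triangular Toeplitz matrices, then
`z ↦ ∑ a, t ^ a • x a` is an invariant line over `A[t] / (t ^ d)`. -/
theorem exists_coordEval {x : Fin d → M}
    (hT : ∀ ξ : Dual A N, ∃ τ : ℕ → A, ∀ b,
      contract φ ξ (x b) = ∑ a, (if a ≤ b then τ (b - a) else 0) • x a) :
    ∃ p : CoordRing φ →ₐ[A] Trunc A d, ∀ α, p (coord φ α) = truncEval x α := by
  have h1 : ∀ α, SymmetricAlgebra.lift (truncEval x) (SymmetricAlgebra.ι A _ α) = truncEval x α :=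
    fun α => SymmetricAlgebra.lift_ι_apply _ _
  refine ⟨Ideal.Quotient.liftₐ (higgsIdeal φ) (SymmetricAlgebra.lift (truncEval x)) ?_, h1⟩
  change higgsIdeal φ ≤ RingHom.ker (SymmetricAlgebra.lift (truncEval x))
  refine Ideal.span_le.mpr ?_
  rintro _ ⟨⟨α, β, ξ⟩, rfl⟩
  obtain ⟨τ, hτ⟩ := hT ξ
  change SymmetricAlgebra.lift (truncEval x) (higgsRel φ (α, β, ξ)) = 0
  simp only [higgsRel, map_sub, map_mul, h1, truncEval_comp hτ]
  ring

/-- A sequence of vectors extended by zero. -/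
def extendZero {V : Type} [Zero V] (x : Fin d → V) (i : ℕ) : V := if h : i < d then x ⟨i, h⟩ else 0

theorem extendZero_fin {V : Type} [Zero V] (x : Fin d → V) (i : Fin d) :
    extendZero x i = x i := dif_pos i.2

theorem extendZero_of_le {V : Type} [Zero V] (x : Fin d → V) {i : ℕ} (h : d ≤ i) :
    extendZero x i = 0 := dif_neg h.not_gt

theorem map_extendZero {V W F : Type} [Zero V] [Zero W] [FunLike F V W] [ZeroHomClass F V W]
    (g : F) (x : Fin d → V) (i : ℕ) : g (extendZero x i) = extendZero (fun a => g (x a)) i := by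
  unfold extendZero
  split_ifs
  · rfl
  · exact map_zero g

/-- The homogeneous coordinate ring in the situation where `φ` acts on part of a basis by upper
triangular Toeplitz matrices, one of which is a Jordan block. -/
theorem jordanChart_coordGrading {κ : Type} [Finite κ] (b : Basis κ A M) {f : Fin d → κ}
    (hf : Function.Injective f)
    (hT : ∀ ξ : Dual A N, ∃ τ : ℕ → A, ∀ j,
      contract φ ξ (b (f j)) = ∑ a, (if a ≤ j then τ (j - a) else 0) • b (f a))
    (hJ : ∃ (ξ : Dual A N) (c : A), ∀ i, extendZero (fun a => b.coord (f a)) i ∘ₗ contract φ ξ =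
      c • extendZero (fun a => b.coord (f a)) i + extendZero (fun a => b.coord (f a)) (i + 1))
    (hY : ∀ (h : 0 < d) (j : κ), j ∉ Set.range f →
      coord φ (b.coord (f ⟨0, h⟩)) * coord φ (b.coord j) = 0) :
    JordanChart (coordGrading φ) d (extendZero fun a => coord φ (b.coord (f a)))
      ((fun j => coord φ (b.coord j)) '' (Set.range f)ᶜ) := by
  classical
  have hz : ∀ i, extendZero (fun a => coord φ (b.coord (f a))) i =
      coord φ (extendZero (fun a => b.coord (f a)) i) := fun i =>
    (map_extendZero (coordₗ φ) _ i).symm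
  refine ⟨fun i => ?_, fun i hi => extendZero_of_le _ hi, fun i j => ?_, fun n => ?_, ?_, ?_⟩
  · rw [hz]; exact coord_mem _
  · -- The equation of the invariant lines for `z i` and `z j`; the terms with `c` cancel.
    obtain ⟨ξ, c, h⟩ := hJ
    have h1 := coord_mul_coord (φ := φ) (extendZero (fun a => b.coord (f a)) i)
      (extendZero (fun a => b.coord (f a)) j) ξ
    rw [h, h, ← coordₗ_apply, ← coordₗ_apply, ← coordₗ_apply, ← coordₗ_apply, map_add, map_add,
      map_smul, map_smul, mul_add, mul_add, mul_smul_comm, mul_smul_comm] at h1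
    rw [hz, hz, hz, hz, ← coordₗ_apply, ← coordₗ_apply, ← coordₗ_apply, ← coordₗ_apply]
    rw [mul_comm (coordₗ φ (extendZero _ j)) (coordₗ φ (extendZero _ i))] at h1
    rw [add_left_cancel h1, mul_comm]
  · refine (coordGrading_le b n).trans (submodule_pow_mono (Submodule.span_mono ?_) n)
    rintro _ ⟨j, rfl⟩
    by_cases hj : j ∈ Set.range f
    · obtain ⟨a, rfl⟩ := hj
      exact Or.inl ⟨a, extendZero_fin _ _⟩
    · exact Or.inr ⟨j, hj, rfl⟩
  · rintro _ ⟨j, hj, rfl⟩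
    by_cases h : 0 < d
    · rw [extendZero, dif_pos h]
      exact hY h j hj
    · rw [extendZero_of_le _ (not_lt.mp h), zero_mul]
  · obtain ⟨p, hp⟩ := exists_coordEval (x := fun a => b (f a)) hT
    refine ⟨p, fun i => ?_⟩
    by_cases hi : i < d
    · rw [extendZero, dif_pos hi, hp]
      change ∑ a, b.coord (f ⟨i, hi⟩) (b (f a)) • Trunc.t A d ^ a.val = _
      rw [Finset.sum_eq_single ⟨i, hi⟩]
      · rw [Basis.coord_apply, Basis.repr_self, Finsupp.single_eq_same, one_smul]
      · intro a _ ha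
        rw [Basis.coord_apply, Basis.repr_self, Finsupp.single_eq_of_ne, zero_smul]
        exact fun h => ha (hf h).symm
      · exact fun h => (h (Finset.mem_univ _)).elim
    · rw [extendZero_of_le _ (not_lt.mp hi), map_zero, Trunc.t_pow_eq_zero (not_lt.mp hi)]

/-- For a Jordan block, the eigenvalue cancels from the defining quadratic forms. -/
theorem matrixRel_jordanBlock (c : A) (i j : Fin d) : matrixRel (jordanBlock c d) i j =
    MvPolynomial.X i * extendZero MvPolynomial.X (j + 1) -
      MvPolynomial.X j * extendZero MvPolynomial.X (i + 1) := by
  have h : ∀ a : Fin d, ∑ k, MvPolynomial.C (jordanBlock c d a k) * MvPolynomial.X k =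
      MvPolynomial.C c * MvPolynomial.X a +
        extendZero (MvPolynomial.X (R := A)) (a.val + 1) := by
    intro a
    have := jordanBlock_row_sum c (extendZero (d := d) (MvPolynomial.X (R := A)))
      (fun i hi => extendZero_of_le _ hi) a
    simpa only [extendZero_fin, MvPolynomial.smul_eq_C_mul] using this
  have h1 : matrixRel (jordanBlock c d) i j =
      MvPolynomial.X i * (∑ k, MvPolynomial.C (jordanBlock c d j k) * MvPolynomial.X k) -
      MvPolynomial.X j * (∑ k, MvPolynomial.C (jordanBlock c d i k) * MvPolynomial.X k) := by
    rw [matrixRel, Finset.mul_sum, Finset.mul_sum, ← Finset.sum_sub_distrib]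
    exact Finset.sum_congr rfl fun k _ => by ring
  rw [h1, h, h]
  ring

/-- The homogeneous coordinate ring of `V_M` for a Jordan block `M`. -/
theorem jordanChart_matrixGrading (c : A) : JordanChart (matrixGrading (jordanBlock c d)) d
    (extendZero (matrixVar (jordanBlock c d))) ∅ := by
  have hz : ∀ i, extendZero (matrixVar (jordanBlock c d)) i =
      Ideal.Quotient.mk (matrixIdeal (jordanBlock c d)) (extendZero MvPolynomial.X i) :=
    fun i => (map_extendZero (Ideal.Quotient.mk _) _ i).symm
  have hrel : ∀ i j : Fin d, matrixVar (jordanBlock c d) i *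
      extendZero (matrixVar (jordanBlock c d)) (j + 1) =
      matrixVar (jordanBlock c d) j * extendZero (matrixVar (jordanBlock c d)) (i + 1) := by
    have h1 : ∀ i j : Fin d, i < j → matrixVar (jordanBlock c d) i *
        extendZero (matrixVar (jordanBlock c d)) (j + 1) =
        matrixVar (jordanBlock c d) j * extendZero (matrixVar (jordanBlock c d)) (i + 1) := by
      intro i j hij
      have : Ideal.Quotient.mk (matrixIdeal (jordanBlock c d))
          (matrixRel (jordanBlock c d) i j) = 0 :=
        Ideal.Quotient.eq_zero_iff_mem.mpr (Ideal.subset_span ⟨i, j, hij, rfl⟩)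
      rw [matrixRel_jordanBlock, map_sub, map_mul, map_mul, ← hz, ← hz] at this
      exact sub_eq_zero.mp this
    intro i j
    rcases lt_trichotomy i j with h | rfl | h
    · exact h1 i j h
    · rfl
    · exact (h1 j i h).symm
  refine ⟨fun i => ?_, fun i hi => extendZero_of_le _ hi, fun i j => ?_, fun n => ?_,
    fun y hy => hy.elim, ?_⟩
  · rw [extendZero]
    split_ifs with hi
    · exact ⟨_, MvPolynomial.isHomogeneous_X _ _, rfl⟩
    · exact zero_mem _
  · by_cases hi : i < d
    · by_cases hj : j < d
      · have := hrel ⟨i, hi⟩ ⟨j, hj⟩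
        rw [← extendZero_fin (matrixVar _) ⟨i, hi⟩, ← extendZero_fin (matrixVar _) ⟨j, hj⟩] at this
        rw [this, mul_comm]
      · rw [extendZero_of_le _ (not_lt.mp hj), extendZero_of_le _ (i := j + 1) (by omega),
          mul_zero, mul_zero]
    · rw [extendZero_of_le _ (not_lt.mp hi), extendZero_of_le _ (i := i + 1) (by omega),
          zero_mul, zero_mul]
  · rw [matrixGrading, quotGrading, ← MvPolynomial.homogeneousSubmodule_one_pow, Submodule.map_pow]
    refine submodule_pow_mono ?_ n
    rw [MvPolynomial.homogeneousSubmodule_one_eq_span_X, Submodule.map_span]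
    refine Submodule.span_mono ?_
    rintro _ ⟨_, ⟨a, rfl⟩, rfl⟩
    exact Or.inl ⟨a, extendZero_fin _ a⟩
  · let p : MvPolynomial (Fin d) A →ₐ[A] Trunc A d :=
      MvPolynomial.aeval fun a : Fin d => Trunc.t A d ^ a.val
    have hp : ∀ i, p (extendZero MvPolynomial.X i) = Trunc.t A d ^ i := by
      intro i
      rw [map_extendZero]
      by_cases hi : i < d
      · rw [extendZero, dif_pos hi]; exact MvPolynomial.aeval_X _ _
      · rw [extendZero_of_le _ (not_lt.mp hi), Trunc.t_pow_eq_zero (not_lt.mp hi)]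
    refine ⟨Ideal.Quotient.liftₐ _ p ?_, fun i => ?_⟩
    · change matrixIdeal (jordanBlock c d) ≤ RingHom.ker p
      refine Ideal.span_le.mpr ?_
      rintro _ ⟨i, j, -, rfl⟩
      change p (matrixRel _ _ _) = 0
      rw [matrixRel_jordanBlock, ← extendZero_fin MvPolynomial.X i,
        ← extendZero_fin MvPolynomial.X j]
      simp only [map_sub, map_mul, hp]
      ring
    · rw [hz]; exact hp i

end CoordChart

/-! ### Free sheaves of modules -/

section FreeModule

variable {Y : Scheme.{0}}

theorem Modules.app_naturality {G H : Y.Modules} (g : G ⟶ H) {V W : Y.Opens} (i : V ⟶ W)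
    (x : Γ(G, W)) : (g.app V).hom ((G.presheaf.map i.op).hom x) =
      (H.presheaf.map i.op).hom ((g.app W).hom x) :=
  congr($(g.mapPresheaf.naturality i.op) x)

variable (Y) in
/-- The structure sheaf as a sheaf of modules. -/
def unitModule : Y.Modules := SheafOfModules.unit Y.ringCatSheaf

/-- The section `1` of the structure sheaf. -/
def unitModule.one (W : Y.Opens) : Γ(unitModule Y, W) := (1 : Γ(Y, W))

theorem unitModule.smul_one_eq {W : Y.Opens} (x : Γ(unitModule Y, W)) :
    (show Γ(Y, W) from x) • unitModule.one W = x :=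
  mul_one (show Γ(Y, W) from x)

theorem unitModule.map_one {V W : Y.Opens} (i : V ⟶ W) :
    ((unitModule Y).presheaf.map i.op).hom (unitModule.one W) = unitModule.one V :=
  (Y.presheaf.map i.op).hom.map_one

/-- The morphism from the structure sheaf that sends `1` to a given global section. -/
def unitModule.homOfSection (G : Y.Modules) (g : Γ(G, ⊤)) : unitModule Y ⟶ G :=
  (SheafOfModules.unitHomEquiv (R := Y.ringCatSheaf) G).symm
    (PresheafOfModules.sectionsMk (M := G.val)
      (fun W => (G.presheaf.map (homOfLE (le_top (a := W.unop))).op).hom g)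
      fun V W f => by
        change (G.presheaf.map _ ≫ G.presheaf.map f).hom g = _
        rw [← G.presheaf.map_comp]; rfl)

theorem unitModule.homOfSection_one (G : Y.Modules) (g : Γ(G, ⊤)) (W : Y.Opens) :
    ((unitModule.homOfSection G g).app W).hom (unitModule.one W) =
      (G.presheaf.map (homOfLE (le_top (a := W))).op).hom g :=
  one_smul Γ(Y, W) ((G.presheaf.map (homOfLE (le_top (a := W))).op).hom g : Γ(G, W))

instance : HasFiniteBiproducts Y.Modules :=
  Abelian.hasFiniteBiproducts

variable (Y) in
/-- The free sheaf of modules of rank `d`. -/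
def freeModule (d : ℕ) : Y.Modules := ⨁ fun _ : Fin d => unitModule Y

namespace freeModule

variable {d : ℕ}

/-- The inclusion of a summand. -/
def incl (a : Fin d) : unitModule Y ⟶ freeModule Y d := biproduct.ι (fun _ => unitModule Y) a

/-- The projection to a summand. -/
def proj (a : Fin d) : freeModule Y d ⟶ unitModule Y := biproduct.π (fun _ => unitModule Y) a

theorem incl_proj_self (a : Fin d) : incl (Y := Y) a ≫ proj a = 𝟙 _ :=
  biproduct.ι_π_self (fun _ : Fin d => unitModule Y) a

theorem incl_proj_ne {a b : Fin d} (h : a ≠ b) : incl (Y := Y) a ≫ proj b = 0 :=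
  biproduct.ι_π_ne (fun _ : Fin d => unitModule Y) h

/-- The standard sections of the free sheaf of modules. -/
def std (W : Y.Opens) (a : Fin d) : Γ(freeModule Y d, W) := ((incl a).app W).hom (unitModule.one W)

theorem proj_std (W : Y.Opens) (a b : Fin d) : ((proj b).app W).hom (std W a) =
    (if a = b then 1 else 0 : Γ(Y, W)) • unitModule.one W := by
  change ((incl a ≫ proj b).app W).hom (unitModule.one W) = _
  split_ifs with h
  · subst h
    rw [incl_proj_self, one_smul]; rfl
  · rw [incl_proj_ne h, zero_smul]; rfl

theorem app_sum {G H : Y.Modules} {ι : Type} (t : Finset ι) (g : ι → (G ⟶ H)) (W : Y.Opens)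
    (x : Γ(G, W)) : ((∑ i ∈ t, g i).app W).hom x = ∑ i ∈ t, ((g i).app W).hom x := by
  classical
  induction t using Finset.induction_on with
  | empty => rw [Finset.sum_empty, Finset.sum_empty]; rfl
  | insert i t hi ih =>
    rw [Finset.sum_insert hi, Finset.sum_insert hi, ← ih]; rfl

theorem eq_sum_std (W : Y.Opens) (x : Γ(freeModule Y d, W)) :
    x = ∑ a, (show Γ(Y, W) from ((proj a).app W).hom x) • std W a := by
  have h1 : ∑ a : Fin d, proj (Y := Y) a ≫ incl a = 𝟙 _ :=
    biproduct.total (f := fun _ : Fin d => unitModule Y)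
  have h2 := app_sum Finset.univ (fun a : Fin d => proj (Y := Y) a ≫ incl a) W x
  rw [h1] at h2
  refine Eq.trans h2 (Finset.sum_congr rfl fun a _ => ?_)
  change ((incl a).app W).hom (((proj a).app W).hom x) = _
  rw [std]
  refine Eq.trans ?_ (Scheme.Modules.Hom.app_smul (incl a) _ (unitModule.one W))
  rw [unitModule.smul_one_eq]

/-- The morphism from a free sheaf given by global sections. -/
def desc (G : Y.Modules) (g : Fin d → Γ(G, ⊤)) : freeModule Y d ⟶ G :=
  biproduct.desc fun a => unitModule.homOfSection G (g a)

theorem incl_desc (G : Y.Modules) (g : Fin d → Γ(G, ⊤)) (a : Fin d) :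
    incl a ≫ desc G g = unitModule.homOfSection G (g a) :=
  biproduct.ι_desc _ a

variable [Y.Over (Spec (.of ℂ))]

theorem resMod_std {V W : Y.Opens} (h : V ≤ W) (a : Fin d) :
    resMod (freeModule Y d) h (std W a) = std V a := by
  refine (Modules.app_naturality (incl a) (homOfLE h) (unitModule.one W)).symm.trans ?_
  rw [unitModule.map_one]; rfl

variable (Y d) in
/-- The standard frame of the free sheaf of modules. -/
def frame : Frame (freeModule Y d) ⊤ (Fin d) where
  sec := std ⊤
  linearIndependent {V} h := by
    simp only [resMod_std]
    rw [Fintype.linearIndependent_iff]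
    intro g hg b
    have h1 := congrArg ((proj b).app V).hom hg
    rw [map_sum, map_zero] at h1
    have h2 : ∀ a, ((proj b).app V).hom (g a • std V a) =
        (show Γ(Y, V) from if a = b then g a else 0) • unitModule.one V := by
      intro a
      refine (Scheme.Modules.Hom.app_smul (proj b) (g a) (std V a)).trans ?_
      change g a • ((proj b).app V).hom (std V a) = _
      rw [proj_std, smul_smul]
      congr 1
      exact mul_ite_zero _ _ _ |>.trans (by rw [mul_one])
    simp only [h2] at h1
    rw [← Finset.sum_smul] at h1
    have h3 : ∑ a, (if a = b then g a else 0 : Γ(Y, V)) = 0 :=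
      (mul_one (∑ a, (if a = b then g a else 0 : Γ(Y, V)))).symm.trans h1
    rwa [Finset.sum_ite_eq', if_pos (Finset.mem_univ b)] at h3
  span {V} h := by
    simp only [resMod_std]
    intro x _
    rw [eq_sum_std V x]
    exact Submodule.sum_mem _ fun a _ => Submodule.smul_mem _ _ (Submodule.subset_span ⟨a, rfl⟩)

theorem desc_std (G : Y.Modules) (g : Fin d → Γ(G, ⊤)) (W : Y.Opens) (a : Fin d) :
    ((desc G g).app W).hom (std W a) = resMod G le_top (g a) := by
  refine Eq.trans ?_ (unitModule.homOfSection_one G (g a) W)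
  change ((incl a ≫ desc G g).app W).hom (unitModule.one W) = _
  rw [incl_desc]

end freeModule

end FreeModule

/-! ### Higgs fields in frames -/

section WedgeSquare

variable {A M N κ : Type} [CommRing A] [AddCommGroup M] [Module A M] [AddCommGroup N] [Module A N]
  [Fintype κ] {n : ℕ} {φ : M →ₗ[A] M ⊗[A] N} {b : κ → M} {ω : Fin n → N}
  {Φ : Fin n → Matrix κ κ A}

/-- The contracted Higgs field has the matrix `∑ k, ξ (ω k) • Φ k`. -/
theorem contract_frame (hφ : ∀ j, φ (b j) = ∑ k, ∑ i, (Φ k i j • b i) ⊗ₜ ω k) (ξ : Dual A N)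
    (j : κ) : contract φ ξ (b j) = ∑ i, (∑ k, ξ (ω k) * Φ k i j) • b i := by
  simp only [contract, LinearMap.comp_apply, hφ, map_sum, LinearMap.lTensor_tmul,
    LinearEquiv.coe_coe, TensorProduct.rid_tmul, smul_smul, Finset.sum_smul]
  exact Finset.sum_comm

/-- The coefficients of `φ ∧ φ` are the entries of the products `Φ l * Φ k`. -/
theorem wedgeSquare_frame (hφ : ∀ j, φ (b j) = ∑ k, ∑ i, (Φ k i j • b i) ⊗ₜ ω k) (j : κ) :
    wedgeSquare φ (b j) = ∑ m, b m ⊗ₜ[A] ∑ k, ∑ l, (Φ l * Φ k) m j •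
      (ExteriorAlgebra.ι A (ω l) * ExteriorAlgebra.ι A (ω k)) := by
  have h1 : wedgeSquare φ (b j) = ∑ k, ∑ i, ∑ l, ∑ m, b m ⊗ₜ[A] ((Φ l m i * Φ k i j) •
      (ExteriorAlgebra.ι A (ω l) * ExteriorAlgebra.ι A (ω k))) := by
    simp only [wedgeSquare, LinearMap.comp_apply, hφ, map_sum, LinearMap.rTensor_tmul, map_smul,
      TensorProduct.sum_tmul, LinearEquiv.coe_coe, ← TensorProduct.smul_tmul', Finset.smul_sum,
      TensorProduct.assoc_tmul, LinearMap.lTensor_tmul, wedge, TensorProduct.map_tmul,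
      LinearMap.mul'_apply, TensorProduct.tmul_smul, smul_smul]
    simp only [mul_comm]
  rw [h1]
  simp only [Matrix.mul_apply, Finset.sum_smul, TensorProduct.tmul_sum]
  refine Eq.trans (Finset.sum_congr rfl fun k _ => ?_) Finset.sum_comm
  refine Finset.sum_comm.trans (Eq.trans (Finset.sum_congr rfl fun l _ => ?_) Finset.sum_comm)
  exact Finset.sum_comm

theorem wedgeSquare_eq_zero {b : Basis κ A M}
    (hφ : ∀ j, φ (b j) = ∑ k, ∑ i, (Φ k i j • b i) ⊗ₜ ω k)
    (hΦ : ∀ k l, Φ k * Φ l = Φ l * Φ k) : wedgeSquare φ = 0 := by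
  refine b.ext fun j => ?_
  rw [wedgeSquare_frame hφ, LinearMap.zero_apply]
  refine Finset.sum_eq_zero fun m _ => ?_
  suffices h : ∑ k, ∑ l, (Φ l * Φ k) m j •
      (ExteriorAlgebra.ι A (ω l) * ExteriorAlgebra.ι A (ω k)) = 0 by
    rw [h, TensorProduct.tmul_zero]
  -- The terms for `(k, l)` and `(l, k)` cancel, and those with `k = l` vanish.
  rw [← Fintype.sum_prod_type']
  refine Finset.sum_involution (fun p _ => p.swap) (fun p _ => ?_) (fun p _ h h' => h ?_)
    (fun _ _ => Finset.mem_univ _) (fun p _ => p.swap_swap)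
  · rw [Prod.fst_swap, Prod.snd_swap, hΦ p.1, ← smul_add, ExteriorAlgebra.ι_add_mul_swap, smul_zero]
  · have h1 : p.2 = p.1 := congrArg Prod.fst h'
    rw [h1, ExteriorAlgebra.ι_sq_zero, smul_zero]

/-- Integrability makes the matrices of the Higgs field commute: the entries of the commutators are
the coefficients of `φ ∧ φ` in a frame. -/
theorem commute_of_wedgeSquare_eq_zero {b : Basis κ A M} {ω : Basis (Fin n) A N}
    (hφ : ∀ j, φ (b j) = ∑ k, ∑ i, (Φ k i j • b i) ⊗ₜ ω k) (h : wedgeSquare φ = 0)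
    (p q : Fin n) : Φ p * Φ q = Φ q * Φ p := by
  classical
  ext m j
  -- `g` reads off the coefficient of `ω p ∧ ω q`.
  let L : N →ₗ[A] (Fin 2 → A) := LinearMap.pi ![ω.coord p, ω.coord q]
  let g : ExteriorAlgebra A N →ₗ[A] A := ExteriorAlgebra.liftAlternating
    (Function.update 0 2 (Matrix.detRowAlternating.compLinearMap L))
  have hg : ∀ x y : N, g (ExteriorAlgebra.ι A x * ExteriorAlgebra.ι A y) =
      ω.coord p x * ω.coord q y - ω.coord q x * ω.coord p y := by
    intro x y
    have h1 := ExteriorAlgebra.liftAlternating_apply_ιMulti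
      (Function.update 0 2 (Matrix.detRowAlternating.compLinearMap L)) ![x, y]
    rw [Function.update_self] at h1
    have h2 : ExteriorAlgebra.ιMulti A 2 ![x, y] =
        ExteriorAlgebra.ι A x * ExteriorAlgebra.ι A y := by
      simp [ExteriorAlgebra.ιMulti_apply]
    rw [h2] at h1
    refine h1.trans ?_
    exact Matrix.det_fin_two (Matrix.of fun i => L (![x, y] i))
  have h1 := wedgeSquare_frame hφ j
  rw [h, LinearMap.zero_apply] at h1
  have h2 := congrArg (TensorProduct.lid A A ∘ TensorProduct.map (b.coord m) g) h1
  simp only [Function.comp_apply, map_zero, map_sum, TensorProduct.map_tmul, Basis.coord_apply,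
    Basis.repr_self, TensorProduct.lid_tmul] at h2
  rw [Finset.sum_eq_single m (fun i _ hi => by rw [Finsupp.single_eq_of_ne hi.symm, zero_smul])
    (fun h => (h (Finset.mem_univ _)).elim), Finsupp.single_eq_same, one_smul] at h2
  simp only [map_smul, hg, Basis.coord_apply, Basis.repr_self, smul_eq_mul, mul_sub,
    Finset.sum_sub_distrib] at h2
  simp [Finsupp.single_apply] at h2
  linear_combination -h2

end WedgeSquare

/-! ### Regular functions and differentials on an open subscheme -/

section OpenSubscheme

variable {X : Scheme.{0}} [X.Over (Spec (.of ℂ))] {U : X.Opens}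

theorem openAlg_bijective (W : U.toScheme.Opens) : Function.Bijective (openAlg W) :=
  ConcreteCategory.bijective_of_isIso (U.ι.appIso W).inv

/-- The identification of the regular functions on `W`, as an open subset of `X`, with those on `W`
as an open subset of the open subscheme `U`; the inverse of `openAlg`. -/
def openInv (W : U.toScheme.Opens) : Γ(X, U.ι ''ᵁ W) →ₐ[ℂ] Γ(U, W) :=
  (AlgEquiv.ofBijective (openAlg W) (openAlg_bijective W)).symm.toAlgHom

theorem openAlg_openInv (W : U.toScheme.Opens) (a : Γ(X, U.ι ''ᵁ W)) :
    openAlg W (openInv W a) = a :=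
  (AlgEquiv.ofBijective (openAlg W) (openAlg_bijective W)).apply_symm_apply a

theorem openInv_openAlg (W : U.toScheme.Opens) (a : Γ(U, W)) : openInv W (openAlg W a) = a :=
  (AlgEquiv.ofBijective (openAlg W) (openAlg_bijective W)).symm_apply_apply a

theorem openInv_bijective (W : U.toScheme.Opens) : Function.Bijective (openInv W) :=
  (AlgEquiv.ofBijective (openAlg W) (openAlg_bijective W)).symm.bijective

theorem openAlg_resAlg {V W : U.toScheme.Opens} (h : V ≤ W) (a : Γ(U, W)) :
    openAlg V (resAlg h a) = resAlg (U.ι.image_mono h) (openAlg W a) :=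
  congr($(U.ι.appIso_inv_naturality (homOfLE h).op) a)

theorem openInv_resAlg {V W : U.toScheme.Opens} (h : V ≤ W) (a : Γ(X, U.ι ''ᵁ W)) :
    openInv V (resAlg (U.ι.image_mono h) a) = resAlg h (openInv W a) := by
  apply (openAlg_bijective V).1
  rw [openAlg_openInv, openAlg_resAlg, openAlg_openInv]

/-- The restriction of regular functions on `U`, as an open subset of `X`, to an open subset `W`
of `U`, considered as an open subscheme. -/
def toOpen (W : U.toScheme.Opens) : Γ(X, U) →+* Γ(U, W) := (U.ι.appLE U W fun x _ => x.2).hom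

theorem openAlg_toOpen (W : U.toScheme.Opens) (a : Γ(X, U)) :
    openAlg W (toOpen W a) = resAlg (U.ι_image_le W) a :=
  congr($(U.ι.appLE_appIso_inv (U := U) (V := W) fun x _ => x.2) a)

theorem resAlg_toOpen {V W : U.toScheme.Opens} (h : V ≤ W) (a : Γ(X, U)) :
    resAlg h (toOpen W a) = toOpen V a :=
  congr($(U.ι.appLE_map (U := U) (V := W) (V' := V) (fun x _ => x.2) (homOfLE h).op) a)

theorem kaehlerMap_comp_apply {A B C : Type} [CommRing A] [CommRing B] [CommRing C] [Algebra ℂ A]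
    [Algebra ℂ B] [Algebra ℂ C] (σ : A →ₐ[ℂ] B) (τ : B →ₐ[ℂ] C) (x : Ω[A⁄ℂ]) :
    kaehlerMap τ (kaehlerMap σ x) = kaehlerMap (τ.comp σ) x := by
  have hx : x ∈ Submodule.span A (Set.range (KaehlerDifferential.D ℂ A)) := by
    rw [KaehlerDifferential.span_range_derivation]; trivial
  induction hx using Submodule.span_induction with
  | mem x hx =>
    obtain ⟨i, rfl⟩ := hx
    rw [kaehlerMap_D, kaehlerMap_D, kaehlerMap_D]; rfl
  | zero => rw [map_zero, map_zero, map_zero]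
  | add x y _ _ hx hy => rw [map_add, map_add, map_add, hx, hy]
  | smul r x _ hx => rw [map_smulₛₗ, map_smulₛₗ, map_smulₛₗ, hx]; rfl

theorem kaehlerMap_id_apply {A : Type} [CommRing A] [Algebra ℂ A] (x : Ω[A⁄ℂ]) :
    kaehlerMap (AlgHom.id ℂ A) x = x :=
  kaehlerMap_eq (AlgHom.id ℂ A) LinearMap.id (fun _ => rfl) x

theorem kaehlerMap_openAlg_openInv (W : U.toScheme.Opens) (x : Ω[Γ(X, U.ι ''ᵁ W)⁄ℂ]) :
    kaehlerMap (openAlg W) (kaehlerMap (openInv W) x) = x := by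
  rw [kaehlerMap_comp_apply]
  have : (openAlg W).comp (openInv W) = AlgHom.id ℂ _ := AlgHom.ext (openAlg_openInv W)
  rw [this, kaehlerMap_id_apply]

theorem kaehlerMap_openInv_openAlg (W : U.toScheme.Opens) (x : Ω[Γ(U, W)⁄ℂ]) :
    kaehlerMap (openInv W) (kaehlerMap (openAlg W) x) = x := by
  rw [kaehlerMap_comp_apply]
  have : (openInv W).comp (openAlg W) = AlgHom.id ℂ _ := AlgHom.ext (openInv_openAlg W)
  rw [this, kaehlerMap_id_apply]

variable {n : ℕ}

/-- The basis of the differentials over a smaller affine open set given by a frame. -/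
def CotangentFrame.basis (ω : CotangentFrame U n) {W : X.Opens} (hW : IsAffineOpen W)
    (h : W ≤ U) : Basis (Fin n) (X.presheaf.obj (.op W)) Ω[Γ(X, W)⁄ℂ] :=
  Basis.mk (ω.linearIndependent hW h) (ω.span hW h)

theorem CotangentFrame.basis_apply (ω : CotangentFrame U n) {W : X.Opens} (hW : IsAffineOpen W)
    (h : W ≤ U) (k : Fin n) : ω.basis hW h k = ω.form hW h k :=
  Basis.mk_apply _ _ k

/-- A frame of the cotangent sheaf over `U` as a frame of the cotangent sheaf of the open
subscheme `U`. -/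
def CotangentFrame.onOpen (ω : CotangentFrame U n) :
    CotangentFrame (X := U.toScheme) ⊤ n where
  form {W} hW _ k := kaehlerMap (openInv W)
    (ω.form (hW.image_of_isOpenImmersion U.ι) (U.ι_image_le W) k)
  res {V W} hV hW _ h k := by
    rw [kaehlerMap_comp_apply, ← ω.res (hV.image_of_isOpenImmersion U.ι)
      (hW.image_of_isOpenImmersion U.ι) (U.ι_image_le W) (U.ι.image_mono h) k,
      kaehlerMap_comp_apply]
    have : (resAlg h).comp (openInv W) = (openInv V).comp (resAlg (U.ι.image_mono h)) :=
      AlgHom.ext fun a => (openInv_resAlg h a).symm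
    rw [this]
  linearIndependent {W} hW _ := by
    rw [Fintype.linearIndependent_iff]
    intro g hg k
    have h1 := congrArg (kaehlerMap (openAlg W)) hg
    rw [map_sum, map_zero] at h1
    have h2 := Fintype.linearIndependent_iff.mp
      (ω.linearIndependent (hW.image_of_isOpenImmersion U.ι) (U.ι_image_le W))
      (fun k => openAlg W (g k)) (by
        refine Eq.trans (Finset.sum_congr rfl fun k _ => ?_) h1
        rw [map_smulₛₗ, kaehlerMap_openAlg_openInv]; rfl) k
    exact (map_eq_zero_iff _ (openAlg_bijective W).1).mp h2
  span {W} hW _ := by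
    intro x _
    rw [← kaehlerMap_openInv_openAlg W x]
    have h1 : kaehlerMap (openAlg W) x ∈ Submodule.span (X.presheaf.obj (.op (U.ι ''ᵁ W))) _ :=
      ω.span (hW.image_of_isOpenImmersion U.ι) (U.ι_image_le W) trivial
    generalize kaehlerMap (openAlg W) x = y at h1
    induction h1 using Submodule.span_induction with
    | mem y hy =>
      obtain ⟨k, rfl⟩ := hy
      exact Submodule.subset_span ⟨k, rfl⟩
    | zero => rw [map_zero]; exact zero_mem _
    | add y z _ _ hy hz => rw [map_add]; exact add_mem hy hz
    | smul r y _ hy => rw [map_smulₛₗ]; exact Submodule.smul_mem _ _ hy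

/-- Regular functions on `U` that agree on all affine open subsets of `U` are equal. -/
theorem eq_of_resAlg_eq {a b : Γ(X, U)}
    (h : ∀ (W : X.Opens) (_ : IsAffineOpen W) (hWU : W ≤ U), resAlg hWU a = resAlg hWU b) :
    a = b := by
  let I := { W : X.Opens // IsAffineOpen W ∧ W ≤ U }
  refine X.sheaf.eq_of_locally_eq' (fun W : I => W.1) U (fun W => homOfLE W.2.2) ?_ a b
    fun W => h W.1 W.2.1 W.2.2
  intro x hx
  obtain ⟨_, ⟨W, hW, rfl⟩, hxW, hWU⟩ := X.isBasis_affineOpens.exists_subset_of_mem_open hx U.2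
  exact TopologicalSpace.Opens.mem_iSup.mpr ⟨⟨W, hW, hWU⟩, hxW⟩

end OpenSubscheme

/-! ### Higgs bundles given by commuting matrices -/

section OfFrame

variable {Y : Scheme.{0}} [Y.Over (Spec (.of ℂ))] {n d : ℕ}

variable {F : Y.Modules} (f : Frame F ⊤ (Fin d)) (ω : CotangentFrame (⊤ : Y.Opens) n)
  (T : Fin n → Matrix (Fin d) (Fin d) Γ(Y, ⊤))

/-- The Higgs field given by matrices in a global frame. -/
def fieldOfFrame {W : Y.Opens} (hW : IsAffineOpen W) :
    Γ(F, W) →ₗ[Γ(Y, W)] Γ(F, W) ⊗[Γ(Y, W)] Ω[Γ(Y, W)⁄ℂ] :=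
  (f.basis (le_top (a := W))).constr Γ(Y, W) fun j =>
    ∑ k, ∑ i, (resAlg (le_top (a := W)) (T k i j) • f.basis (le_top (a := W)) i) ⊗ₜ
      ω.form hW le_top k

theorem fieldOfFrame_basis {W : Y.Opens} (hW : IsAffineOpen W) (j : Fin d) :
    fieldOfFrame f ω T hW (f.basis (le_top (a := W)) j) =
      ∑ k, ∑ i, (resAlg (le_top (a := W)) (T k i j) • f.basis (le_top (a := W)) i) ⊗ₜ
        ω.form hW le_top k :=
  Basis.constr_basis _ _ _ _

/-- The Higgs fields given by the same matrices over different affine open sets are compatible with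
restriction. -/
theorem fieldOfFrame_res {V W : Y.Opens} (hV : IsAffineOpen V) (hW : IsAffineOpen W)
    (h : V ≤ W) (m : Γ(F, W)) : fieldOfFrame f ω T hV (resMod F h m) =
      TensorProduct.map (resMod F h) (kaehlerMap (resAlg h)) (fieldOfFrame f ω T hW m) := by
  refine LinearMap.congr_fun (f := (fieldOfFrame f ω T hV).comp (resMod F h)) (g :=
    (TensorProduct.map (resMod F h) (kaehlerMap (resAlg h))).comp (fieldOfFrame f ω T hW))
    ((f.basis (le_top (a := W))).ext fun j => ?_) m
  rw [LinearMap.comp_apply, LinearMap.comp_apply, f.res_basis, fieldOfFrame_basis,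
    fieldOfFrame_basis]
  simp only [map_sum, TensorProduct.map_tmul, map_smulₛₗ, f.res_basis, ω.res hV hW]
  refine Finset.sum_congr rfl fun k _ => Finset.sum_congr rfl fun i _ => ?_
  congr 2
  exact (resAlg_trans _ _ _).symm

theorem matrix_map_commute {R S : Type} [CommRing R] [CommRing S] {κ : Type} [Fintype κ]
    (σ : R →+* S) {P Q : Matrix κ κ R} (h : P * Q = Q * P) :
    P.map σ * Q.map σ = Q.map σ * P.map σ := by
  rw [← Matrix.map_mul, ← Matrix.map_mul, h]

variable {T} in
/-- The Higgs bundle with a global frame in which the Higgs field is given by commuting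
matrices. -/
def HiggsBundle.ofFrame (hT : ∀ k l, T k * T l = T l * T k) : HiggsBundle Y d where
  E := F
  locallyFree _ := ⟨⊤, trivial, ⟨f⟩⟩
  φ hW := fieldOfFrame f ω T hW
  φ_res hV hW h m := fieldOfFrame_res f ω T hV hW h m
  integrable {W} hW :=
    wedgeSquare_eq_zero (b := f.basis (le_top (a := W))) (ω := ω.form hW le_top)
      (Φ := fun k => (T k).map (resAlg (le_top (a := W)))) (fieldOfFrame_basis f ω T hW)
      fun k l => matrix_map_commute (resAlg (le_top (a := W))).toRingHom (hT k l)

variable {T} in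
theorem HiggsBundle.represents_ofFrame (hT : ∀ k l, T k * T l = T l * T k) :
    Represents (𝔈 := HiggsBundle.ofFrame f ω hT) f ω T :=
  fun hW _ j => fieldOfFrame_basis f ω T hW j

end OfFrame

section Commute

variable {X : Scheme.{0}} [X.Over (Spec (.of ℂ))] {U : X.Opens} {r n : ℕ} {κ : Type} [Fintype κ]
  {𝔈 : HiggsBundle X r} {e : Frame 𝔈.E U κ} {ω : CotangentFrame U n}
  {Φ : Fin n → Matrix κ κ Γ(X, U)}

/-- The matrices of a Higgs field commute. Integrability gives this over the affine open subsets of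
`U`, where a frame of differentials is a basis. -/
theorem Represents.commute (hΦ : Represents e ω Φ) (k l : Fin n) : Φ k * Φ l = Φ l * Φ k := by
  ext i j
  refine eq_of_resAlg_eq fun W hW hWU => ?_
  have h1 := commute_of_wedgeSquare_eq_zero (b := e.basis hWU) (ω := ω.basis hW hWU)
    (Φ := fun k => (Φ k).map (resAlg hWU)) (fun j => by
      simp only [ω.basis_apply]; exact hΦ hW hWU j) (𝔈.integrable hW) k l
  beta_reduce at h1
  rw [← AlgHom.coe_toRingHom, ← Matrix.map_mul, ← Matrix.map_mul] at h1
  exact congrFun (congrFun h1 i) j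

end Commute

/-! ### Invariant subbundles spanned by part of a frame -/

section Subbundle

variable {X : Scheme.{0}} [X.Over (Spec (.of ℂ))] {U : X.Opens} {r n d : ℕ} {κ : Type}
  {𝔈 : HiggsBundle X r} {e : Frame 𝔈.E U κ} {ω : CotangentFrame U n}
  {Φ : Fin n → Matrix κ κ Γ(X, U)} {g : Fin d → κ}

variable (e g) in
/-- The inclusion of the span of part of a frame: the standard sections are sent to the members
of the frame that are indexed by `g`. -/
def subIncl : freeModule U.toScheme d ⟶ 𝔈.E.restrict U.ι :=
  freeModule.desc _ fun a => (𝔈.E.restrictAppIso U.ι ⊤).inv.hom (e.basis (U.ι_image_le ⊤) (g a))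

theorem inclSec_subIncl (W : U.toScheme.Opens) (a : Fin d) :
    inclSec (subIncl e g) W ((freeModule.frame U.toScheme d).basis (le_top (a := W)) a) =
      e.basis (U.ι_image_le W) (g a) := by
  rw [Frame.basis_apply]
  change inclSec (subIncl e g) W (resMod _ _ (freeModule.std ⊤ a)) = _
  rw [freeModule.resMod_std]
  refine (congrArg (𝔈.E.restrictAppIso U.ι W).hom.hom (freeModule.desc_std _ _ W a)).trans ?_
  exact e.res_basis (U.ι_image_le ⊤) (U.ι.image_mono le_top) (g a)

theorem subIncl_injective (hg : Function.Injective g) (W : U.toScheme.Opens) :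
    Function.Injective (inclSec (subIncl e g) W) := by
  rw [injective_iff_map_eq_zero]
  intro m hm
  let f := (freeModule.frame U.toScheme d).basis (le_top (a := W))
  have h1 : inclSec (subIncl e g) W m =
      ∑ a, openAlg W (f.repr m a) • e.basis (U.ι_image_le W) (g a) := by
    conv_lhs => rw [← f.sum_repr m, map_sum]
    refine Finset.sum_congr rfl fun a _ => ?_
    rw [map_smulₛₗ, inclSec_subIncl]; rfl
  rw [h1] at hm
  have h2 := Fintype.linearIndependent_iff.mp
    ((e.basis (U.ι_image_le W)).linearIndependent.comp g hg) _ hm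
  refine f.ext_elem fun a => ?_
  rw [map_zero, Finsupp.zero_apply]
  exact (map_eq_zero_iff _ (openAlg_bijective W).1).mp (h2 a)

variable [Fintype κ]

theorem sum_eq_sum_range {V : Type} [AddCommMonoid V] (hg : Function.Injective g) {x : κ → V}
    (hx : ∀ i, i ∉ Set.range g → x i = 0) : ∑ i, x i = ∑ a, x (g a) := by
  classical
  rw [← Finset.sum_image (s := Finset.univ) (g := g) (f := x) fun a _ b _ h => hg h]
  refine (Finset.sum_subset (Finset.subset_univ _) fun i _ hi => hx i ?_).symm
  simpa using hi

/-- If the span of part of a frame is invariant under two commuting matrices, their restrictions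
commute. -/
theorem submatrix_map_commute {R S : Type} [CommRing R] [CommRing S] {P Q : Matrix κ κ R}
    (hg : Function.Injective g) (hP : ∀ i b, i ∉ Set.range g → P i (g b) = 0)
    (hQ : ∀ i b, i ∉ Set.range g → Q i (g b) = 0) (h : P * Q = Q * P) (σ : R →+* S) :
    (P.submatrix g g).map σ * (Q.submatrix g g).map σ =
      (Q.submatrix g g).map σ * (P.submatrix g g).map σ := by
  refine matrix_map_commute σ ?_
  ext a b
  have h1 := congrFun (congrFun h (g a)) (g b)
  rw [Matrix.mul_apply, Matrix.mul_apply,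
    sum_eq_sum_range hg fun i hi => by rw [hQ i b hi, mul_zero],
    sum_eq_sum_range hg fun i hi => by rw [hP i b hi, mul_zero]] at h1
  exact h1

/-- The restriction of a Higgs bundle to the invariant subsheaf spanned by part of a frame over `U`,
encoded as the free sheaf on `U` with the corresponding submatrices of the Higgs field. -/
def subBundle (hΦ : Represents e ω Φ) (hg : Function.Injective g)
    (hinv : ∀ k i b, i ∉ Set.range g → Φ k i (g b) = 0) : HiggsBundle U.toScheme d :=
  HiggsBundle.ofFrame (freeModule.frame U.toScheme d) ω.onOpen
    (T := fun k => ((Φ k).submatrix g g).map (toOpen ⊤)) fun k l =>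
      submatrix_map_commute hg (hinv k) (hinv l) (hΦ.commute k l) (toOpen ⊤)

/-- The standard frame of `subBundle`. -/
def subBundle.frame (hΦ : Represents e ω Φ) (hg : Function.Injective g)
    (hinv : ∀ k i b, i ∉ Set.range g → Φ k i (g b) = 0) :
    Frame (subBundle hΦ hg hinv).E ⊤ (Fin d) :=
  freeModule.frame U.toScheme d

theorem subBundle.represents (hΦ : Represents e ω Φ) (hg : Function.Injective g)
    (hinv : ∀ k i b, i ∉ Set.range g → Φ k i (g b) = 0) :
    Represents (subBundle.frame hΦ hg hinv) ω.onOpen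
      fun k => ((Φ k).submatrix g g).map (toOpen ⊤) :=
  HiggsBundle.represents_ofFrame _ _ _

/-- The inclusion of `subBundle` as a morphism of Higgs bundles. -/
def subBundle.incl (hΦ : Represents e ω Φ) (hg : Function.Injective g)
    (hinv : ∀ k i b, i ∉ Set.range g → Φ k i (g b) = 0) :
    HiggsHom (subBundle hΦ hg hinv) 𝔈 where
  hom := subIncl e g
  comm {W} hW m := by
    have hW' := hW.image_of_isOpenImmersion U.ι
    refine LinearMap.congr_fun (f := (𝔈.φ hW').comp (inclSec (subIncl e g) W)) (g :=
      (TensorProduct.map (inclSec (subIncl e g) W) (kaehlerMap (openAlg W))).comp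
        (fieldOfFrame (freeModule.frame U.toScheme d) ω.onOpen
          (fun k => ((Φ k).submatrix g g).map (toOpen ⊤)) hW))
      (((freeModule.frame U.toScheme d).basis (le_top (a := W))).ext fun j => ?_) m
    rw [LinearMap.comp_apply, LinearMap.comp_apply, inclSec_subIncl, hΦ hW' (U.ι_image_le W),
      fieldOfFrame_basis, map_sum]
    refine Finset.sum_congr rfl fun k _ => ?_
    rw [map_sum, sum_eq_sum_range hg fun i hi => by
      rw [hinv k i j hi, map_zero, zero_smul, TensorProduct.zero_tmul]]
    refine Finset.sum_congr rfl fun a _ => ?_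
    rw [TensorProduct.map_tmul, map_smulₛₗ, inclSec_subIncl]
    congr 1
    · congr 1
      change _ = openAlg W (resAlg _ (toOpen ⊤ _))
      rw [resAlg_toOpen, openAlg_toOpen]
      rfl
    · exact (kaehlerMap_openAlg_openInv W _).symm

theorem subBundle.inclSec_basis (hΦ : Represents e ω Φ) (hg : Function.Injective g)
    (hinv : ∀ k i b, i ∉ Set.range g → Φ k i (g b) = 0) (W : U.toScheme.Opens) (a : Fin d) :
    inclSec (subBundle.incl hΦ hg hinv).hom W
      ((subBundle.frame hΦ hg hinv).basis (le_top (a := W)) a) = e.basis (U.ι_image_le W) (g a) :=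
  inclSec_subIncl W a

/-- The sections in the span of part of a frame are those whose other coordinates vanish. -/
theorem range_subIncl (hg : Function.Injective g) (W : U.toScheme.Opens) :
    Set.range (inclSec (subIncl e g) W) =
      {x | ∀ j, j ∉ Set.range g → (e.basis (U.ι_image_le W)).coord j x = 0} := by
  let f := (freeModule.frame U.toScheme d).basis (le_top (a := W))
  let b := e.basis (U.ι_image_le W)
  ext x
  constructor
  · rintro ⟨m, rfl⟩ j hj
    rw [← f.sum_repr m, map_sum, map_sum]
    refine Finset.sum_eq_zero fun a _ => ?_
    rw [map_smulₛₗ, inclSec_subIncl, map_smul, Basis.coord_apply, Basis.repr_self,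
      Finsupp.single_eq_of_ne, smul_zero]
    exact fun h => hj ⟨a, h.symm⟩
  · intro hx
    refine ⟨∑ a, openInv W (b.coord (g a) x) • f a, ?_⟩
    rw [map_sum]
    conv_rhs => rw [← b.sum_repr x]
    rw [sum_eq_sum_range hg fun i hi => by
      rw [show b.repr x i = 0 from hx i hi, zero_smul]]
    refine Finset.sum_congr rfl fun a _ => ?_
    rw [map_smulₛₗ, inclSec_subIncl]
    congr 1
    exact openAlg_openInv W _

end Subbundle

section Eigen

variable {A : Type} [CommRing A] {s : ℕ} {d : Fin s → ℕ} {c : Fin s → A}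
  {M : Type} [AddCommGroup M] [Module A M] (b : Basis (Σ v : Fin s, Fin (d v)) A M)

theorem jordanBlock_map {B : Type} [CommRing B] (σ : A →+* B) (c : A) (m : ℕ) :
    (jordanBlock c m).map σ = jordanBlock (σ c) m := by
  ext i j
  simp only [Matrix.map_apply, jordanBlock]
  split_ifs <;> simp

variable (c) in
/-- The endomorphism whose matrix in the basis `b` is block diagonal with Jordan blocks. -/
def jordanEnd : End A M :=
  Matrix.toLin b b (Matrix.blockDiagonal' fun v => jordanBlock (c v) (d v))

/-- The coordinates in one block, extended by zero. -/
def blockCoord (v : Fin s) : ℕ → Dual A M := extendZero fun a => b.coord ⟨v, a⟩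

theorem blockCoord_of_le {v : Fin s} {i : ℕ} (hi : d v ≤ i) : blockCoord b v i = 0 :=
  extendZero_of_le _ hi

theorem blockCoord_jordanEnd (v : Fin s) (i : ℕ) (x : M) : blockCoord b v i (jordanEnd c b x) =
    c v * blockCoord b v i x + blockCoord b v (i + 1) x := by
  by_cases hi : i < d v
  · have h1 : blockCoord b v i = b.coord ⟨v, i, hi⟩ := dif_pos hi
    have h2 := congrFun (LinearMap.toMatrix_mulVec_repr b b (jordanEnd c b) x) ⟨v, i, hi⟩
    rw [jordanEnd, LinearMap.toMatrix_toLin, Matrix.mulVec, dotProduct, Fintype.sum_sigma,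
      Fintype.sum_eq_single v fun w hw => Finset.sum_eq_zero fun k _ => by
        rw [Matrix.blockDiagonal'_apply_ne _ _ _ hw.symm, zero_mul]] at h2
    simp only [Matrix.blockDiagonal'_apply_eq] at h2
    have h3 := jordanBlock_row_sum (c v) (fun k => blockCoord b v k x)
      (fun i hi => by rw [blockCoord, extendZero_of_le _ hi, LinearMap.zero_apply]) ⟨i, hi⟩
    rw [smul_eq_mul] at h3
    rw [← h3, h1]
    refine h2.symm.trans (Finset.sum_congr rfl fun k _ => ?_)
    rw [blockCoord, extendZero_fin]; rfl
  · rw [blockCoord, extendZero_of_le _ (not_lt.mp hi), extendZero_of_le _ (i := i + 1) (by omega)]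
    simp

/-- Over a ring, the generalized eigenspace of a Jordan matrix is spanned by the basis vectors of
one block, provided that the differences of the eigenvalues are units. -/
theorem maxGenEigenspace_jordanEnd (hc : ∀ v w, v ≠ w → IsUnit (c v - c w)) (v : Fin s) :
    ((jordanEnd c b).maxGenEigenspace (c v) : Set M) =
      {x | ∀ j, j ∉ Set.range (Sigma.mk v) → b.coord j x = 0} := by
  ext x
  rw [SetLike.mem_coe, Module.End.mem_maxGenEigenspace]
  have hN : ∀ w i y, blockCoord b w i ((jordanEnd c b - c v • (1 : End A M)) y) =
      (c w - c v) * blockCoord b w i y + blockCoord b w (i + 1) y := by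
    intro w i y
    rw [LinearMap.sub_apply, map_sub, blockCoord_jordanEnd, LinearMap.smul_apply, map_smul,
      Module.End.one_apply, smul_eq_mul]
    ring
  constructor
  · -- In the other blocks `jordanEnd c b - c v` is injective: it is a unit plus a nilpotent shift.
    rintro ⟨k, hk⟩
    have h1 : ∀ w, w ≠ v → ∀ i, blockCoord b w i x = 0 := by
      intro w hw
      induction k generalizing x with
      | zero => rw [pow_zero, Module.End.one_apply] at hk; simp [hk]
      | succ k ih =>
        have h2 := ih _ (by rwa [pow_succ, Module.End.mul_apply] at hk)
        have h3 : ∀ m i, d w ≤ i + m → blockCoord b w i x = 0 := by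
          intro m
          induction m with
          | zero => exact fun i hi => by rw [blockCoord_of_le b (i := i) (by omega)]; rfl
          | succ m ihm =>
            intro i hi
            have h4 := hN w i x
            rw [h2, ihm (i + 1) (by omega), add_zero] at h4
            exact ((hc w v hw).mul_right_eq_zero).mp h4.symm
        exact fun i => h3 (d w) i (by omega)
    rintro ⟨w, a⟩ hj
    have h2 := h1 w (by rintro rfl; exact hj ⟨a, rfl⟩) a
    rwa [blockCoord, extendZero_fin] at h2
  · -- In the `v`-th block it is the shift, whose power `d v` vanishes.
    intro hx
    refine ⟨d v, ?_⟩
    have h1 : ∀ w, w ≠ v → ∀ m i, blockCoord b w i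
        (((jordanEnd c b - c v • (1 : End A M)) ^ m) x) = 0 := by
      intro w hw m
      induction m with
      | zero =>
        intro i
        by_cases hi : i < d w
        · have h2 : blockCoord b w i = b.coord ⟨w, i, hi⟩ := dif_pos hi
          rw [h2]
          exact hx _ (by rintro ⟨a, ha⟩; exact hw (congrArg Sigma.fst ha).symm)
        · rw [blockCoord_of_le b (not_lt.mp hi)]; rfl
      | succ m ih =>
        intro i
        rw [pow_succ', Module.End.mul_apply, hN, ih, ih, mul_zero, add_zero]
    have h2 : ∀ m i, d v ≤ i + m → blockCoord b v i
        (((jordanEnd c b - c v • (1 : End A M)) ^ m) x) = 0 := by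
      intro m
      induction m with
      | zero => exact fun i hi => by rw [blockCoord_of_le b (i := i) (by omega)]; rfl
      | succ m ih =>
        intro i hi
        rw [pow_succ', Module.End.mul_apply, hN, sub_self, zero_mul, ih _ (by omega), add_zero]
    refine b.ext_elem fun ⟨w, a⟩ => ?_
    rw [map_zero, Finsupp.zero_apply]
    have h3 : blockCoord b w a (((jordanEnd c b - c v • (1 : End A M)) ^ (d v)) x) = 0 := by
      by_cases hw : w = v
      · subst hw; exact h2 (d w) a (by omega)
      · exact h1 w hw (d v) a
    rwa [blockCoord, extendZero_fin] at h3

end Eigen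

section EigenSubbundle

variable {X : Scheme.{0}} [X.Over (Spec (.of ℂ))] {U : X.Opens} {r n s : ℕ} {d : Fin s → ℕ}
  {𝔈 : HiggsBundle X r} {e : Frame 𝔈.E U (Σ v : Fin s, Fin (d v))} {ω : CotangentFrame U n}
  {Φ : Fin n → Matrix (Σ v : Fin s, Fin (d v)) (Σ v : Fin s, Fin (d v)) Γ(X, U)}
  {c : Fin s → Γ(X, U)}

/-- The subbundle spanned by the frame of one block is the generalized eigensheaf. -/
theorem subBundle.isEigenSubbundle (hΦ : Represents e ω Φ)
    (hc : ∀ v w, v ≠ w → IsUnit (c v - c w)) (v : Fin s)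
    (hinv : ∀ k i b, i ∉ Set.range (Sigma.mk (β := fun v => Fin (d v)) v) → Φ k i ⟨v, b⟩ = 0) :
    IsEigenSubbundle (subBundle.incl hΦ sigma_mk_injective hinv) e
      (Matrix.blockDiagonal' fun v => jordanBlock (c v) (d v)) (c v) := by
  intro W
  refine ⟨subIncl_injective (e := e) (g := Sigma.mk (β := fun v => Fin (d v)) v)
    sigma_mk_injective W, ?_⟩
  have h1 : frameEnd e (Matrix.blockDiagonal' fun v => jordanBlock (c v) (d v)) (U.ι_image_le W) =
      jordanEnd (fun v => resAlg (U.ι_image_le W) (c v)) (e.basis (U.ι_image_le W)) := by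
    have h2 : (Matrix.blockDiagonal' fun v => jordanBlock (c v) (d v)).map
        (resAlg (U.ι_image_le W)) = Matrix.blockDiagonal' fun v =>
          jordanBlock (resAlg (U.ι_image_le W) (c v)) (d v) := by
      refine (Matrix.blockDiagonal'_map _ _ (map_zero (resAlg (U.ι_image_le W)))).trans ?_
      exact congrArg Matrix.blockDiagonal' (funext fun w =>
        jordanBlock_map (resAlg (U.ι_image_le W)).toRingHom (c w) (d w))
    exact congrArg (Matrix.toLin _ _) h2
  have h2 : ∀ v w, v ≠ w → IsUnit (resAlg (U.ι_image_le W) (c v) - resAlg (U.ι_image_le W) (c w)) :=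
    fun v w h => by rw [← map_sub]; exact (hc v w h).map _
  have h3 := maxGenEigenspace_jordanEnd
    (c := fun v => resAlg (U.ι_image_le W) (c v)) (e.basis (U.ι_image_le W)) h2 v
  rw [← h1] at h3
  have h4 := range_subIncl (e := e) (g := Sigma.mk (β := fun v => Fin (d v)) v) sigma_mk_injective W
  exact h4.trans h3.symm

end EigenSubbundle

/-! ### The coordinate rings in a frame -/

section FrameChart

variable {A M N : Type} [CommRing A] [AddCommGroup M] [Module A M] [AddCommGroup N] [Module A N]
  {φ : M →ₗ[A] M ⊗[A] N} {κ : Type} {b : Basis κ A M} {n d : ℕ}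
  {ω : Basis (Fin n) A N} {Ψ : Fin n → Matrix κ κ A} {f : Fin d → κ} {k₀ : Fin n} {c : A}

theorem extendZero_coord_apply (hf : Function.Injective f) (i : ℕ) (a : Fin d) :
    extendZero (fun a => b.coord (f a)) i (b (f a)) = if a.val = i then 1 else 0 := by
  by_cases hi : i < d
  · rw [extendZero, dif_pos hi, Basis.coord_apply, Basis.repr_self]
    split_ifs with h
    · obtain rfl : a = ⟨i, hi⟩ := Fin.ext h
      exact Finsupp.single_eq_same
    · exact Finsupp.single_eq_of_ne fun h' => h (congrArg Fin.val (hf h')).symm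
  · rw [extendZero_of_le _ (not_lt.mp hi), if_neg (by omega)]; rfl

theorem extendZero_coord_apply_of_notMem (i : ℕ) {j : κ} (hj : j ∉ Set.range f) :
    extendZero (fun a => b.coord (f a)) i (b j) = 0 := by
  by_cases hi : i < d
  · rw [extendZero, dif_pos hi, Basis.coord_apply, Basis.repr_self]
    exact Finsupp.single_eq_of_ne fun h => hj ⟨_, h⟩
  · rw [extendZero_of_le _ (not_lt.mp hi)]; rfl

variable [Fintype κ]

/-- Contraction with the coordinate of `ω k₀` picks out the matrix `Ψ k₀`. -/
theorem contract_coord (hφ : ∀ j, φ (b j) = ∑ k, ∑ i, (Ψ k i j • b i) ⊗ₜ ω k) (j : κ) :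
    contract φ (ω.coord k₀) (b j) = ∑ i, Ψ k₀ i j • b i := by
  rw [contract_frame hφ]
  refine Finset.sum_congr rfl fun i _ => ?_
  rw [Finset.sum_eq_single k₀]
  · rw [Basis.coord_apply, Basis.repr_self, Finsupp.single_eq_same, one_mul]
  · intro k _ hk
    rw [Basis.coord_apply, Basis.repr_self, Finsupp.single_eq_of_ne hk.symm, zero_mul]
  · exact fun h => (h (Finset.mem_univ _)).elim

/-- The transpose of the contracted Higgs field acts on the coordinates of a Jordan block by the
shift. -/
theorem extendZero_coord_comp_contract
    (hφ : ∀ j, φ (b j) = ∑ k, ∑ i, (Ψ k i j • b i) ⊗ₜ ω k) (hf : Function.Injective f)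
    (hrow : ∀ a j, j ∉ Set.range f → Ψ k₀ (f a) j = 0)
    (hJ : ∀ a j, Ψ k₀ (f a) (f j) = jordanBlock c d a j) (i : ℕ) :
    extendZero (fun a => b.coord (f a)) i ∘ₗ contract φ (ω.coord k₀) =
      c • extendZero (fun a => b.coord (f a)) i + extendZero (fun a => b.coord (f a)) (i + 1) := by
  classical
  by_cases hi : i < d
  · refine b.ext fun j => ?_
    have h1 : extendZero (fun a => b.coord (f a)) i (contract φ (ω.coord k₀) (b j)) =
        Ψ k₀ (f ⟨i, hi⟩) j := by
      rw [contract_coord hφ, extendZero, dif_pos hi, map_sum, Finset.sum_eq_single (f ⟨i, hi⟩)]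
      · rw [map_smul, Basis.coord_apply, Basis.repr_self, Finsupp.single_eq_same, smul_eq_mul,
          mul_one]
      · intro k _ hk
        rw [map_smul, Basis.coord_apply, Basis.repr_self, Finsupp.single_eq_of_ne hk.symm,
          smul_zero]
      · exact fun h => (h (Finset.mem_univ _)).elim
    rw [LinearMap.comp_apply, h1, LinearMap.add_apply, LinearMap.smul_apply]
    by_cases hj : j ∈ Set.range f
    · obtain ⟨a, rfl⟩ := hj
      rw [hJ, extendZero_coord_apply hf, extendZero_coord_apply hf, jordanBlock]
      by_cases h2 : a.val = i
      · rw [if_pos (Fin.ext h2.symm), if_pos h2, if_neg (by omega), smul_eq_mul, mul_one, add_zero]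
      · rw [if_neg fun h => h2 (congrArg Fin.val h).symm, if_neg h2, smul_zero, zero_add]
        exact if_congr eq_comm rfl rfl
    · rw [hrow _ _ hj, extendZero_coord_apply_of_notMem _ hj, extendZero_coord_apply_of_notMem _ hj,
        smul_zero, add_zero]
  · rw [extendZero_of_le _ (not_lt.mp hi), extendZero_of_le _ (i := i + 1) (by omega),
      LinearMap.zero_comp, smul_zero, add_zero]

/-- The coordinates that belong to different eigenvalues annihilate each other. -/
theorem coord_mul_coord_eq_zero {α β : ℕ → Dual A M} {p q : ℕ} (hα : ∀ i, p ≤ i → α i = 0)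
    (hβ : ∀ j, q ≤ j → β j = 0) {ξ : Dual A N} {x y : A} (hxy : IsUnit (x - y))
    (h1 : ∀ i, α i ∘ₗ contract φ ξ = x • α i + α (i + 1))
    (h2 : ∀ j, β j ∘ₗ contract φ ξ = y • β j + β (j + 1)) (i j : ℕ) :
    coord φ (α i) * coord φ (β j) = 0 := by
  -- Descending induction on `i + j`: the equation of the invariant lines for `α i` and `β j` is
  -- `(x - y) α i β j = α i β (j + 1) - α (i + 1) β j`.
  have h : ∀ m i j, p + q ≤ i + j + m → coord φ (α i) * coord φ (β j) = 0 := by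
    intro m
    induction m with
    | zero =>
      intro i j h
      by_cases hi : p ≤ i
      · rw [hα i hi, ← coordₗ_apply, map_zero, zero_mul]
      · rw [hβ j (by omega), ← coordₗ_apply (0 : Dual A M), map_zero, mul_zero]
    | succ m ih =>
      intro i j h
      have h3 := coord_mul_coord (φ := φ) (α i) (β j) ξ
      rw [h1, h2, ← coordₗ_apply, ← coordₗ_apply, ← coordₗ_apply, ← coordₗ_apply, map_add, map_add,
        map_smul, map_smul, mul_add, mul_add, mul_smul_comm, mul_smul_comm] at h3
      simp only [coordₗ_apply] at h3
      rw [ih i (j + 1) (by omega), mul_comm _ (coord φ (α (i + 1))), ih (i + 1) j (by omega),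
        add_zero, add_zero, mul_comm (coord φ (β j))] at h3
      have h4 : (x - y) • (coord φ (α i) * coord φ (β j)) = 0 := by
        rw [sub_smul, h3, sub_self]
      exact (hxy.smul_eq_zero).mp h4
  exact h (p + q) i j (by omega)

/-- If the Higgs field is given by matrices that are Toeplitz in one block and zero outside of it in
the same rows and columns, and one of them is a Jordan block, then the coordinates of this block
make up a chart of Jordan type. -/
theorem jordanChart_of_toeplitz
    (hφ : ∀ j, φ (b j) = ∑ k, ∑ i, (Ψ k i j • b i) ⊗ₜ ω k) (hf : Function.Injective f)
    (hcol : ∀ k i j, i ∉ Set.range f → Ψ k i (f j) = 0)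
    (hτ : ∀ k, ∃ τ : ℕ → A, ∀ a j : Fin d,
      Ψ k (f a) (f j) = if a ≤ j then τ (j - a) else 0)
    (hrow : ∀ a j, j ∉ Set.range f → Ψ k₀ (f a) j = 0)
    (hJ : ∀ a j, Ψ k₀ (f a) (f j) = jordanBlock c d a j)
    (hY : ∀ (h : 0 < d) (j : κ), j ∉ Set.range f →
      coord φ (b.coord (f ⟨0, h⟩)) * coord φ (b.coord j) = 0) :
    JordanChart (coordGrading φ) d (extendZero fun a => coord φ (b.coord (f a)))
      ((fun j => coord φ (b.coord j)) '' (Set.range f)ᶜ) := by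
  refine jordanChart_coordGrading b hf (fun ξ => ?_)
    ⟨ω.coord k₀, c, extendZero_coord_comp_contract hφ hf hrow hJ⟩ hY
  choose τ hτ using hτ
  refine ⟨fun m => ∑ k, ξ (ω k) * τ k m, fun j => ?_⟩
  rw [contract_frame hφ, sum_eq_sum_range hf fun i hi => by
    rw [Finset.sum_eq_zero fun k _ => by rw [hcol k i j hi, mul_zero], zero_smul]]
  refine Finset.sum_congr rfl fun a _ => ?_
  congr 1
  split_ifs with h
  · exact Finset.sum_congr rfl fun k _ => by rw [hτ, if_pos h]
  · exact Finset.sum_eq_zero fun k _ => by rw [hτ, if_neg h, mul_zero]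

end FrameChart

/-! ### The homomorphism of coordinate rings induced by a morphism of Higgs bundles -/

section CoordHom

variable {X : Scheme.{0}} [X.Over (Spec (.of ℂ))] {U : X.Opens} {d r : ℕ}
  {𝔉 : HiggsBundle U.toScheme d} {𝔈 : HiggsBundle X r} (i : HiggsHom 𝔉 𝔈)

/-- The restriction of linear forms along a morphism of Higgs bundles. -/
def HiggsHom.dual (W : U.toScheme.Opens) :
    Dual Γ(X, U.ι ''ᵁ W) Γ(𝔈.E, U.ι ''ᵁ W) →ₛₗ[(openInv W).toRingHom] Dual Γ(U, W) Γ(𝔉.E, W) where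
  toFun α :=
    { toFun := fun m => openInv W (α (inclSec i.hom W m))
      map_add' := fun x y => by rw [map_add, map_add, map_add]
      map_smul' := fun a x => by
        rw [map_smulₛₗ, map_smul, smul_eq_mul, map_mul]
        exact congrArg (· * _) (openInv_openAlg W a) }
  map_add' α β := LinearMap.ext fun m => map_add (openInv W) _ _
  map_smul' a α := LinearMap.ext fun m => map_mul (openInv W) _ _

theorem HiggsHom.dual_apply (W : U.toScheme.Opens) (α : Dual Γ(X, U.ι ''ᵁ W) Γ(𝔈.E, U.ι ''ᵁ W))
    (m : Γ(𝔉.E, W)) : i.dual W α m = openInv W (α (inclSec i.hom W m)) := rfl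

/-- The restriction of vector fields to an open subscheme. -/
def dualKaehler (W : U.toScheme.Opens) (ξ : Dual Γ(X, U.ι ''ᵁ W) Ω[Γ(X, U.ι ''ᵁ W)⁄ℂ]) :
    Dual Γ(U, W) Ω[Γ(U, W)⁄ℂ] where
  toFun x := openInv W (ξ (kaehlerMap (openAlg W) x))
  map_add' x y := by rw [map_add, map_add, map_add]
  map_smul' a x := by
    rw [map_smulₛₗ, map_smul, smul_eq_mul, map_mul]
    exact congrArg (· * _) (openInv_openAlg W a)

/-- Restriction of linear forms is compatible with the transposes of the contracted Higgs fields; so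
it preserves the equations of the invariant lines. -/
theorem HiggsHom.dual_comp_contract {W : U.toScheme.Opens} (hW : IsAffineOpen W)
    (α : Dual Γ(X, U.ι ''ᵁ W) Γ(𝔈.E, U.ι ''ᵁ W))
    (ξ : Dual Γ(X, U.ι ''ᵁ W) Ω[Γ(X, U.ι ''ᵁ W)⁄ℂ]) :
    i.dual W (α ∘ₗ contract (𝔈.φ (hW.image_of_isOpenImmersion U.ι)) ξ) =
      i.dual W α ∘ₗ contract (𝔉.φ hW) (dualKaehler W ξ) := by
  refine LinearMap.ext fun m => congrArg (openInv W) (congrArg α ?_)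
  exact contract_map (ρ := inclSec i.hom W) (ν := kaehlerMap (openAlg W)) (i.comm hW)
    (ξ := dualKaehler W ξ) (fun x => (openAlg_openInv W _).symm) m

/-- The homomorphism of homogeneous coordinate rings that restricts linear forms along a morphism
of Higgs bundles. -/
def HiggsHom.coordHom {W : U.toScheme.Opens} (hW : IsAffineOpen W) :
    coordGrading (𝔈.φ (hW.image_of_isOpenImmersion U.ι)) →+*ᵍ coordGrading (𝔉.φ hW) where
  toRingHom := Ideal.quotientMap (higgsIdeal (𝔉.φ hW)) (symMap (i.dual W)) (by
    refine Ideal.span_le.mpr ?_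
    rintro _ ⟨⟨α, β, ξ⟩, rfl⟩
    have h1 : symMap (i.dual W) (higgsRel (𝔈.φ (hW.image_of_isOpenImmersion U.ι)) (α, β, ξ)) =
        higgsRel (𝔉.φ hW) (i.dual W α, i.dual W β, dualKaehler W ξ) := by
      simp only [higgsRel, map_sub, map_mul, symMap_ι, i.dual_comp_contract hW]
    change symMap (i.dual W) _ ∈ higgsIdeal (𝔉.φ hW)
    rw [h1]
    exact Ideal.subset_span ⟨_, rfl⟩)
  map_mem := by
    rintro j _ ⟨x, hx, rfl⟩
    exact ⟨symMap (i.dual W) x, symMap_mem _ hx, rfl⟩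

theorem HiggsHom.coordHom_coord {W : U.toScheme.Opens} (hW : IsAffineOpen W)
    (α : Dual Γ(X, U.ι ''ᵁ W) Γ(𝔈.E, U.ι ''ᵁ W)) :
    i.coordHom hW (coord _ α) = coord _ (i.dual W α) :=
  congrArg (Ideal.Quotient.mk (higgsIdeal (𝔉.φ hW))) (symMap_ι _ _)

theorem HiggsHom.coordHom_algebraMap {W : U.toScheme.Opens} (hW : IsAffineOpen W)
    (a : Γ(X, U.ι ''ᵁ W)) : i.coordHom hW (algebraMap Γ(X, U.ι ''ᵁ W) _ a) =
      algebraMap Γ(U, W) _ (openInv W a) :=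
  congrArg (Ideal.Quotient.mk (higgsIdeal (𝔉.φ hW))) (symMap_algebraMap _ _)

end CoordHom

/-! ### Higgs fields with a Jordan matrix -/

section IsJordan

variable {X : Scheme.{0}} [X.Over (Spec (.of ℂ))] {U : X.Opens} {r n s : ℕ} {d : Fin s → ℕ}
  {𝔈 : HiggsBundle X r}

/-- The homogeneous coordinates that belong to one block of a frame on the chart over an affine open
set, extended by zero. -/
def frameVar (e : Frame 𝔈.E U (Σ v : Fin s, Fin (d v))) {W : X.Opens} (hW : IsAffineOpen W)
    (hWU : W ≤ U) (v : Fin s) : ℕ → CoordRing (𝔈.φ hW) :=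
  extendZero fun a => coord (𝔈.φ hW) ((e.basis hWU).coord ⟨v, a⟩)

/-- In the frames `e` and `ω` the Higgs field is given by the matrices `Φ k`, and `Φ k₀` is block
diagonal with Jordan blocks whose eigenvalues `c v` differ everywhere on `U`. -/
structure IsJordan (e : Frame 𝔈.E U (Σ v : Fin s, Fin (d v))) (ω : CotangentFrame U n)
    (Φ : Fin n → Matrix (Σ v : Fin s, Fin (d v)) (Σ v : Fin s, Fin (d v)) Γ(X, U))
    (c : Fin s → Γ(X, U)) (k₀ : Fin n) : Prop where
  represents : Represents e ω Φ
  isUnit_sub : ∀ v w, v ≠ w → IsUnit (c v - c w)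
  eq_blockDiagonal : Φ k₀ = Matrix.blockDiagonal' fun v => jordanBlock (c v) (d v)

namespace IsJordan

variable {e : Frame 𝔈.E U (Σ v : Fin s, Fin (d v))} {ω : CotangentFrame U n}
  {Φ : Fin n → Matrix (Σ v : Fin s, Fin (d v)) (Σ v : Fin s, Fin (d v)) Γ(X, U)}
  {c : Fin s → Γ(X, U)} {k₀ : Fin n} (H : IsJordan e ω Φ c k₀)

theorem commute (H : IsJordan e ω Φ c k₀) (k : Fin n) :
    Φ k * Matrix.blockDiagonal' (fun v => jordanBlock (c v) (d v)) =
    Matrix.blockDiagonal' (fun v => jordanBlock (c v) (d v)) * Φ k := by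
  rw [← H.eq_blockDiagonal]
  exact Represents.commute H.represents k k₀

theorem col_eq_zero (H : IsJordan e ω Φ c k₀) (v : Fin s) (k : Fin n)
    (i : Σ v : Fin s, Fin (d v)) (b : Fin (d v))
    (hi : i ∉ Set.range (Sigma.mk (β := fun v => Fin (d v)) v)) : Φ k i ⟨v, b⟩ = 0 := by
  obtain ⟨w, a⟩ := i
  refine apply_eq_zero_of_commute_jordan (H.commute k) H.isUnit_sub ?_ a b
  rintro rfl
  exact hi ⟨a, rfl⟩

theorem row_eq_zero (H : IsJordan e ω Φ c k₀) (v : Fin s) (k : Fin n)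
    (a : Fin (d v)) (j : Σ v : Fin s, Fin (d v))
    (hj : j ∉ Set.range (Sigma.mk (β := fun v => Fin (d v)) v)) : Φ k ⟨v, a⟩ j = 0 := by
  obtain ⟨w, b⟩ := j
  refine apply_eq_zero_of_commute_jordan (H.commute k) H.isUnit_sub ?_ a b
  rintro rfl
  exact hj ⟨b, rfl⟩

theorem apply_block (H : IsJordan e ω Φ c k₀) (v : Fin s) (a b : Fin (d v)) :
    Φ k₀ ⟨v, a⟩ ⟨v, b⟩ = jordanBlock (c v) (d v) a b := by
  rw [H.eq_blockDiagonal, Matrix.blockDiagonal'_apply_eq]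

/-- Every matrix of the Higgs field is Toeplitz in each block, also after a change of rings. -/
theorem exists_toeplitz (H : IsJordan e ω Φ c k₀) {B : Type} [CommRing B] (σ : Γ(X, U) →+* B)
    (v : Fin s) (k : Fin n) :
    ∃ τ : ℕ → B, ∀ a b : Fin (d v),
      σ (Φ k ⟨v, a⟩ ⟨v, b⟩) = if a ≤ b then τ (b - a) else 0 := by
  obtain ⟨τ, hτ⟩ := exists_toeplitz_of_commute_jordan (H.commute k) v
  refine ⟨fun m => σ (τ m), fun a b => ?_⟩
  rw [hτ]
  split_ifs
  · rfl
  · exact map_zero σ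

theorem map_jordanBlock_apply {A B : Type} [CommRing A] [CommRing B] (σ : A →+* B) (c : A) {m : ℕ}
    (a b : Fin m) : σ (jordanBlock c m a b) = jordanBlock (σ c) m a b :=
  congrFun (congrFun (jordanBlock_map σ c m) a) b

/-- The Higgs bundle on the generalized eigensheaf with eigenvalue `c v`. -/
def block (v : Fin s) : HiggsBundle U.toScheme (d v) :=
  subBundle H.represents (g := Sigma.mk (β := fun v => Fin (d v)) v) sigma_mk_injective
    fun k i b => H.col_eq_zero v k i b

/-- The frame of the generalized eigensheaf given by the `v`-th part of the frame `e`. -/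
def frame (v : Fin s) : Frame (H.block v).E ⊤ (Fin (d v)) :=
  subBundle.frame H.represents (g := Sigma.mk (β := fun v => Fin (d v)) v) sigma_mk_injective
    fun k i b => H.col_eq_zero v k i b

/-- The inclusion of the generalized eigensheaf. -/
def incl (v : Fin s) : HiggsHom (H.block v) 𝔈 :=
  subBundle.incl H.represents (g := Sigma.mk (β := fun v => Fin (d v)) v) sigma_mk_injective
    fun k i b => H.col_eq_zero v k i b

theorem represents_block (v : Fin s) : Represents (H.frame v) ω.onOpen
    fun k => ((Φ k).submatrix (Sigma.mk v) (Sigma.mk v)).map (toOpen ⊤) :=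
  subBundle.represents H.represents (g := Sigma.mk (β := fun v => Fin (d v)) v) sigma_mk_injective
    fun k i b => H.col_eq_zero v k i b

theorem inclSec_basis (v : Fin s) (W : U.toScheme.Opens) (a : Fin (d v)) :
    inclSec (H.incl v).hom W ((H.frame v).basis (le_top (a := W)) a) =
      e.basis (U.ι_image_le W) ⟨v, a⟩ :=
  subBundle.inclSec_basis H.represents (g := Sigma.mk (β := fun v => Fin (d v)) v)
    sigma_mk_injective (fun k i b => H.col_eq_zero v k i b) W a

theorem isEigenSubbundle (v : Fin s) : IsEigenSubbundle (H.incl v) e (Φ k₀) (c v) := by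
  have h := subBundle.isEigenSubbundle H.represents H.isUnit_sub v
    fun k i b => H.col_eq_zero v k i b
  rw [← H.eq_blockDiagonal] at h
  exact h

/-- The homogeneous coordinates on the chart of one block over an affine open set, extended by
zero. -/
def blockVar {W : U.toScheme.Opens} (hW : IsAffineOpen W) (v : Fin s) :
    ℕ → CoordRing ((H.block v).φ hW) :=
  extendZero fun a => coord ((H.block v).φ hW) (((H.frame v).basis (le_top (a := W))).coord a)

theorem field_basis (H : IsJordan e ω Φ c k₀) {W : X.Opens} (hW : IsAffineOpen W) (hWU : W ≤ U)
    (j : Σ v : Fin s, Fin (d v)) : 𝔈.φ hW (e.basis hWU j) =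
      ∑ k, ∑ i, ((Φ k).map (resAlg hWU) i j • e.basis hWU i) ⊗ₜ ω.basis hW hWU k := by
  rw [H.represents hW hWU]
  simp only [ω.basis_apply]
  rfl

theorem coord_mul_coord_eq_zero (H : IsJordan e ω Φ c k₀) {W : X.Opens} (hW : IsAffineOpen W)
    (hWU : W ≤ U) {v w : Fin s} (hvw : v ≠ w) (i j : ℕ) :
    frameVar e hW hWU v i * frameVar e hW hWU w j = 0 := by
  have h1 : ∀ v i, frameVar e hW hWU v i =
      coord (𝔈.φ hW) (extendZero (fun a => (e.basis hWU).coord ⟨v, a⟩) i) :=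
    fun v i => (map_extendZero (coordₗ (𝔈.φ hW)) _ i).symm
  rw [h1, h1]
  have h2 := fun (v : Fin s) (i : ℕ) => extendZero_coord_comp_contract (k₀ := k₀)
    (c := resAlg hWU (c v)) (f := Sigma.mk (β := fun v => Fin (d v)) v)
    (H.field_basis hW hWU) sigma_mk_injective
    (fun a j hj => by rw [Matrix.map_apply, H.row_eq_zero v k₀ a j hj, map_zero])
    (fun a j => by
      rw [Matrix.map_apply, H.apply_block]
      exact map_jordanBlock_apply (resAlg hWU).toRingHom _ _ _) i
  refine HiggsGrass.coord_mul_coord_eq_zero (fun i hi => extendZero_of_le _ hi)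
    (fun i hi => extendZero_of_le _ hi) ?_ (h2 v) (h2 w) i j
  rw [← map_sub]
  exact (H.isUnit_sub v w hvw).map _

/-- The chart of the Higgs Grassmannian of `𝔈` over an affine open subset of `U` where the first
coordinate of the `v`-th block does not vanish. -/
theorem jordanChart (H : IsJordan e ω Φ c k₀) {W : X.Opens} (hW : IsAffineOpen W) (hWU : W ≤ U)
    (v : Fin s) :
    JordanChart (coordGrading (𝔈.φ hW)) (d v) (frameVar e hW hWU v)
      ((fun j => coord (𝔈.φ hW) ((e.basis hWU).coord j)) '' (Set.range (Sigma.mk v))ᶜ) := by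
  refine jordanChart_of_toeplitz (k₀ := k₀) (c := resAlg hWU (c v)) (H.field_basis hW hWU)
    sigma_mk_injective
    (fun k i j hi => by rw [Matrix.map_apply, H.col_eq_zero v k i j hi, map_zero])
    (fun k => H.exists_toeplitz (resAlg hWU).toRingHom v k)
    (fun a j hj => by rw [Matrix.map_apply, H.row_eq_zero v k₀ a j hj, map_zero])
    (fun a j => by
      rw [Matrix.map_apply, H.apply_block]
      exact map_jordanBlock_apply (resAlg hWU).toRingHom _ _ _) ?_
  rintro h ⟨w, b⟩ hj
  have h1 := H.coord_mul_coord_eq_zero hW hWU (v := v) (w := w)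
    (by rintro rfl; exact hj ⟨b, rfl⟩) (⟨0, h⟩ : Fin (d v)) b
  rwa [frameVar, frameVar, extendZero_fin, extendZero_fin] at h1

/-- The Higgs Grassmannian of one block over an affine open subset of `U`. -/
theorem jordanChart_block {W : U.toScheme.Opens} (hW : IsAffineOpen W) (v : Fin s) :
    JordanChart (coordGrading ((H.block v).φ hW)) (d v) (H.blockVar hW v) ∅ := by
  have h1 : ∀ j, (H.block v).φ hW ((H.frame v).basis (le_top (a := W)) j) =
      ∑ k, ∑ i, ((((Φ k).submatrix (Sigma.mk v) (Sigma.mk v)).map (toOpen W)) i j •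
        (H.frame v).basis (le_top (a := W)) i) ⊗ₜ ω.onOpen.basis hW le_top k := by
    intro j
    rw [H.represents_block v hW le_top]
    simp only [ω.onOpen.basis_apply, Matrix.map_apply]
    refine Finset.sum_congr rfl fun k _ => Finset.sum_congr rfl fun i _ => ?_
    rw [resAlg_toOpen]
  have h2 := jordanChart_of_toeplitz (k₀ := k₀) (c := toOpen W (c v)) (f := id) h1
    Function.injective_id (fun k i j hi => (hi ⟨i, rfl⟩).elim)
    (fun k => H.exists_toeplitz (toOpen W) v k) (fun a j hj => (hj ⟨j, rfl⟩).elim)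
    (fun a j => by
      change toOpen W (Φ k₀ ⟨v, a⟩ ⟨v, j⟩) = _
      rw [H.apply_block]
      exact map_jordanBlock_apply (toOpen W) _ _ _)
    (fun _ j hj => (hj ⟨j, rfl⟩).elim)
  rwa [Set.range_id, Set.compl_univ, Set.image_empty] at h2

/-- The coordinates of `e` in the `v`-th block restrict to the coordinates of the frame of the
block. -/
theorem dual_coord (v : Fin s) (W : U.toScheme.Opens) (a : Fin (d v)) :
    (H.incl v).dual W ((e.basis (U.ι_image_le W)).coord ⟨v, a⟩) =
      ((H.frame v).basis (le_top (a := W))).coord a := by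
  classical
  refine ((H.frame v).basis (le_top (a := W))).ext fun b => ?_
  rw [HiggsHom.dual_apply, H.inclSec_basis, Basis.coord_apply, Basis.coord_apply, Basis.repr_self,
    Basis.repr_self, Finsupp.single_apply, Finsupp.single_apply, apply_ite (openInv W), map_one,
    map_zero]
  exact if_congr (sigma_mk_injective (β := fun v => Fin (d v))).eq_iff rfl rfl

theorem coordHom_var {W : U.toScheme.Opens} (hW : IsAffineOpen W) (v : Fin s) (i : ℕ) :
    (H.incl v).coordHom hW (frameVar e (hW.image_of_isOpenImmersion U.ι) (U.ι_image_le W) v i) =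
      H.blockVar hW v i := by
  refine (map_extendZero ((H.incl v).coordHom hW) _ i).trans ?_
  refine congrArg (fun x => extendZero x i) (funext fun a => ?_)
  exact ((H.incl v).coordHom_coord hW _).trans (congrArg _ (H.dual_coord v W a))

end IsJordan

end IsJordan

/-! ### Morphisms from Higgs Grassmannians -/

section RelativeGluing

open Scheme.Cover

variable {S : Scheme.{0}} {𝒰 : S.OpenCover} [Category 𝒰.I₀] [𝒰.LocallyDirected] [Small.{0} 𝒰.I₀]
  [Quiver.IsThin 𝒰.I₀] (D : RelativeGluingData 𝒰)

/-- This is `colimit.w`, in terms of the open cover of the glued scheme. -/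
theorem map_cover_f {i j : 𝒰.I₀} (f : i ⟶ j) : D.functor.map f ≫ D.cover.f j = D.cover.f i :=
  colimit.w D.functor f

/-- A morphism from a relative gluing is given by compatible morphisms from the pieces. -/
def gluedDesc {T : Scheme.{0}} (g : ∀ i, D.functor.obj i ⟶ T)
    (hg : ∀ i j (f : i ⟶ j), D.functor.map f ≫ g j = g i) : D.glued ⟶ T :=
  colimit.desc D.functor
    { pt := T
      ι := { app := g, naturality := fun i j f => (hg i j f).trans (Category.comp_id _).symm } }

theorem cover_f_gluedDesc {T : Scheme.{0}} (g : ∀ i, D.functor.obj i ⟶ T)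
    (hg : ∀ i j (f : i ⟶ j), D.functor.map f ≫ g j = g i) (i : 𝒰.I₀) :
    D.cover.f i ≫ gluedDesc D g hg = g i :=
  colimit.ι_desc _ i

theorem isOpenImmersion_cover_f (i : 𝒰.I₀) : IsOpenImmersion (D.cover.f i) :=
  D.cover.map_prop i

end RelativeGluing

section Glue

variable {X : Scheme.{0}} [X.Over (Spec (.of ℂ))] {r : ℕ} {𝔈 : HiggsBundle X r}
  [Smooth (X ↘ Spec (.of ℂ))]

theorem Hgrass.chartMap_ι {V W : TrivAffine 𝔈} (h : V ≤ W) :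
    chartMap h ≫ Hgrass.ι 𝔈 W = Hgrass.ι 𝔈 V :=
  map_cover_f (gluingData 𝔈) (homOfLE h : (show (TrivAffine.cover 𝔈).I₀ from V) ⟶ W)

/-- A morphism from the Higgs Grassmannian is given by compatible morphisms from the charts. -/
def Hgrass.desc {T : Scheme.{0}} (g : ∀ W : TrivAffine 𝔈, chart 𝔈 W ⟶ T)
    (hg : ∀ (V W : TrivAffine 𝔈) (h : V ≤ W), chartMap h ≫ g W = g V) : Hgrass 𝔈 ⟶ T :=
  gluedDesc (gluingData 𝔈) g fun V W h => hg V W (leOfHom (X := TrivAffine 𝔈) h)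

theorem Hgrass.ι_desc {T : Scheme.{0}} (g : ∀ W : TrivAffine 𝔈, chart 𝔈 W ⟶ T)
    (hg : ∀ (V W : TrivAffine 𝔈) (h : V ≤ W), chartMap h ≫ g W = g V) (W : TrivAffine 𝔈) :
    Hgrass.ι 𝔈 W ≫ Hgrass.desc g hg = g W :=
  cover_f_gluedDesc (gluingData 𝔈) g _ W

theorem Hgrass.hom_ext {T : Scheme.{0}} {f g : Hgrass 𝔈 ⟶ T}
    (h : ∀ W, Hgrass.ι 𝔈 W ≫ f = Hgrass.ι 𝔈 W ≫ g) : f = g :=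
  (gluingData 𝔈).cover.hom_ext f g h

theorem Hgrass.ι_proj (W : TrivAffine 𝔈) : Hgrass.ι 𝔈 W ≫ Hgrass.proj 𝔈 =
    projToSpec (coordGrading (𝔈.φ W.affine)) ≫ W.affine.fromSpec :=
  ((Hgrass.isPullback_ι 𝔈 W).w.symm.trans (Category.assoc _ _ _)).trans
    (congrArg _ W.affine.isoSpec_inv_ι)

theorem Hgrass.exists_ι {W : TrivAffine 𝔈} {x : Hgrass 𝔈} (h : Hgrass.proj 𝔈 x ∈ W.1) :
    ∃ p, Hgrass.ι 𝔈 W p = x := by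
  obtain ⟨p, -, hp⟩ := Scheme.exists_preimage_of_isPullback (Hgrass.isPullback_ι 𝔈 W)
    (⟨_, h⟩ : W.1.toScheme) x rfl
  exact ⟨p, hp⟩

instance (W : TrivAffine 𝔈) : IsOpenImmersion (Hgrass.ι 𝔈 W) :=
  isOpenImmersion_cover_f (gluingData 𝔈) W

end Glue

/-! ### The morphism of Higgs Grassmannians induced by a morphism of Higgs bundles -/

section Induced

variable {X : Scheme.{0}} [X.Over (Spec (.of ℂ))] {U : X.Opens} {d r : ℕ}
  {𝔉 : HiggsBundle U.toScheme d} {𝔈 : HiggsBundle X r} (i : HiggsHom 𝔉 𝔈)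

/-- The reindexing of a frame along a bijection of the index types. -/
def Frame.reindex {E : X.Modules} {κ κ' : Type} (e : Frame E U κ) (σ : κ' ≃ κ) : Frame E U κ' where
  sec a := e.sec (σ a)
  linearIndependent h := (e.linearIndependent h).comp σ σ.injective
  span h := by
    change ⊤ ≤ Submodule.span _ (Set.range ((fun a => resMod E h (e.sec a)) ∘ σ))
    rw [σ.surjective.range_comp]
    exact e.span h

theorem openInv_eq_appLE (W : U.toScheme.Opens) :
    CommRingCat.ofHom (openInv W).toRingHom =
      U.ι.appLE (U.ι ''ᵁ W) W (le_preimage_of_image_eq rfl) := by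
  rw [← Scheme.Hom.appIso_hom', ← cancel_mono (U.ι.appIso W).inv, Iso.hom_inv_id]
  exact CommRingCat.hom_ext (RingHom.ext (openAlg_openInv W))

theorem SpecMap_openInv_fromSpec {W : U.toScheme.Opens} (hW : IsAffineOpen W) :
    Spec.map (CommRingCat.ofHom (openInv W).toRingHom) ≫
      (hW.image_of_isOpenImmersion U.ι).fromSpec = hW.fromSpec ≫ U.ι := by
  rw [openInv_eq_appLE]
  exact IsAffineOpen.SpecMap_appLE_fromSpec _ _ _ _

theorem inclSec_resMod {F : U.toScheme.Modules} {E : X.Modules} (g : F ⟶ E.restrict U.ι)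
    {V W : U.toScheme.Opens} (h : V ≤ W) (m : Γ(F, W)) :
    inclSec g V (resMod F h m) = resMod E (U.ι.image_mono h) (inclSec g W m) :=
  congrArg (E.restrictAppIso U.ι V).hom.hom (Modules.app_naturality g (homOfLE h) m)

variable {i}

/-- The image in `X` of a trivializing affine open subset of `U`. -/
abbrev TrivAffine.image (h : ∀ W : TrivAffine 𝔉, Nonempty (Frame 𝔈.E (U.ι ''ᵁ W.1) (Fin r)))
    (W : TrivAffine 𝔉) : TrivAffine 𝔈 :=
  ⟨U.ι ''ᵁ W.1, W.affine.image_of_isOpenImmersion U.ι, h W⟩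

theorem TrivAffine.image_mono
    (h : ∀ W : TrivAffine 𝔉, Nonempty (Frame 𝔈.E (U.ι ''ᵁ W.1) (Fin r))) {V W : TrivAffine 𝔉}
    (hVW : V ≤ W) : image h V ≤ image h W := by
  obtain ⟨f, hf⟩ := hVW
  refine ⟨openAlg W.1 f, ?_⟩
  change _ = U.ι ''ᵁ V.1
  rw [← hf, Scheme.image_basicOpen]
  rfl

theorem coordGrading_hom_ext {A B M N T : Type} [CommRing A] [CommRing B] [AddCommGroup M]
    [Module A M] [AddCommGroup N] [Module A N] [CommRing T] [Algebra B T] {φ : M →ₗ[A] M ⊗[A] N}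
    {𝒯 : ℕ → Submodule B T} {g g' : coordGrading φ →+*ᵍ 𝒯}
    (h1 : ∀ a, g (algebraMap A _ a) = g' (algebraMap A _ a))
    (h2 : ∀ x, g (coord φ x) = g' (coord φ x)) : g = g' := by
  have h3 : g.toRingHom = g'.toRingHom := coordHom_ext h1 h2
  exact GradedRingHom.ext fun x => congr($h3 x)

variable (i) in
/-- The restriction of linear forms along `i` over a trivializing affine open subset of `U`. -/
def HiggsHom.chartCoordHom (h : ∀ W : TrivAffine 𝔉, Nonempty (Frame 𝔈.E (U.ι ''ᵁ W.1) (Fin r)))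
    (W : TrivAffine 𝔉) :
    coordGrading (𝔈.φ (TrivAffine.image h W).affine) →+*ᵍ coordGrading (𝔉.φ W.affine) :=
  i.coordHom W.affine

variable (h : ∀ W : TrivAffine 𝔉, Nonempty (Frame 𝔈.E (U.ι ''ᵁ W.1) (Fin r)))

theorem HiggsHom.chartCoordHom_coord (W : TrivAffine 𝔉)
    (α : Dual Γ(X, U.ι ''ᵁ W.1) Γ(𝔈.E, U.ι ''ᵁ W.1)) :
    i.chartCoordHom h W (coord _ α) = coord _ (i.dual W.1 α) :=
  i.coordHom_coord W.affine α

theorem HiggsHom.chartCoordHom_algebraMap (W : TrivAffine 𝔉) (a : Γ(X, U.ι ''ᵁ W.1)) :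
    i.chartCoordHom h W (algebraMap Γ(X, U.ι ''ᵁ W.1) _ a) =
      algebraMap Γ(U, W.1) _ (openInv W.1 a) :=
  i.coordHom_algebraMap W.affine a

/-- On every trivializing affine open subset of `U`, the linear forms on `𝔈` restrict to generators
of the irrelevant ideal of the coordinate ring of `𝔉`. -/
def HiggsHom.Embeds (i : HiggsHom 𝔉 𝔈)
    (h : ∀ W : TrivAffine 𝔉, Nonempty (Frame 𝔈.E (U.ι ''ᵁ W.1) (Fin r))) : Prop :=
  ∀ W : TrivAffine 𝔉, HomogeneousIdeal.irrelevant (coordGrading (𝔉.φ W.affine)) ≤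
    (HomogeneousIdeal.irrelevant (coordGrading (𝔈.φ (TrivAffine.image h W).affine))).map
      (i.chartCoordHom h W)

variable {h} (hirr : i.Embeds h)

/-- The morphism of charts that sends an invariant line to its image. -/
def HiggsHom.chartHom (W : TrivAffine 𝔉) : chart 𝔉 W ⟶ chart 𝔈 (TrivAffine.image h W) :=
  Proj.map (i.chartCoordHom h W) (hirr W)

theorem HiggsHom.chartHom_projToSpec (W : TrivAffine 𝔉) :
    chartHom hirr W ≫ projToSpec (coordGrading (𝔈.φ (TrivAffine.image h W).affine)) =
      projToSpec (coordGrading (𝔉.φ W.affine)) ≫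
        Spec.map (CommRingCat.ofHom (openInv W.1).toRingHom) :=
  projMap_projToSpec (hirr W) (i.chartCoordHom_algebraMap h W)

variable [Smooth (X ↘ Spec (.of ℂ))]

variable (h) in
/-- Restricting linear forms along `i` commutes with restricting them to smaller open sets. -/
theorem HiggsHom.coordRes_comp_chartCoordHom {V W : TrivAffine 𝔉} (hVW : V ≤ W) :
    (coordRes hVW).comp (i.chartCoordHom h W) =
      (i.chartCoordHom h V).comp (coordRes (TrivAffine.image_mono h hVW)) := by
  refine coordGrading_hom_ext (fun a => ?_) (fun α => ?_)
  · have h1 := (congrArg (coordRes hVW) (i.chartCoordHom_algebraMap h W a)).trans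
      (coordRes_algebraMap hVW _)
    have h2 := (congrArg (i.chartCoordHom h V)
      (coordRes_algebraMap (TrivAffine.image_mono h hVW) a)).trans
      (i.chartCoordHom_algebraMap h V _)
    refine h1.trans (Eq.trans ?_ h2.symm)
    exact congrArg _ (openInv_resAlg (TrivAffine.opens_le hVW) a).symm
  · have D := dualPair_resMod (TrivAffine.image_mono h hVW)
      (TrivAffine.image_mono h hVW).choose_spec
    have h1 := (congrArg (i.chartCoordHom h V)
      (coordRes_coord (TrivAffine.image_mono h hVW) α _ (D.map_apply α))).trans
      (i.chartCoordHom_coord h V _)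
    have h2 := congrArg (coordRes hVW) (i.chartCoordHom_coord h W α)
    refine (h2.trans (coordRes_coord hVW _ _ fun m => ?_)).trans h1.symm
    rw [HiggsHom.dual_apply, HiggsHom.dual_apply, inclSec_resMod, ← openInv_resAlg]
    exact congrArg _ (D.map_apply α _)

theorem HiggsHom.chartMap_chartHom {V W : TrivAffine 𝔉} (hVW : V ≤ W) :
    chartMap hVW ≫ chartHom hirr W =
      chartHom hirr V ≫ chartMap (TrivAffine.image_mono h hVW) :=
  (projMap_eq_comp rfl _ _
    (HomogeneousIdeal.irrelevant_le_map_comp (hirr W) (coordRes_irrelevant hVW))).symm.trans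
    (projMap_eq_comp (i.coordRes_comp_chartCoordHom h hVW) _ _ _)

/-- The morphism of Higgs Grassmannians that sends an invariant line to its image. -/
def HiggsHom.hgrass : Hgrass 𝔉 ⟶ Hgrass 𝔈 :=
  Hgrass.desc (fun W => chartHom hirr W ≫ Hgrass.ι 𝔈 (TrivAffine.image h W))
    fun V W hVW => by
      rw [← Category.assoc, chartMap_chartHom, Category.assoc, Hgrass.chartMap_ι]

theorem HiggsHom.ι_hgrass (W : TrivAffine 𝔉) : Hgrass.ι 𝔉 W ≫ hgrass hirr =
    chartHom hirr W ≫ Hgrass.ι 𝔈 (TrivAffine.image h W) :=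
  Hgrass.ι_desc _ _ W

theorem HiggsHom.hgrass_proj :
    hgrass hirr ≫ Hgrass.proj 𝔈 = Hgrass.proj 𝔉 ≫ U.ι := by
  refine Hgrass.hom_ext fun W => ?_
  refine ((Category.assoc _ _ _).symm.trans (congrArg (· ≫ _) (ι_hgrass hirr W))).trans ?_
  refine (Category.assoc _ _ _).trans ?_
  refine (congrArg (chartHom hirr W ≫ ·) (Hgrass.ι_proj (TrivAffine.image h W))).trans ?_
  refine ((Category.assoc _ _ _).symm.trans
    (congrArg (· ≫ _) (chartHom_projToSpec hirr W))).trans ?_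
  refine (Category.assoc _ _ _).trans ?_
  refine (congrArg _ (SpecMap_openInv_fromSpec W.affine)).trans ?_
  refine (Category.assoc _ _ _).symm.trans ?_
  exact (congrArg (· ≫ _) (Hgrass.ι_proj W).symm).trans (Category.assoc _ _ _)

theorem HiggsHom.isInducedBy_hgrass : IsInducedBy (hgrass hirr) i := by
  rintro W' ⟨W, hW⟩ (rfl : U.ι ''ᵁ W'.1 = W)
  refine ⟨i.chartCoordHom h W', hirr W', fun a => ?_, fun α β hαβ => ?_, ι_hgrass hirr W'⟩
  · refine (i.chartCoordHom_algebraMap h W' a).trans ?_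
    exact congrArg _ congr($(openInv_eq_appLE W'.1) a)
  · refine (i.chartCoordHom_coord h W' α).trans ?_
    congr 1
    refine LinearMap.ext fun m => (openAlg_bijective W'.1).1 ?_
    rw [HiggsHom.dual_apply, openAlg_openInv, hαβ m (inclSec i.hom W'.1 m) (resMod_refl _ _ _).symm,
      resAlg_refl]

end Induced

/-! ### The Higgs Grassmannians of the blocks -/

section Blocks

variable {X : Scheme.{0}} [X.Over (Spec (.of ℂ))] {U : X.Opens}
  {r n s : ℕ} {d : Fin s → ℕ} {𝔈 : HiggsBundle X r}
  {e : Frame 𝔈.E U (Σ v : Fin s, Fin (d v))} {ω : CotangentFrame U n}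
  {Φ : Fin n → Matrix (Σ v : Fin s, Fin (d v)) (Σ v : Fin s, Fin (d v)) Γ(X, U)}
  {c : Fin s → Γ(X, U)} {k₀ : Fin n} (H : IsJordan e ω Φ c k₀) (hr : ∑ v, d v = r)

theorem exists_isAffineOpen_mem {Y : Scheme.{0}} (y : Y) :
    ∃ W : Y.Opens, IsAffineOpen W ∧ y ∈ W := by
  obtain ⟨_, ⟨W, hW, rfl⟩, hy, -⟩ :=
    Y.isBasis_affineOpens.exists_subset_of_mem_open (Set.mem_univ y) isOpen_univ
  exact ⟨W, hW, hy⟩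

namespace IsJordan

/-- Every affine open subset of `U` trivializes the bundle of a block. -/
abbrev trivAffine (v : Fin s) {W : U.toScheme.Opens} (hW : IsAffineOpen W) :
    TrivAffine (H.block v) :=
  ⟨W, hW, ⟨(H.frame v).restrict le_top⟩⟩

/-- An open subset of `U` has a frame indexed by `Fin r`, since the blocks have total size `r`. -/
theorem nonempty_frame (hr : ∑ v, d v = r) (v : Fin s) (W : TrivAffine (H.block v)) :
    Nonempty (Frame 𝔈.E (U.ι ''ᵁ W.1) (Fin r)) :=
  ⟨(e.restrict (U.ι_image_le W.1)).reindex ((finCongr hr.symm).trans finSigmaFinEquiv.symm)⟩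

/-- The coordinates that belong to one block on the chart over the image of an affine open set. -/
abbrev imageVar (v : Fin s) (W : TrivAffine (H.block v)) (w : Fin s) :
    ℕ → CoordRing (𝔈.φ (TrivAffine.image (H.nonempty_frame hr v) W).affine) :=
  frameVar e (TrivAffine.image (H.nonempty_frame hr v) W).affine (U.ι_image_le W.1) w

theorem chartCoordHom_var (v : Fin s) (W : TrivAffine (H.block v)) (i : ℕ) :
    (H.incl v).chartCoordHom (H.nonempty_frame hr v) W (H.imageVar hr v W v i) =
      H.blockVar W.affine v i :=
  H.coordHom_var W.affine v i

theorem jordanChart_image (v : Fin s) (W : TrivAffine (H.block v)) :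
    JordanChart (coordGrading (𝔈.φ (TrivAffine.image (H.nonempty_frame hr v) W).affine)) (d v)
      (H.imageVar hr v W v)
      ((fun j => coord (𝔈.φ (TrivAffine.image (H.nonempty_frame hr v) W).affine)
        ((e.basis (U.ι_image_le W.1)).coord j)) '' (Set.range (Sigma.mk v))ᶜ) :=
  H.jordanChart (TrivAffine.image (H.nonempty_frame hr v) W).affine (U.ι_image_le W.1) v

/-- The coordinates in the `v`-th block restrict to all generators of the coordinate ring of the
block. -/
theorem embeds (v : Fin s) : (H.incl v).Embeds (H.nonempty_frame hr v) := fun W =>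
  (H.jordanChart_image hr v W).irrelevant_le_map
    (H.jordanChart_block W.affine v) (H.chartCoordHom_var hr v W)

/-- The charts of different blocks are disjoint, since the product of their coordinates is zero. -/
theorem not_mem_basicOpen (H : IsJordan e ω Φ c k₀) {W : X.Opens} (hW : IsAffineOpen W)
    (hWU : W ≤ U) {v w : Fin s} (hvw : v ≠ w) (x : Proj (coordGrading (𝔈.φ hW)))
    (hv : x ∈ Proj.basicOpen (coordGrading (𝔈.φ hW)) (frameVar e hW hWU v 0)) :
    x ∉ Proj.basicOpen (coordGrading (𝔈.φ hW)) (frameVar e hW hWU w 0) := fun hw =>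
  (x.isPrime.mem_or_mem (x := frameVar e hW hWU v 0) (y := frameVar e hW hWU w 0)
    (by rw [H.coord_mul_coord_eq_zero hW hWU hvw]; exact zero_mem _)).elim hv hw

/-- The charts of the blocks cover the Higgs Grassmannian: a common zero of the first coordinates of
all blocks would be a common zero of all coordinates. -/
theorem exists_mem_basicOpen (H : IsJordan e ω Φ c k₀) {W : X.Opens} (hW : IsAffineOpen W)
    (hWU : W ≤ U) (x : Proj (coordGrading (𝔈.φ hW))) :
    ∃ v, x ∈ Proj.basicOpen (coordGrading (𝔈.φ hW)) (frameVar e hW hWU v 0) := by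
  by_contra! h
  refine x.not_irrelevant_le ?_
  rw [HomogeneousIdeal.irrelevant_le]
  intro m hm y hy
  refine JordanChart.le_of_subset hm ?_ (coordGrading_le (e.basis hWU) m hy)
  rintro _ ⟨⟨v, a⟩, rfl⟩
  have h1 := (H.jordanChart hW hWU v).mem_of_zero_mem x (not_not.mp (h v)) a
  rwa [frameVar, extendZero_fin] at h1

theorem projMap_chartCoordHom (v : Fin s) (W : TrivAffine (H.block v)) :
    IsOpenImmersion (Proj.map ((H.incl v).chartCoordHom (H.nonempty_frame hr v) W)
      (H.embeds hr v W)) ∧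
    Set.range (Proj.map ((H.incl v).chartCoordHom (H.nonempty_frame hr v) W) (H.embeds hr v W)) =
      (Proj.basicOpen (coordGrading (𝔈.φ (TrivAffine.image (H.nonempty_frame hr v) W).affine))
        (H.imageVar hr v W v 0) : Set _) :=
  JordanChart.isOpenImmersion_projMap (H.jordanChart_image hr v W)
    (H.jordanChart_block W.affine v) (openInv_bijective W.1)
    ((H.incl v).chartCoordHom_algebraMap _ W) (H.chartCoordHom_var hr v W) (H.embeds hr v W)

theorem isOpenImmersion_chartHom (v : Fin s) (W : TrivAffine (H.block v)) :
    IsOpenImmersion (HiggsHom.chartHom (H.embeds hr v) W) :=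
  (H.projMap_chartCoordHom hr v W).1

/-- The image of the Higgs Grassmannian of a block is the locus where the first coordinate of the
block does not vanish. -/
theorem mem_range_chartHom (v : Fin s) (W : TrivAffine (H.block v))
    (x : Proj (coordGrading (𝔈.φ (TrivAffine.image (H.nonempty_frame hr v) W).affine))) :
    (∃ y, HiggsHom.chartHom (H.embeds hr v) W y = x) ↔
      x ∈ Proj.basicOpen (coordGrading (𝔈.φ (TrivAffine.image (H.nonempty_frame hr v) W).affine))
        (H.imageVar hr v W v 0) :=
  Set.ext_iff.mp (H.projMap_chartCoordHom hr v W).2 x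

variable [Smooth (X ↘ Spec (.of ℂ))]

/-- The morphism that sends an invariant line in the bundle of a block to the same line in `E`. -/
def hgrassIncl (v : Fin s) : Hgrass (H.block v) ⟶ Hgrass 𝔈 := HiggsHom.hgrass (H.embeds hr v)

theorem hgrassIncl_proj (v : Fin s) :
    H.hgrassIncl hr v ≫ Hgrass.proj 𝔈 = Hgrass.proj (H.block v) ≫ U.ι :=
  HiggsHom.hgrass_proj _

theorem hgrassIncl_proj_apply (v : Fin s) (x : Hgrass (H.block v)) :
    Hgrass.proj 𝔈 (H.hgrassIncl hr v x) = U.ι (Hgrass.proj (H.block v) x) :=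
  congr($(H.hgrassIncl_proj hr v) x)

theorem ι_hgrassIncl_apply (v : Fin s) (W : TrivAffine (H.block v)) (x : chart (H.block v) W) :
    H.hgrassIncl hr v (Hgrass.ι (H.block v) W x) =
      Hgrass.ι 𝔈 (TrivAffine.image (H.nonempty_frame hr v) W)
        (HiggsHom.chartHom (H.embeds hr v) W x) :=
  congr($(HiggsHom.ι_hgrass (H.embeds hr v) W) x)

/-- Both projections are compatible, so injectivity can be checked over one affine open subset of
`U`. -/
theorem hgrassIncl_injective (v : Fin s) : Function.Injective (H.hgrassIncl hr v) := by
  intro x y hxy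
  have h1 : Hgrass.proj (H.block v) x = Hgrass.proj (H.block v) y := by
    apply U.ι.isOpenEmbedding.injective
    rw [← H.hgrassIncl_proj_apply hr, ← H.hgrassIncl_proj_apply hr, hxy]
  obtain ⟨W, hW⟩ := TrivAffine.exists_mem (H.block v) (Hgrass.proj (H.block v) x)
  obtain ⟨p, rfl⟩ := Hgrass.exists_ι hW
  obtain ⟨q, rfl⟩ := Hgrass.exists_ι (h1 ▸ hW)
  rw [H.ι_hgrassIncl_apply, H.ι_hgrassIncl_apply] at hxy
  have := H.isOpenImmersion_chartHom hr v W
  rw [(HiggsHom.chartHom (H.embeds hr v) W).isOpenEmbedding.injective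
    ((Hgrass.ι 𝔈 _).isOpenEmbedding.injective hxy)]

instance (v : Fin s) : IsOpenImmersion (H.hgrassIncl hr v) := by
  refine IsOpenImmersion.of_forall_source_exists _ (H.hgrassIncl_injective hr v) fun x => ?_
  obtain ⟨W, hW⟩ := TrivAffine.exists_mem (H.block v) (Hgrass.proj (H.block v) x)
  obtain ⟨p, hp⟩ := Hgrass.exists_ι hW
  refine ⟨_, Hgrass.ι (H.block v) W, inferInstance, ⟨p, hp⟩, ?_⟩
  have := H.isOpenImmersion_chartHom hr v W
  rw [hgrassIncl, HiggsHom.ι_hgrass]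
  infer_instance

theorem disjoint_range_hgrassIncl :
    Pairwise (Function.onFun Disjoint fun v => Set.range (H.hgrassIncl hr v)) := by
  refine fun v w hvw => Set.disjoint_left.mpr ?_
  rintro _ ⟨x, rfl⟩ ⟨y, hxy⟩
  have h1 : Hgrass.proj (H.block v) x = Hgrass.proj (H.block w) y := by
    apply U.ι.isOpenEmbedding.injective
    rw [← H.hgrassIncl_proj_apply hr, ← H.hgrassIncl_proj_apply hr, hxy]
  obtain ⟨W, hW, hx⟩ := exists_isAffineOpen_mem (Hgrass.proj (H.block v) x)
  obtain ⟨p, rfl⟩ := Hgrass.exists_ι (W := H.trivAffine v hW) hx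
  obtain ⟨q, rfl⟩ := Hgrass.exists_ι (W := H.trivAffine w hW) (h1 ▸ hx)
  rw [H.ι_hgrassIncl_apply, H.ι_hgrassIncl_apply] at hxy
  have h2 := (Hgrass.ι 𝔈 _).isOpenEmbedding.injective hxy
  have hp := (H.mem_range_chartHom hr v (H.trivAffine v hW) _).mp ⟨p, rfl⟩
  have hq := (H.mem_range_chartHom hr w (H.trivAffine w hW) _).mp ⟨q, rfl⟩
  rw [h2] at hq
  exact H.not_mem_basicOpen _ _ hvw _ hp hq

theorem exists_hgrassIncl_eq {x : Hgrass 𝔈} (hx : Hgrass.proj 𝔈 x ∈ U) :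
    ∃ v y, H.hgrassIncl hr v y = x := by
  obtain ⟨W, hW, h1⟩ := exists_isAffineOpen_mem (Y := U.toScheme) ⟨_, hx⟩
  let W' : TrivAffine 𝔈 := ⟨U.ι ''ᵁ W, hW.image_of_isOpenImmersion U.ι,
    ⟨(e.restrict (U.ι_image_le W)).reindex ((finCongr hr.symm).trans finSigmaFinEquiv.symm)⟩⟩
  obtain ⟨p, rfl⟩ := Hgrass.exists_ι (W := W') ⟨_, h1, rfl⟩
  obtain ⟨v, hv⟩ := H.exists_mem_basicOpen W'.affine (U.ι_image_le W) p
  obtain ⟨q, rfl⟩ := (H.mem_range_chartHom hr v (H.trivAffine v hW) _).mpr hv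
  exact ⟨v, _, H.ι_hgrassIncl_apply hr v _ q⟩

/-- Over `U`, the Higgs Grassmannian is the disjoint union of those of the blocks. -/
theorem isPullback_sigmaDesc : IsPullback (Sigma.desc (H.hgrassIncl hr))
    (Sigma.desc fun v => Hgrass.proj (H.block v)) (Hgrass.proj 𝔈) U.ι := by
  have := isOpenImmersion_sigmaDesc _ (H.hgrassIncl hr) (H.disjoint_range_hgrassIncl hr)
  have hw : Sigma.desc (H.hgrassIncl hr) ≫ Hgrass.proj 𝔈 =
      (Sigma.desc fun v => Hgrass.proj (H.block v)) ≫ U.ι := by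
    refine Sigma.hom_ext _ _ fun v => ?_
    rw [Sigma.ι_desc_assoc, Sigma.ι_desc_assoc, H.hgrassIncl_proj]
  refine (IsOpenImmersion.isPullback _ _ _ _ hw ?_).flip
  rw [Scheme.Opens.opensRange_ι]
  refine le_antisymm (fun x hx => ?_) ?_
  · obtain ⟨v, y, rfl⟩ := H.exists_hgrassIncl_eq hr hx
    exact ⟨Sigma.ι (fun v => Hgrass (H.block v)) v y,
      congr($(Sigma.ι_desc (H.hgrassIncl hr) v) y)⟩
  · rintro _ ⟨y, rfl⟩
    have h1 := congr($hw y)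
    change Hgrass.proj 𝔈 (Sigma.desc (H.hgrassIncl hr) y) ∈ U
    refine Set.mem_of_eq_of_mem h1 ?_
    exact ((Sigma.desc fun v => Hgrass.proj (H.block v)) y).2

end IsJordan

end Blocks

/-! ### Homogeneous coordinates on the Higgs Grassmannian of a block -/

section MatrixHom

attribute [local instance] MvPolynomial.gradedAlgebra

variable {A B T : Type} [CommRing A] [CommRing B] [CommRing T] [Algebra B T] {d : ℕ}

theorem matrixRing_hom_ext {M : Matrix (Fin d) (Fin d) A} {g h : MatrixRing M →+* T}
    (h1 : ∀ a, g (algebraMap A _ a) = h (algebraMap A _ a))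
    (h2 : ∀ a, g (matrixVar M a) = h (matrixVar M a)) : g = h :=
  Ideal.Quotient.ringHom_ext (MvPolynomial.ringHom_ext h1 h2)

/-- Evaluation of a form of degree `m` at elements of degree one has degree `m`. -/
theorem eval₂Hom_mem {𝒯 : ℕ → Submodule B T} [GradedAlgebra 𝒯] (σ : A →+* B) {x : Fin d → T}
    (hx : ∀ a, x a ∈ 𝒯 1) {m : ℕ} {p : MvPolynomial (Fin d) A} (hp : p.IsHomogeneous m) :
    MvPolynomial.eval₂Hom ((algebraMap B T).comp σ) x p ∈ 𝒯 m := by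
  rw [MvPolynomial.coe_eval₂Hom, MvPolynomial.eval₂_eq']
  refine sum_mem fun k hk => ?_
  have h1 : ∏ a, x a ^ k a ∈ 𝒯 (∑ a, k a) :=
    SetLike.prod_mem_graded _ _ _ fun a _ => by
      simpa only [smul_eq_mul, mul_one] using SetLike.pow_mem_graded (k a) (hx a)
  have h2 : ∑ a, k a = m := by
    rw [← hp (MvPolynomial.mem_support_iff.mp hk), Finsupp.weight_apply, Finsupp.sum_fintype]
    · simp
    · simp
  rw [h2] at h1
  rw [RingHom.comp_apply, ← Algebra.smul_def]
  exact (𝒯 m).smul_mem _ h1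

namespace JordanChart

variable {𝒯 : ℕ → Submodule B T} [GradedAlgebra 𝒯] {z : ℕ → T} {Y : Set T}

/-- The homomorphism from the homogeneous coordinate ring of `V_M`, where `M` is a Jordan block,
that sends the variables to the coordinates of a chart. -/
def matrixHom (H : JordanChart 𝒯 d z Y) (σ : A →+* B) (c : A) :
    matrixGrading (jordanBlock c d) →+*ᵍ 𝒯 where
  toRingHom := Ideal.Quotient.lift _
    (MvPolynomial.eval₂Hom ((algebraMap B T).comp σ) fun a : Fin d => z a) (by
      change matrixIdeal (jordanBlock c d) ≤ RingHom.ker _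
      refine Ideal.span_le.mpr ?_
      rintro _ ⟨i, j, -, rfl⟩
      have h1 : ∀ i, MvPolynomial.eval₂Hom ((algebraMap B T).comp σ) (fun a : Fin d => z a)
          (extendZero MvPolynomial.X i) = z i := by
        intro i
        rw [map_extendZero]
        by_cases hi : i < d
        · rw [extendZero, dif_pos hi]; exact MvPolynomial.eval₂_X _ _ _
        · rw [extendZero_of_le _ (not_lt.mp hi), H.eq_zero _ (not_lt.mp hi)]
      rw [SetLike.mem_coe, RingHom.mem_ker, matrixRel_jordanBlock,
        ← extendZero_fin MvPolynomial.X i, ← extendZero_fin MvPolynomial.X j]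
      simp only [map_sub, map_mul, h1]
      rw [H.rel, mul_comm, sub_self])
  map_mem := by
    rintro m _ ⟨x, hx, rfl⟩
    exact eval₂Hom_mem σ (fun a => H.mem a) hx

theorem matrixHom_algebraMap (H : JordanChart 𝒯 d z Y) (σ : A →+* B) (c a : A) :
    H.matrixHom σ c (algebraMap A _ a) = algebraMap B T (σ a) :=
  MvPolynomial.eval₂_C _ _ _

theorem matrixHom_matrixVar (H : JordanChart 𝒯 d z Y) (σ : A →+* B) (c : A) (a : Fin d) :
    H.matrixHom σ c (matrixVar _ a) = z a :=
  MvPolynomial.eval₂_X _ _ _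

theorem matrixHom_extendZero (H : JordanChart 𝒯 d z Y) (σ : A →+* B) (c : A) (i : ℕ) :
    H.matrixHom σ c (extendZero (matrixVar _) i) = z i := by
  rw [map_extendZero]
  by_cases hi : i < d
  · rw [extendZero, dif_pos hi, H.matrixHom_matrixVar]
  · rw [extendZero_of_le _ (not_lt.mp hi), H.eq_zero _ (not_lt.mp hi)]

end JordanChart

end MatrixHom

section CoverIso

/-- A morphism `Y ⟶ Z` is an isomorphism if it is one over the members of an open cover of a base
of `Z`. -/
theorem isIso_of_isPullback_cover {S Y Z : Scheme.{0}} (f : Y ⟶ Z) (p : Z ⟶ S) (𝒰 : S.OpenCover)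
    (h : ∀ i, ∃ (P : Scheme.{0}) (a : P ⟶ 𝒰.X i) (b : P ⟶ Y),
      IsPullback a b (𝒰.f i) (f ≫ p) ∧ IsPullback a (b ≫ f) (𝒰.f i) p) : IsIso f := by
  refine IsZariskiLocalAtTarget.of_openCover (P := MorphismProperty.isomorphisms Scheme.{0})
    (𝒰.pullback₁ p) fun i => ?_
  obtain ⟨P, a, b, h1, h2⟩ := h i
  have h3 := IsPullback.of_hasPullback p (𝒰.f i)
  have h4 := (IsPullback.of_hasPullback f (pullback.fst p (𝒰.f i))).paste_vert h3
  let u := h1.flip.isoIsPullback _ _ h4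
  let w := h2.flip.isoIsPullback _ _ h3
  have hu : u.hom ≫ pullback.snd f (pullback.fst p (𝒰.f i)) = w.hom := by
    refine pullback.hom_ext ?_ ?_
    · rw [Category.assoc, ← pullback.condition, IsPullback.isoIsPullback_hom_fst,
        IsPullback.isoIsPullback_hom_fst_assoc]
    · rw [Category.assoc, IsPullback.isoIsPullback_hom_snd, IsPullback.isoIsPullback_hom_snd]
  change IsIso (pullback.snd f (pullback.fst p (𝒰.f i)))
  rw [(Iso.eq_inv_comp u).mpr hu]
  infer_instance

end CoverIso

section Theta

theorem fromSpec_toSpecΓ {X : Scheme.{0}} {U : X.Opens} {W : U.toScheme.Opens}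
    (hW : IsAffineOpen W) :
    hW.fromSpec ≫ U.toSpecΓ = Spec.map (CommRingCat.ofHom (toOpen W)) := by
  rw [Scheme.Opens.toSpecΓ, ← Category.assoc, IsAffineOpen.fromSpec_toSpecΓ, ← Spec.map_comp]
  congr 1
  refine Eq.trans ?_ (Scheme.Opens.ι_appLE U U W fun x _ => x.2).symm
  rw [Scheme.Opens.topIso_inv]
  exact (X.presheaf.map_comp _ _).symm

/-- The coordinates with respect to a frame commute with restriction. -/
theorem Frame.coord_resMod {X : Scheme.{0}} [X.Over (Spec (.of ℂ))] {E : X.Modules}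
    {U V W : X.Opens} {κ : Type} [Fintype κ] (e : Frame E U κ) (hW : W ≤ U) (h : V ≤ W) (a : κ)
    (m : Γ(E, W)) :
    (e.basis (h.trans hW)).coord a (resMod E h m) = resAlg h ((e.basis hW).coord a m) := by
  classical
  conv_lhs => rw [← (e.basis hW).sum_repr m]
  simp only [map_sum, map_smulₛₗ, e.res_basis, Basis.coord_apply, Basis.repr_self,
    smul_eq_mul]
  rw [Finset.sum_eq_single a]
  · rw [Finsupp.single_eq_same]; exact mul_one _
  · intro i _ hi
    rw [Finsupp.single_eq_of_ne hi.symm]; exact mul_zero _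
  · exact fun h => (h (Finset.mem_univ _)).elim

variable {X : Scheme.{0}} [X.Over (Spec (.of ℂ))] {U : X.Opens}
  {r n s : ℕ} {d : Fin s → ℕ} {𝔈 : HiggsBundle X r}
  {e : Frame 𝔈.E U (Σ v : Fin s, Fin (d v))} {ω : CotangentFrame U n}
  {Φ : Fin n → Matrix (Σ v : Fin s, Fin (d v)) (Σ v : Fin s, Fin (d v)) Γ(X, U)}
  {c : Fin s → Γ(X, U)} {k₀ : Fin n} (H : IsJordan e ω Φ c k₀)

namespace IsJordan

/-- The homomorphism of coordinate rings given by the homogeneous coordinates of the frame. -/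
def blockHom (v : Fin s) (W : TrivAffine (H.block v)) :
    matrixGrading (jordanBlock (c v) (d v)) →+*ᵍ coordGrading ((H.block v).φ W.affine) :=
  (H.jordanChart_block W.affine v).matrixHom (toOpen W.1) (c v)

theorem blockHom_algebraMap (v : Fin s) (W : TrivAffine (H.block v)) (a : Γ(X, U)) :
    H.blockHom v W (algebraMap _ _ a) = algebraMap Γ(U, W.1) _ (toOpen W.1 a) :=
  (H.jordanChart_block W.affine v).matrixHom_algebraMap _ _ a

theorem blockHom_matrixVar (v : Fin s) (W : TrivAffine (H.block v)) (a : Fin (d v)) :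
    H.blockHom v W (matrixVar _ a) =
      coord _ (((H.frame v).basis (le_top (a := W.1))).coord a) :=
  ((H.jordanChart_block W.affine v).matrixHom_matrixVar _ _ a).trans (extendZero_fin _ a)

theorem blockHom_irrelevant (v : Fin s) (W : TrivAffine (H.block v)) :
    HomogeneousIdeal.irrelevant (coordGrading ((H.block v).φ W.affine)) ≤
      (HomogeneousIdeal.irrelevant (matrixGrading (jordanBlock (c v) (d v)))).map
        (H.blockHom v W) :=
  (jordanChart_matrixGrading (c v)).irrelevant_le_map (H.jordanChart_block W.affine v)
    ((H.jordanChart_block W.affine v).matrixHom_extendZero _ _)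

variable [Smooth (X ↘ Spec (.of ℂ))]

/-- The homogeneous coordinates of the frame are compatible with restriction to smaller open sets.
-/
theorem coordRes_comp_blockHom (v : Fin s) {V W : TrivAffine (H.block v)} (h : V ≤ W) :
    (coordRes h).comp (H.blockHom v W) = H.blockHom v V := by
  have h1 : ((coordRes h).comp (H.blockHom v W)).toRingHom = (H.blockHom v V).toRingHom := by
    refine matrixRing_hom_ext (fun a => ?_) fun a => ?_
    · refine ((congrArg (coordRes h) (H.blockHom_algebraMap v W a)).trans
        (coordRes_algebraMap h _)).trans (Eq.trans ?_ (H.blockHom_algebraMap v V a).symm)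
      exact congrArg _ (resAlg_toOpen _ a)
    · refine ((congrArg (coordRes h) (H.blockHom_matrixVar v W a)).trans
        (coordRes_coord h _ (((H.frame v).basis (le_top (a := V.1))).coord a) fun m => ?_)).trans
          (H.blockHom_matrixVar v V a).symm
      exact (H.frame v).coord_resMod _ _ _ _
  exact GradedRingHom.ext fun x => congr($h1 x)

/-- The homogeneous coordinates of the frame as a morphism to `Proj`. -/
def toProj (v : Fin s) : Hgrass (H.block v) ⟶ Proj (matrixGrading (jordanBlock (c v) (d v))) :=
  Hgrass.desc (fun W => Proj.map (H.blockHom v W) (H.blockHom_irrelevant v W)) fun V W h =>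
    (projMap_eq_comp (H.coordRes_comp_blockHom v h).symm (H.blockHom_irrelevant v W)
      (coordRes_irrelevant h) (H.blockHom_irrelevant v V)).symm

theorem ι_toProj (v : Fin s) (W : TrivAffine (H.block v)) :
    Hgrass.ι (H.block v) W ≫ H.toProj v = Proj.map (H.blockHom v W) (H.blockHom_irrelevant v W) :=
  Hgrass.ι_desc _ _ W

/-- Over an affine open subset, the Higgs Grassmannian of a block is the base change of `Proj` of
the coordinate ring of `V_M`. -/
theorem isPullback_chart (v : Fin s) (W : TrivAffine (H.block v)) :
    IsPullback (chartToBase (H.block v) W) (Hgrass.ι (H.block v) W ≫ H.toProj v)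
      (W.1.ι ≫ U.toSpecΓ) (projToSpec (matrixGrading (jordanBlock (c v) (d v)))) := by
  rw [H.ι_toProj]
  refine ((jordanChart_matrixGrading (c v)).isPullback_projMap (H.jordanChart_block W.affine v)
    (H.blockHom_algebraMap v W) ((H.jordanChart_block W.affine v).matrixHom_extendZero _ _)
    (H.blockHom_irrelevant v W)).of_iso (Iso.refl _) W.affine.isoSpec.symm (Iso.refl _)
    (Iso.refl _) ?_ ?_ ?_ ?_
  · exact (Category.id_comp _).symm
  · exact (Category.comp_id _).trans (Category.id_comp _).symm
  · refine (Category.comp_id _).trans ?_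
    rw [← fromSpec_toSpecΓ W.affine, IsAffineOpen.fromSpec, Category.assoc]
    rfl
  · exact (Category.comp_id _).trans (Category.id_comp _).symm

theorem toProj_projToSpec (v : Fin s) : Hgrass.proj (H.block v) ≫ U.toSpecΓ =
    H.toProj v ≫ projToSpec (matrixGrading (jordanBlock (c v) (d v))) := by
  refine Hgrass.hom_ext fun W => ?_
  rw [← Category.assoc, ← (Hgrass.isPullback_ι (H.block v) W).w, Category.assoc,
    (H.isPullback_chart v W).w, Category.assoc]

/-- The homogeneous coordinates of the frame as a morphism to `V_M`. -/
def toVM (v : Fin s) : Hgrass (H.block v) ⟶ VM U (jordanBlock (c v) (d v)) :=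
  pullback.lift (Hgrass.proj (H.block v)) (H.toProj v) (H.toProj_projToSpec v)

theorem toVM_proj (v : Fin s) : H.toVM v ≫ VM.proj U _ = Hgrass.proj (H.block v) :=
  pullback.lift_fst _ _ _

theorem toVM_toProj (v : Fin s) : H.toVM v ≫ VM.toProj U _ = H.toProj v :=
  pullback.lift_snd _ _ _

/-- Over each chart, both sides are the same base change of `Proj` of the coordinate ring of
`V_M`. -/
instance (v : Fin s) : IsIso (H.toVM v) := by
  refine isIso_of_isPullback_cover _ (VM.proj U _) (TrivAffine.cover (H.block v)) fun W => ?_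
  refine ⟨_, chartToBase (H.block v) W, Hgrass.ι (H.block v) W, ?_, ?_⟩
  · rw [H.toVM_proj]
    exact Hgrass.isPullback_ι (H.block v) W
  · have h1 : IsPullback (VM.proj U (jordanBlock (c v) (d v))) (VM.toProj U _) U.toSpecΓ
      (projToSpec (matrixGrading (jordanBlock (c v) (d v)))) := IsPullback.of_hasPullback _ _
    have h2 := H.isPullback_chart v W
    rw [← H.toVM_toProj, ← Category.assoc] at h2
    refine IsPullback.of_bot h2 ?_ h1
    rw [Category.assoc, H.toVM_proj]
    exact (Hgrass.isPullback_ι (H.block v) W).w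

/-- The isomorphism of the Higgs Grassmannian of a block with `V_M` given by the homogeneous
coordinates of the frame. -/
def isoVM (v : Fin s) : Hgrass (H.block v) ≅ VM U (jordanBlock (c v) (d v)) := asIso (H.toVM v)

theorem isCoordinates_isoVM (v : Fin s) : IsCoordinates (H.isoVM v).hom (H.frame v) :=
  ⟨H.toVM_proj v, fun W => ⟨H.blockHom v W, H.blockHom_irrelevant v W, H.blockHom_algebraMap v W,
    H.blockHom_matrixVar v W,
    (congrArg (Hgrass.ι (H.block v) W ≫ ·) (H.toVM_toProj v)).trans (H.ι_toProj v W)⟩⟩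

end IsJordan

end Theta

/-! ### Fibers -/

section FiniteOfDegree

/-- A scheme over `K` that is isomorphic to the spectrum of a finite algebra over a ring isomorphic
to `K` is finite, and its degree is the dimension of the algebra. -/
theorem isFiniteOfDegree_of_iso {Z : Scheme.{0}} {K : CommRingCat.{0}} {K' R : Type} [CommRing K']
    [CommRing R] [Algebra K' R] [Module.Finite K' R] {z : Z ⟶ Spec K} (ε : Z ≅ Spec (.of R))
    (τ : K ⟶ .of K') [IsIso τ]
    (hz : z = ε.hom ≫ Spec.map (CommRingCat.ofHom (algebraMap K' R)) ≫ Spec.map τ) :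
    IsFiniteOfDegree z (Module.finrank K' R) where
  finite := by
    have : IsFinite (Spec.map (CommRingCat.ofHom (algebraMap K' R))) := by
      rw [IsFinite.SpecMap_iff]
      exact RingHom.finite_algebraMap.mpr inferInstance
    rw [hz]
    infer_instance
  degree := by
    let := ((Scheme.ΓSpecIso K).inv ≫ z.appTop).hom.toAlgebra
    let i : K ≃+* K' := (asIso τ).commRingCatIsoToRingEquiv
    let ρ : CommRingCat.of R ≅ Γ(Z, ⊤) := (Scheme.ΓSpecIso (.of R)).symm ≪≫
      (Scheme.Γ.mapIso ε.op)
    refine Algebra.finrank_eq_of_equiv_equiv i ρ.symm.commRingCatIsoToRingEquiv ?_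
    have h1 : (Scheme.ΓSpecIso K).inv ≫ z.appTop =
        (τ ≫ CommRingCat.ofHom (algebraMap K' R)) ≫ ρ.hom := by
      rw [hz, ← Spec.map_comp, Scheme.Hom.comp_appTop]
      exact (Scheme.ΓSpecIso_inv_naturality_assoc _ _).symm
    have h2 : ((Scheme.ΓSpecIso K).inv ≫ z.appTop) ≫ ρ.inv =
        τ ≫ CommRingCat.ofHom (algebraMap K' R) := by
      rw [h1, Category.assoc, Iso.hom_inv_id, Category.comp_id]
    exact congrArg CommRingCat.Hom.hom h2.symm

end FiniteOfDegree

section TruncField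

variable {K : Type} [CommRing K] {d : ℕ}

instance Trunc.free : Module.Free K (Trunc K d) :=
  .of_basis (AdjoinRoot.powerBasis' (Polynomial.monic_X_pow d)).basis

instance Trunc.finite : Module.Finite K (Trunc K d) :=
  (AdjoinRoot.powerBasis' (Polynomial.monic_X_pow d)).finite

theorem Trunc.finrank_eq [Nontrivial K] : Module.finrank K (Trunc K d) = d := by
  rw [(AdjoinRoot.powerBasis' (Polynomial.monic_X_pow d)).finrank, AdjoinRoot.powerBasis'_dim,
    Polynomial.natDegree_X_pow]

/-- The constant term of a polynomial splits off. -/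
theorem Trunc.exists_eq (x : Trunc K d) : ∃ (a : K) (y : Trunc K d),
    x = algebraMap K _ a + Trunc.t K d * y := by
  obtain ⟨p, rfl⟩ := AdjoinRoot.mk_surjective x
  refine ⟨p.coeff 0, AdjoinRoot.mk _ p.divX, ?_⟩
  conv_lhs => rw [← Polynomial.X_mul_divX_add p]
  rw [map_add, map_mul, AdjoinRoot.mk_X, AdjoinRoot.mk_C, add_comm]
  rfl

/-- The ideal generated by `t` is the only prime ideal of `K[t] / (t ^ d)`. -/
theorem Trunc.eq_span_t (hK : IsField K) (p : Ideal (Trunc K d)) [hp : p.IsPrime] :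
    p = Ideal.span {Trunc.t K d} := by
  have ht : Trunc.t K d ∈ p :=
    hp.mem_of_pow_mem d (by rw [Trunc.t_pow_eq_zero le_rfl]; exact zero_mem _)
  refine le_antisymm (fun x hx => ?_) ((Ideal.span_singleton_le_iff_mem _).mpr ht)
  obtain ⟨a, y, rfl⟩ := Trunc.exists_eq x
  have ha : algebraMap K (Trunc K d) a ∈ p := by
    simpa using sub_mem hx (Ideal.mul_mem_right y p ht)
  have : a = 0 := by
    by_contra h
    obtain ⟨b, hb⟩ := hK.mul_inv_cancel h
    exact hp.ne_top (Ideal.eq_top_of_isUnit_mem _ ha ((IsUnit.of_mul_eq_one b hb).map _))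
  rw [this, map_zero, zero_add]
  exact Ideal.mul_mem_right _ _ (Ideal.mem_span_singleton_self _)

theorem Trunc.subsingleton_spec (hK : IsField K) : Subsingleton (Spec (.of (Trunc K d))) :=
  ⟨fun p q => PrimeSpectrum.ext (by
    have := p.isPrime
    have := q.isPrime
    rw [Trunc.eq_span_t hK p.asIdeal, Trunc.eq_span_t hK q.asIdeal])⟩

end TruncField

section Curvilinear

/-- The cotangent space of a local ring with principal maximal ideal is generated by one element. -/
theorem rank_cotangentSpace_le_one {R : Type} [CommRing R] [IsLocalRing R] (t : R)
    (h : IsLocalRing.maximalIdeal R = Ideal.span {t}) :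
    Module.rank (IsLocalRing.ResidueField R) (IsLocalRing.CotangentSpace R) ≤ 1 := by
  have ht : t ∈ IsLocalRing.maximalIdeal R := h ▸ Ideal.mem_span_singleton_self t
  refine rank_le_one_iff.mpr ⟨Ideal.toCotangent _ ⟨t, ht⟩, fun v => ?_⟩
  obtain ⟨⟨x, hx⟩, rfl⟩ := Ideal.toCotangent_surjective _ v
  rw [h] at hx
  obtain ⟨a, rfl⟩ := Ideal.mem_span_singleton'.mp hx
  refine ⟨IsLocalRing.residue R a, ?_⟩
  exact ((IsLocalRing.maximalIdeal R).toCotangent.map_smul a ⟨t, ht⟩).symm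

theorem maximalIdeal_eq_span_of_ringEquiv {R S : Type} [CommRing R] [CommRing S] [IsLocalRing R]
    [IsLocalRing S] (e : R ≃+* S) {t : R} (h : IsLocalRing.maximalIdeal R = Ideal.span {t}) :
    IsLocalRing.maximalIdeal S = Ideal.span {e t} := by
  ext x
  obtain ⟨x, rfl⟩ := e.surjective x
  rw [IsLocalRing.mem_maximalIdeal, mem_nonunits_iff, MulEquiv.isUnit_map, ← mem_nonunits_iff,
    ← IsLocalRing.mem_maximalIdeal, h, Ideal.mem_span_singleton, Ideal.mem_span_singleton]
  exact (map_dvd_iff e).symm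

/-- The spectrum of `K[t] / (t ^ d)` is curvilinear. -/
theorem isCurvilinear_of_iso {Z : Scheme.{0}} {K : Type} [CommRing K] (hK : IsField K) {d : ℕ}
    (ε : Z ≅ Spec (.of (Trunc K d))) : IsCurvilinear Z := by
  intro z
  let p : PrimeSpectrum (Trunc K d) := ε.hom z
  let i : CommRingCat.of (Localization.AtPrime p.asIdeal) ≅ Z.presheaf.stalk z :=
    (Spec.stalkIso (.of (Trunc K d)) p).symm ≪≫ asIso (ε.hom.stalkMap z)
  refine rank_cotangentSpace_le_one _
    (maximalIdeal_eq_span_of_ringEquiv i.commRingCatIsoToRingEquiv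
      (t := algebraMap _ _ (Trunc.t K d)) ?_)
  rw [← Set.image_singleton, ← Ideal.map_span, ← Trunc.eq_span_t hK p.asIdeal]
  exact (IsLocalization.AtPrime.map_eq_maximalIdeal p.asIdeal _).symm

end Curvilinear

section FiberTrunc

/-- The fibers of a base change of `Spec A[t] / (t ^ d)` are the spectra of `κ[t] / (t ^ d)`, where
`κ` is the residue field. -/
theorem exists_fiber_iso {Y V : Scheme.{0}} {A : Type} [CommRing A] {d : ℕ} {f : Y ⟶ V}
    {g : Y ⟶ Spec (.of (Trunc A d))} {b : V ⟶ Spec (.of A)}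
    (h : IsPullback f g b (Spec.map (CommRingCat.ofHom (algebraMap A (Trunc A d))))) (y : V) :
    ∃ ε : f.fiber y ≅ Spec (.of (Trunc (V.residueField y) d)),
      ε.hom ≫ Spec.map (CommRingCat.ofHom (algebraMap (V.residueField y) (Trunc _ d))) =
        f.fiberToSpecResidueField y := by
  have h1 : IsPullback (f.fiberι y) (f.fiberToSpecResidueField y) f (V.fromSpecResidueField y) :=
    IsPullback.of_hasPullback _ _
  have h2 := (h1.paste_horiz h.flip).flip
  have h3 := Trunc.isPullback_spec (Spec.preimage (V.fromSpecResidueField y ≫ b)).hom d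
  rw [CommRingCat.ofHom_hom, Spec.map_preimage] at h3
  exact ⟨h2.isoIsPullback _ _ h3, IsPullback.isoIsPullback_hom_fst _ _ _ _⟩

end FiberTrunc

section FiberSum

variable {ι : Type} {X V Z : Scheme.{0}} {Y : ι → Scheme.{0}} {p : Z ⟶ X} {q : ∀ i, Y i ⟶ V}
  {κ : ∀ i, Y i ⟶ Z} {u : V ⟶ X} (h : ∀ i, κ i ≫ p = q i ≫ u) (y : V)

/-- The morphism from the fiber of `q i` over `y` to the fiber of `p` over `u y` induced by
`κ i`. -/
def fiberMap (i : ι) : (q i).fiber y ⟶ p.fiber (u y) :=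
  pullback.lift ((q i).fiberι y ≫ κ i)
    ((q i).fiberToSpecResidueField y ≫ Spec.map (u.residueFieldMap y)) (by
      rw [Category.assoc, h, Category.assoc,
        Scheme.Hom.SpecMap_residueFieldMap_fromSpecResidueField,
        ← Category.assoc, ← Category.assoc, Scheme.Hom.fiber_fac])

theorem fiberMap_fiberι (i : ι) :
    fiberMap h y i ≫ p.fiberι (u y) = (q i).fiberι y ≫ κ i := pullback.lift_fst _ _ _

theorem fiberMap_toSpec (i : ι) : fiberMap h y i ≫ p.fiberToSpecResidueField (u y) =
    (q i).fiberToSpecResidueField y ≫ Spec.map (u.residueFieldMap y) := pullback.lift_snd _ _ _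

/-- The open immersion `u` does not change residue fields, so the fiber of `q i` is the part of the
fiber of `p` that lies over `κ i`. -/
theorem isPullback_fiberMap [IsOpenImmersion u] (i : ι) :
    IsPullback ((q i).fiberι y) (fiberMap h y i) (κ i) (p.fiberι (u y)) := by
  have h1 : IsPullback (V.fromSpecResidueField y) (Spec.map (u.residueFieldMap y)) u
      (X.fromSpecResidueField (u y)) :=
    .of_vert_isIso_mono ⟨(Scheme.Hom.SpecMap_residueFieldMap_fromSpecResidueField _ _).symm⟩
  have h2 := (IsPullback.of_hasPullback (q i) (V.fromSpecResidueField y)).paste_vert h1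
  have h3 : IsPullback ((q i).fiberι y) (fiberMap h y i ≫ p.fiberToSpecResidueField (u y))
      (κ i ≫ p) (X.fromSpecResidueField (u y)) := by
    rw [h, fiberMap_toSpec]; exact h2
  exact IsPullback.of_bot h3 (fiberMap_fiberι h y i).symm (IsPullback.of_hasPullback _ _)

/-- The fiber of a disjoint union is the disjoint union of the fibers. -/
theorem nonempty_isColimit_fiber [IsOpenImmersion u] [∀ i, IsOpenImmersion (κ i)]
    (hdisj : Pairwise (Function.onFun Disjoint fun i => Set.range (κ i)))
    (hcov : ∀ x, p x = u y → ∃ i w, κ i w = x) :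
    Nonempty (IsColimit (Cofan.mk (p.fiber (u y)) (fiberMap h y))) := by
  have h1 : ∀ i, IsOpenImmersion (fiberMap h y i) := fun i =>
    MorphismProperty.of_isPullback (isPullback_fiberMap h y i) inferInstance
  refine nonempty_isColimit_cofanMk_of _ (top_le_iff.mp fun x _ => ?_) fun i j hij => ?_
  · have h2 : p (p.fiberι (u y) x) = u y := by
      have : p.fiberι (u y) x ∈ Set.range (p.fiberι (u y)) := ⟨x, rfl⟩
      rwa [Scheme.Hom.range_fiberι] at this
    obtain ⟨i, w, hw⟩ := hcov _ h2
    obtain ⟨z, -, hz⟩ := Scheme.exists_preimage_of_isPullback (isPullback_fiberMap h y i) w x hw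
    exact TopologicalSpace.Opens.mem_iSup.mpr ⟨i, z, hz⟩
  · refine disjoint_iff.mpr (le_bot_iff.mp ?_)
    rintro _ ⟨⟨z, rfl⟩, ⟨w, hw⟩⟩
    refine Set.disjoint_left.mp (hdisj hij) ⟨_, congr($(fiberMap_fiberι h y i) z).symm⟩
      ⟨(q j).fiberι y w, ?_⟩
    refine congr($(fiberMap_fiberι h y j) w).symm.trans ?_
    exact congrArg (p.fiberι (u y)) hw

end FiberSum

section BlockFibers

variable {X : Scheme.{0}} [X.Over (Spec (.of ℂ))] [Smooth (X ↘ Spec (.of ℂ))] {U : X.Opens}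
  {r n s : ℕ} {d : Fin s → ℕ} {𝔈 : HiggsBundle X r}
  {e : Frame 𝔈.E U (Σ v : Fin s, Fin (d v))} {ω : CotangentFrame U n}
  {Φ : Fin n → Matrix (Σ v : Fin s, Fin (d v)) (Σ v : Fin s, Fin (d v)) Γ(X, U)}
  {c : Fin s → Γ(X, U)} {k₀ : Fin n} (H : IsJordan e ω Φ c k₀) (hr : ∑ v, d v = r)
  (y : U.toScheme)

namespace IsJordan

/-- The fibers of the Higgs Grassmannian of a block are spectra of truncated polynomial rings. -/
theorem exists_fiber_iso (v : Fin s) :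
    ∃ ε : (Hgrass.proj (H.block v)).fiber y ≅ Spec (.of (Trunc (U.toScheme.residueField y) (d v))),
      ε.hom ≫ Spec.map (CommRingCat.ofHom
        (algebraMap (U.toScheme.residueField y) (Trunc _ (d v)))) =
        (Hgrass.proj (H.block v)).fiberToSpecResidueField y := by
  have hM := jordanChart_matrixGrading (c v) (d := d v)
  have := hM.isIso_specι
  have h1 : IsPullback (VM.proj U (jordanBlock (c v) (d v))) (VM.toProj U _) U.toSpecΓ
    (projToSpec (matrixGrading (jordanBlock (c v) (d v)))) := IsPullback.of_hasPullback _ _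
  refine HiggsGrass.exists_fiber_iso (b := U.toSpecΓ)
    (g := H.toVM v ≫ VM.toProj U _ ≫ inv hM.specι) (h1.of_iso (asIso (H.toVM v)).symm (Iso.refl _)
      (asIso hM.specι).symm (Iso.refl _) ?_ ?_ ?_ ?_) y
  · rw [Iso.refl_hom, Category.comp_id, Iso.symm_hom, asIso_inv, ← H.toVM_proj,
      IsIso.inv_hom_id_assoc]
  · rw [Iso.symm_hom, asIso_inv, Iso.symm_hom, asIso_inv, IsIso.inv_hom_id_assoc]
  · exact (Category.comp_id _).trans (Category.id_comp _).symm
  · rw [Iso.refl_hom, Category.comp_id, Iso.symm_hom, asIso_inv, ← hM.specι_projToSpec,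
      IsIso.inv_hom_id_assoc]

theorem isField_residueField {V : Scheme.{0}} (y : V) : IsField (V.residueField y) :=
  Field.toIsField (IsLocalRing.ResidueField (V.presheaf.stalk y))

/-- The fiber of one block is the spectrum of `κ(y)[t] / (t ^ d v)`. -/
theorem block_fiber (v : Fin s) :
    IsFiniteOfDegree ((Hgrass.proj (H.block v)).fiberToSpecResidueField y) (d v) ∧
      IsCurvilinear ((Hgrass.proj (H.block v)).fiber y) ∧
      Subsingleton ((Hgrass.proj (H.block v)).fiber y) := by
  have hK := isField_residueField y
  have := hK.nontrivial
  obtain ⟨ε, hε⟩ := H.exists_fiber_iso y v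
  refine ⟨?_, isCurvilinear_of_iso hK ε, ?_⟩
  · have h1 := isFiniteOfDegree_of_iso (K' := U.toScheme.residueField y)
      (z := (Hgrass.proj (H.block v)).fiberToSpecResidueField y) ε
      (𝟙 (U.toScheme.residueField y)) (by
        refine hε.symm.trans (congrArg (ε.hom ≫ ·) ?_)
        exact ((congrArg _ (Spec.map_id _)).trans (Category.comp_id _)).symm)
    rwa [Trunc.finrank_eq] at h1
  · have := Trunc.subsingleton_spec hK (d := d v)
    exact ε.hom.homeomorph.injective.subsingleton

/-- The fibers over the points of `U` are the disjoint unions of the fibers of the blocks. -/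
def fiberIso : (∐ fun v => (Hgrass.proj (H.block v)).fiber y) ≅
    (Hgrass.proj 𝔈).fiber (U.ι y) :=
  (coproductIsCoproduct _).coconePointUniqueUpToIso
    (nonempty_isColimit_fiber (H.hgrassIncl_proj hr) y (H.disjoint_range_hgrassIncl hr)
      fun x hx => H.exists_hgrassIncl_eq hr (by rw [hx]; exact y.2)).some

theorem ι_fiberIso_hom (v : Fin s) :
    Sigma.ι (fun v => (Hgrass.proj (H.block v)).fiber y) v ≫ (H.fiberIso hr y).hom =
      fiberMap (H.hgrassIncl_proj hr) y v :=
  (coproductIsCoproduct _).comp_coconePointUniqueUpToIso_hom _ ⟨v⟩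

theorem ι_fiberIso_hom_fiberι (v : Fin s) :
    Sigma.ι (fun v => (Hgrass.proj (H.block v)).fiber y) v ≫ (H.fiberIso hr y).hom ≫
      (Hgrass.proj 𝔈).fiberι (U.ι y) = (Hgrass.proj (H.block v)).fiberι y ≫ H.hgrassIncl hr v := by
  rw [← Category.assoc, H.ι_fiberIso_hom, fiberMap_fiberι]

/-- The fiber is the spectrum of the product of the rings `κ(y)[t] / (t ^ d v)`, whose dimension is
the sum of the `d v`. -/
theorem isFiniteOfDegree_fiber (H : IsJordan e ω Φ c k₀) (hr : ∑ v, d v = r) (y : U.toScheme) :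
    IsFiniteOfDegree ((Hgrass.proj 𝔈).fiberToSpecResidueField (U.ι y)) r := by
  have hK := isField_residueField y
  have := hK.nontrivial
  choose ε hε using H.exists_fiber_iso y
  let R : Fin s → CommRingCat.{0} := fun v => .of (Trunc (U.toScheme.residueField y) (d v))
  let ψ : (Hgrass.proj 𝔈).fiber (U.ι y) ≅ Spec (.of (Π v, R v)) :=
    (H.fiberIso hr y).symm ≪≫ Sigma.mapIso ε ≪≫ asIso (sigmaSpec R)
  have h2 := isFiniteOfDegree_of_iso (K' := U.toScheme.residueField y)
    (z := (Hgrass.proj 𝔈).fiberToSpecResidueField (U.ι y)) (R := Π v, Trunc _ (d v)) ψ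
    (U.ι.residueFieldMap y) ?_
  · rw [Module.finrank_pi_fintype] at h2
    simp only [Trunc.finrank_eq] at h2
    rwa [hr] at h2
  · rw [← cancel_epi (H.fiberIso hr y).hom]
    refine Sigma.hom_ext _ _ fun v => ?_
    have h3 : Sigma.ι (fun v => (Hgrass.proj (H.block v)).fiber y) v ≫ (H.fiberIso hr y).hom ≫
        ψ.hom = (ε v).hom ≫ Spec.map (CommRingCat.ofHom (Pi.evalRingHom _ v)) := by
      rw [Iso.trans_hom, Iso.symm_hom, Iso.hom_inv_id_assoc, Iso.trans_hom, asIso_hom]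
      refine (Sigma.ι_map_assoc (fun v => (ε v).hom) v _).trans ?_
      exact congrArg _ (ι_sigmaSpec R v)
    have h4 : Spec.map (CommRingCat.ofHom (Pi.evalRingHom
          (fun v => Trunc (U.toScheme.residueField y) (d v)) v)) ≫
        Spec.map (CommRingCat.ofHom (algebraMap (U.toScheme.residueField y)
          (Π v, Trunc (U.toScheme.residueField y) (d v)))) =
        Spec.map (CommRingCat.ofHom (algebraMap (U.toScheme.residueField y)
          (Trunc (U.toScheme.residueField y) (d v)))) :=
      (Spec.map_comp _ _).symm
    refine ((Category.assoc _ _ _).symm.trans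
      (congrArg (· ≫ _) (H.ι_fiberIso_hom hr y v))).trans ?_
    refine (fiberMap_toSpec _ y v).trans ?_
    rw [← hε, ← h4]
    have h5 := congrArg (· ≫ Spec.map (CommRingCat.ofHom (algebraMap (U.toScheme.residueField y)
      (Π v, Trunc (U.toScheme.residueField y) (d v)))) ≫ Spec.map (U.ι.residueFieldMap y)) h3.symm
    simp only [Category.assoc] at h5 ⊢
    exact h5

end IsJordan

end BlockFibers

end

end HiggsGrass

open CategoryTheory Limits AlgebraicGeometry HiggsGrass

theorem mainTheorem3 {n r : ℕ} [NeZero n] (X : Scheme.{0}) [X.Over (Spec (.of ℂ))]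
    [Smooth (X ↘ Spec (.of ℂ))] [SmoothOfRelativeDimension n (X ↘ Spec (.of ℂ))]
    [IsSeparated (X ↘ Spec (.of ℂ))] [QuasiCompact (X ↘ Spec (.of ℂ))] [ConnectedSpace X]
    (𝔈 : HiggsBundle X r) (U : X.Opens)
    (s : ℕ) (d : Fin s → ℕ) (hd : ∀ v, 0 < d v) (hr : ∑ v, d v = r)
    (e : Frame 𝔈.E U (Σ v : Fin s, Fin (d v))) (ω : CotangentFrame U n)
    (Φ : Fin n → Matrix (Σ v : Fin s, Fin (d v)) (Σ v : Fin s, Fin (d v)) Γ(X, U))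
    (hΦ : Represents e ω Φ)
    (c : Fin s → Γ(X, U)) (hc : ∀ v w, v ≠ w → IsUnit (c v - c w))
    (hJ : Φ 0 = Matrix.blockDiagonal' fun v => jordanBlock (c v) (d v)) :
    ∃ (𝔉 : ∀ v, HiggsBundle U.toScheme (d v)) (i : ∀ v, HiggsHom (𝔉 v) 𝔈)
      (f : ∀ v, Frame (𝔉 v).E ⊤ (Fin (d v)))
      (κ : ∀ v, Hgrass (𝔉 v) ⟶ Hgrass 𝔈)
      (θ : ∀ v, Hgrass (𝔉 v) ≅ VM U (jordanBlock (c v) (d v))),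
      (∀ v, IsEigenSubbundle (i v) e (Φ 0) (c v)) ∧
      (∀ v a, inclSec (i v).hom ⊤ ((f v).sec a) =
        resMod 𝔈.E (U.ι_image_le ⊤) (e.sec ⟨v, a⟩)) ∧
      (∀ v, IsInducedBy (κ v) (i v)) ∧
      IsPullback (Sigma.desc κ) (Sigma.desc fun v => Hgrass.proj (𝔉 v)) (Hgrass.proj 𝔈) U.ι ∧
      (∀ v, IsCoordinates (θ v).hom (f v)) ∧
      ∀ y : U.toScheme,
        IsFiniteOfDegree ((Hgrass.proj 𝔈).fiberToSpecResidueField (U.ι y)) r ∧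
        (∀ v, IsFiniteOfDegree ((Hgrass.proj (𝔉 v)).fiberToSpecResidueField y) (d v) ∧
          IsCurvilinear ((Hgrass.proj (𝔉 v)).fiber y) ∧
          Subsingleton ((Hgrass.proj (𝔉 v)).fiber y)) ∧
        ∃ iso : (∐ fun v => (Hgrass.proj (𝔉 v)).fiber y) ≅ (Hgrass.proj 𝔈).fiber (U.ι y),
          ∀ v, Sigma.ι (fun v => (Hgrass.proj (𝔉 v)).fiber y) v ≫ iso.hom ≫
              (Hgrass.proj 𝔈).fiberι (U.ι y) =
            (Hgrass.proj (𝔉 v)).fiberι y ≫ κ v := by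
  have H : IsJordan e ω Φ c 0 := ⟨hΦ, hc, hJ⟩
  refine ⟨H.block, H.incl, H.frame, H.hgrassIncl hr, H.isoVM, H.isEigenSubbundle, fun v a => ?_,
    fun v => HiggsHom.isInducedBy_hgrass (H.embeds hr v), H.isPullback_sigmaDesc hr,
    H.isCoordinates_isoVM, fun y => ⟨H.isFiniteOfDegree_fiber hr y, H.block_fiber y,
      H.fiberIso hr y, H.ι_fiberIso_hom_fiberι hr y⟩⟩
  have h1 := H.inclSec_basis v ⊤ a
  rwa [Frame.basis_apply, Frame.basis_apply, resMod_refl] at h1
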